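/- Let $p$ be a prime. Consider the following question on $p$: suppose that $F$ is a field of characteristic $p$, that $H$ is a finite group with a normal $p$-complement $K>1$, that $V$ is a finite faithful completely reducible $FH$-module, and that $P\in\mathrm{Syl}_p(H)$; does there exist $v\in C_V(P)$ such that $|C_K(v)|^2<|K|$? Assume that this question has an affirmative answer (that is, such a $v$ exists for all such $F,H,K,V,P$). Let $G$ be a finite group, let $Z\trianglelefteq G$, and let $\lambda\in\mathrm{Irr}(Z)$ be a $G$-invariant irreducible complex character such that $o(\lambda)\lambda(1)$ is not divisible by $p$, where $o(\lambda)$ is the determinantal order of $\lambda$, i.e. the order of the linear character $\det\rho$ for a representation $\rho$ of $Z$ affording $\lambda$. Assume that $G/Z$ is $p$-solvable and that $O_{p'}(G/Z)=1$, where $O_{p'}$ denotes the largest normal subgroup of order prime to $p$. Let $\mathrm{Irr}(G|\lambda)$ be the set of irreducible complex characters $\chi$ of $G$ such that $\lambda$ is a constituent of the restriction $\chi_Z$. If there exists an integer $d$ such that $\chi(1)=d$ for all $\chi\in\mathrm{Irr}(G|\lambda)$ of degree not divisible by $p$, then $G/Z$ is a $p$-group. -/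

import Mathlib

universe u

noncomputable section

open scoped ComplexConjugate

/-! ### Ordinary characters of finite groups -/

/-- `ρ` is an irreducible complex matrix representation with character `χ`. -/
def Affords {G : Type*} [Group G] {n : ℕ} (ρ : Representation ℂ G (Fin n → ℂ)) (χ : G → ℂ) :
    Prop :=
  ρ.IsIrreducible ∧ ρ.character = χ

/-- `Irr(G)`: the irreducible complex characters of `G`. -/
def Irr (G : Type*) [Group G] : Set (G → ℂ) :=
  {χ | ∃ (n : ℕ) (ρ : Representation ℂ G (Fin n → ℂ)), Affords ρ χ}

/-- The linear character `g ↦ det (ρ g)`. -/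
def detChar {G : Type*} [Group G] {n : ℕ} (ρ : Representation ℂ G (Fin n → ℂ)) : G →* ℂ :=
  LinearMap.det.comp ρ

open Classical in
/-- The determinantal order `o(χ)` of `χ ∈ Irr(G)`: the order of the linear character `det ρ`,
where `ρ` affords `χ`. It does not depend on `ρ`, see `detOrder_eq` (and is `0` if `χ ∉ Irr(G)`). -/
def detOrder {G : Type*} [Group G] (χ : G → ℂ) : ℕ :=
  if h : χ ∈ Irr G then orderOf (detChar h.choose_spec.choose) else 0

theorem detChar_eq_of_affords {G : Type*} [Group G] [Finite G] {χ : G → ℂ} {n m : ℕ}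
    {ρ : Representation ℂ G (Fin n → ℂ)} {σ : Representation ℂ G (Fin m → ℂ)}
    (hρ : Affords ρ χ) (hσ : Affords σ χ) : detChar ρ = detChar σ := by
  classical
  have := Fintype.ofFinite G
  have : Invertible (Nat.card G : ℂ) :=
    invertibleOfNonzero (Nat.cast_ne_zero.mpr Nat.card_pos.ne')
  have := hρ.1
  have := hσ.1
  have h1 := Representation.char_orthonormal ρ ρ
  have h2 := Representation.char_orthonormal ρ σ
  rw [hσ.2, ← hρ.2, h1, if_pos ⟨Representation.Equiv.refl ρ⟩] at h2
  by_cases h : Nonempty (Representation.Equiv σ ρ)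
  · obtain ⟨e⟩ := h
    ext g
    have hg : ρ g = e.toLinearEquiv.toLinearMap ∘ₗ σ g ∘ₗ e.toLinearEquiv.symm.toLinearMap := by
      refine LinearMap.ext fun v => ?_
      have := LinearMap.congr_fun (e.toIntertwiningMap.isIntertwining' g) (e.toLinearEquiv.symm v)
      exact ((congrArg (ρ g) (e.toLinearEquiv.apply_symm_apply v)).symm.trans this.symm)
    change LinearMap.det (ρ g) = LinearMap.det (σ g)
    rw [hg, LinearMap.det_conj]
  · simp [h] at h2

theorem detOrder_eq {G : Type*} [Group G] [Finite G] {χ : G → ℂ} {n : ℕ}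
    {ρ : Representation ℂ G (Fin n → ℂ)} (hρ : Affords ρ χ) :
    detOrder χ = orderOf (detChar ρ) := by
  have h : χ ∈ Irr G := ⟨n, ρ, hρ⟩
  rw [detOrder, dif_pos h, detChar_eq_of_affords h.choose_spec.choose_spec hρ]

/-- The inner product `[χ, ψ] = |G|⁻¹ ∑ χ(g) conj(ψ(g))` of class functions of a finite group. -/
def charInner {G : Type*} [Group G] (χ ψ : G → ℂ) : ℂ :=
  (Nat.card G : ℂ)⁻¹ * ∑ᶠ g : G, χ g * conj (ψ g)

/-- `Irr(G | lam)`: the irreducible characters of `G` that lie over `lam`, that is, whose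
restriction to `Z` has `lam` as a constituent. -/
def IrrOver {G : Type*} [Group G] (Z : Subgroup G) (lam : Z → ℂ) : Set (G → ℂ) :=
  {χ | χ ∈ Irr G ∧ charInner (fun z : Z => χ z) lam ≠ 0}

/-! ### `p`-solvable groups, `O_{p'}`, normal `p`-complements -/

/-- `G` is `p`-solvable: it has a normal series each of whose factors is a `p`-group or a
`p'`-group. -/
def IsPSolvable (p : ℕ) (G : Type*) [Group G] : Prop :=
  ∃ (n : ℕ) (H : ℕ → Subgroup G), H 0 = ⊥ ∧ H n = ⊤ ∧ (∀ i ≤ n, (H i).Normal) ∧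
    ∀ i < n, H i ≤ H (i + 1) ∧
      ((∃ k : ℕ, (H i).relIndex (H (i + 1)) = p ^ k) ∨ ¬ p ∣ (H i).relIndex (H (i + 1)))

/-- `O_{p'}(G)`, the largest normal subgroup of `G` of order prime to `p`. -/
def pPrimeCore (p : ℕ) (G : Type*) [Group G] : Subgroup G :=
  sSup {N : Subgroup G | N.Normal ∧ ¬ p ∣ Nat.card N}

/-- `K` is a normal `p`-complement of `G`. -/
def IsNormalPComplement (p : ℕ) {G : Type*} [Group G] (K : Subgroup G) : Prop :=
  K.Normal ∧ ¬ p ∣ Nat.card K ∧ ∃ k : ℕ, K.index = p ^ k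

/-! ### The large orbit question -/

/-- The affirmative answer, for the prime `p`, to the large orbit question: if `V` is a finite
faithful completely reducible `FG`-module, `F` of characteristic `p`, `G` has a normal
`p`-complement `K > 1` and `P` is a Sylow `p`-subgroup of `G`, then some `v ∈ C_V(P)` satisfies
`|C_K(v)|² < |K|`. -/
def LargeOrbitAffirmative (p : ℕ) : Prop :=
  ∀ (F G V : Type u) [Field F] [CharP F p] [Group G] [Finite G]
    [AddCommGroup V] [Module F V] [Finite V] (ρ : Representation F G V),
    Function.Injective ρ → ρ.IsSemisimpleRepresentation →
    ∀ (K : Subgroup G) (P : Sylow p G), IsNormalPComplement p K → K ≠ ⊥ →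
      ∃ v : V, (∀ g ∈ P, ρ g v = v) ∧ Nat.card {k : K // ρ k v = v} ^ 2 < Nat.card K

end

noncomputable section

open scoped ComplexConjugate

/-! ### Irreducible representations and their characters -/

section Criterion

variable {k G H V W : Type*} [Field k] [Group G] [Group H] [AddCommGroup V] [Module k V]
  [AddCommGroup W] [Module k W]

/-! The proof is an induction on the order of `Γ = A/Z`, carried out for all subgroups `A` of `G`
and all `A`-invariant characters `λ` of coprime degree and determinantal order at once
(`DegreeTheoremBelow`). Subgroups of `Γ` are written below like their preimages in `A`.

Let `E` be minimal normal in `Γ`. Since `Γ` is `p`-solvable with `O_{p'}(Γ) = 1`, `E` is an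
elementary abelian `p`-group. Coprimeness gives `λ` exactly one coprime extension `λ'` to `E`, and
uniqueness makes `λ'` invariant in `A`. Let `M/E = O_{p'}(Γ/E)`, so that `O_{p'}(Γ/M) = 1`. If `M =
E`, the induction hypothesis for `λ'` shows that `Γ/E`, hence `Γ`, is a `p`-group.

If `M > E`, two characters over `λ` of different `p'`-degrees are produced. The group `M/E` acts
faithfully on `E`, hence on its linear characters, and the large orbit hypothesis yields `β`, fixed
by a Sylow `p`-subgroup `P`, whose stabilizer `T` satisfies `i² < j` with `i = |T ∩ M : E|` and `j =
|M : E|` (`LargeOrbitAffirmative.exists_linChar`). A Frattini argument complements `E` in `Γ`, so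
`β` extends to `T`; multiplying by the extension carries the characters of `T` over `λ'` to those
over `λ'β`, whose stabilizer in `A` is `T`.

Counting modulo `p` gives `P`-invariant characters `φ` of `M` and `η` of `T ∩ M` over `λ'`, of
`p'`-degrees `eλ(1)` and `fλ(1)`. Let `U` and `S` be their stabilizers in `A` and in `T`. By
induction `U/M` and `S/(T ∩ M)` are `p`-groups, here because Hall–Higman keeps `O_{p'}` trivial in
subgroups containing a Sylow `p`-subgroup. So `φ` and `η` extend to `U` and `S`, and Clifford's
correspondence yields characters of `A` over `λ` of `p'`-degrees `|A:U|φ(1)` and `|A:S|η(1)`. If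
these agree, comparing `p'`-parts gives `ie = jf`, while `e² ≤ j`; hence `j² ≤ i²j < j²`, a
contradiction.

The character theory rests on Schur's lemma and orthogonality. Restrictions are multisets of
irreducible characters, and multiplicities in the regular character take the place of induction and
Frobenius reciprocity. -/

theorem isIrreducible_iff_forall_submodule (ρ : Representation k G V) :
    ρ.IsIrreducible ↔ Nontrivial V ∧
      ∀ S : Submodule k V, (∀ g, ∀ v ∈ S, ρ g v ∈ S) → S = ⊥ ∨ S = ⊤ := by
  constructor
  · intro h
    refine ⟨?_, fun S hS => ?_⟩
    · by_contra hV
      rw [not_nontrivial_iff_subsingleton] at hV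
      obtain ⟨a, b, hab⟩ := h.toNontrivial
      exact hab (Subrepresentation.toSubmodule_injective (Subsingleton.elim _ _))
    · rcases h.eq_bot_or_eq_top ⟨S, fun g v hv => hS g v hv⟩ with h | h
      · exact Or.inl (congrArg Subrepresentation.toSubmodule h)
      · exact Or.inr (congrArg Subrepresentation.toSubmodule h)
  · rintro ⟨hV, h⟩
    have : Nontrivial (Subrepresentation ρ) := by
      refine ⟨⊥, ⊤, fun e => ?_⟩
      have e' : (⊥ : Submodule k V) = ⊤ := congrArg Subrepresentation.toSubmodule e
      exact bot_ne_top e'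
    refine ⟨fun S => ?_⟩
    rcases h S.toSubmodule (fun g v hv => S.apply_mem_toSubmodule g hv) with h | h
    · exact Or.inl (Subrepresentation.toSubmodule_injective h)
    · exact Or.inr (Subrepresentation.toSubmodule_injective h)

/-- Irreducibility only depends on the operators, up to scalars and change of basis. -/
theorem isIrreducible_of_forall_exists_smul {ρ : Representation k G V} {σ : Representation k H W}
    (e : V ≃ₗ[k] W) (h : ∀ g, ∃ (h : H) (c : k), ∀ v, e (ρ g v) = c • σ h (e v))
    (hρ : ρ.IsIrreducible) : σ.IsIrreducible := by
  rw [isIrreducible_iff_forall_submodule] at hρ ⊢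
  obtain ⟨hV, hρ⟩ := hρ
  refine ⟨e.symm.toEquiv.nontrivial, fun S hS => ?_⟩
  have := hρ (S.comap e.toLinearMap) (fun g v hv => by
    obtain ⟨x, c, hx⟩ := h g
    simp only [Submodule.mem_comap, LinearEquiv.coe_coe] at hv ⊢
    rw [hx]
    exact S.smul_mem _ (hS _ _ hv))
  rcases this with h | h
  · left
    rw [← Submodule.map_comap_eq_of_surjective e.surjective S]
    exact (congrArg (Submodule.map e.toLinearMap) h).trans (Submodule.map_bot _)
  · right
    rw [← Submodule.map_comap_eq_of_surjective e.surjective S]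
    refine (congrArg (Submodule.map e.toLinearMap) h).trans ?_
    rw [Submodule.map_top]
    exact LinearMap.range_eq_top.2 e.surjective

/-- Transport of a representation along a linear equivalence. -/
def transportRep (e : V ≃ₗ[k] W) (ρ : Representation k G V) : Representation k G W where
  toFun g := e.conj (ρ g)
  map_one' := by ext; simp [LinearEquiv.conj_apply]
  map_mul' g h := by ext; simp [LinearEquiv.conj_apply]

theorem transportRep_apply (e : V ≃ₗ[k] W) (ρ : Representation k G V) (g : G) (w : W) :
    transportRep e ρ g w = e (ρ g (e.symm w)) := rfl

theorem transportRep_isIrreducible (e : V ≃ₗ[k] W) {ρ : Representation k G V}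
    (h : ρ.IsIrreducible) : (transportRep e ρ).IsIrreducible :=
  isIrreducible_of_forall_exists_smul e
    (fun g => ⟨g, 1, fun v => by simp [transportRep_apply]⟩) h

theorem transportRep_character [FiniteDimensional k V] [FiniteDimensional k W]
    (e : V ≃ₗ[k] W) (ρ : Representation k G V) :
    (transportRep e ρ).character = ρ.character := by
  ext g
  exact LinearMap.trace_conj' (ρ g) e

theorem transportRep_det (e : V ≃ₗ[k] W) (ρ : Representation k G V) (g : G) :
    LinearMap.det (transportRep e ρ g) = LinearMap.det (ρ g) :=
  LinearMap.det_conj (ρ g) e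

/-- Schur's lemma. -/
theorem exists_eq_smul_of_commute [IsAlgClosed k] [FiniteDimensional k V]
    {ρ : Representation k G V} (hρ : ρ.IsIrreducible) (f : V →ₗ[k] V)
    (hf : ∀ g v, f (ρ g v) = ρ g (f v)) : ∃ c : k, ∀ v, f v = c • v := by
  obtain ⟨c, hc⟩ := (Representation.IsIrreducible.algebraMap_intertwiningMap_bijective_of_isAlgClosed
    (ρ := ρ)).2
    ⟨f, fun g => LinearMap.ext fun v => hf g v⟩
  refine ⟨c, fun v => ?_⟩
  have := congrArg (fun F : Representation.IntertwiningMap ρ ρ => F v) hc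
  exact this.symm

end Criterion

section Irr

variable {H : Type*} [Group H]

theorem Irr.of_irreducible {V : Type*} [AddCommGroup V] [Module ℂ V] [FiniteDimensional ℂ V]
    {σ : Representation ℂ H V} (hσ : σ.IsIrreducible) :
    ∃ ρ : Representation ℂ H (Fin (Module.finrank ℂ V) → ℂ), Affords ρ σ.character ∧
      ∀ h, LinearMap.det (ρ h) = LinearMap.det (σ h) :=
  ⟨transportRep (Module.finBasis ℂ V).equivFun σ,
    ⟨transportRep_isIrreducible _ hσ, transportRep_character _ _⟩, transportRep_det _ _⟩

theorem Affords.apply_one {n : ℕ} {ρ : Representation ℂ H (Fin n → ℂ)} {χ : H → ℂ}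
    (h : Affords ρ χ) : χ 1 = n := by
  rw [← h.2, Representation.char_one]; simp

theorem Affords.pos {n : ℕ} {ρ : Representation ℂ H (Fin n → ℂ)} {χ : H → ℂ}
    (h : Affords ρ χ) : 0 < n := by
  rcases Nat.eq_zero_or_pos n with rfl | h0
  · have := ((isIrreducible_iff_forall_submodule ρ).1 h.1).1
    exact absurd this (not_nontrivial _)
  · exact h0

theorem Irr.exists_degree {χ : H → ℂ} (h : χ ∈ Irr H) : ∃ n : ℕ, 0 < n ∧ χ 1 = n := by
  obtain ⟨n, ρ, h⟩ := h
  exact ⟨n, h.pos, h.apply_one⟩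

theorem Irr.conj_apply {χ : H → ℂ} (h : χ ∈ Irr H) (g x : H) : χ (g * x * g⁻¹) = χ x := by
  obtain ⟨n, ρ, h⟩ := h
  rw [← h.2]
  exact ρ.char_conj x g

variable [Finite H]

/-- If the two representations were not isomorphic, orthogonality would give `[χ, χ] = 0`, whereas
irreducibility gives `[χ, χ] = 1`. -/
theorem Affords.nonempty_equiv {n m : ℕ} {χ : H → ℂ} {ρ : Representation ℂ H (Fin n → ℂ)}
    {σ : Representation ℂ H (Fin m → ℂ)} (hρ : Affords ρ χ) (hσ : Affords σ χ) :
    Nonempty (σ.Equiv ρ) := by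
  classical
  have := Fintype.ofFinite H
  have : Invertible (Nat.card H : ℂ) :=
    invertibleOfNonzero (Nat.cast_ne_zero.mpr Nat.card_pos.ne')
  have := hρ.1
  have := hσ.1
  have h1 := Representation.char_orthonormal ρ ρ
  have h2 := Representation.char_orthonormal ρ σ
  rw [hσ.2, ← hρ.2, h1, if_pos ⟨Representation.Equiv.refl ρ⟩] at h2
  by_contra h
  simp [h] at h2

/-- Irreducible characters are orthonormal. -/
theorem Irr.sum_mul_inv [Fintype H] {χ ψ : H → ℂ} (hχ : χ ∈ Irr H) (hψ : ψ ∈ Irr H)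
    [Decidable (χ = ψ)] :
    (Nat.card H : ℂ)⁻¹ * ∑ g, χ g * ψ g⁻¹ = if χ = ψ then 1 else 0 := by
  classical
  obtain ⟨n, ρ, hρ⟩ := hχ
  obtain ⟨m, σ, hσ⟩ := hψ
  have : Invertible (Nat.card H : ℂ) :=
    invertibleOfNonzero (Nat.cast_ne_zero.mpr Nat.card_pos.ne')
  have := hρ.1
  have := hσ.1
  have h2 := Representation.char_orthonormal ρ σ
  rw [hρ.2, hσ.2] at h2
  rw [h2]
  by_cases h : χ = ψ
  · subst h
    rw [if_pos (hρ.nonempty_equiv hσ), if_pos rfl]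
  · rw [if_neg h, if_neg]
    rintro ⟨e⟩
    exact h (by rw [← hρ.2, ← hσ.2, Representation.char_iso e])

open Classical in
/-- The determinant of a representation affording `χ`. -/
def irrDet (χ : H → ℂ) (h : H) : ℂ :=
  if hχ : χ ∈ Irr H then detChar hχ.choose_spec.choose h else 1

theorem Affords.irrDet_eq {n : ℕ} {ρ : Representation ℂ H (Fin n → ℂ)} {χ : H → ℂ}
    (hρ : Affords ρ χ) (h : H) : irrDet χ h = LinearMap.det (ρ h) := by
  have hχ : χ ∈ Irr H := ⟨n, ρ, hρ⟩
  rw [irrDet, dif_pos hχ, detChar_eq_of_affords hχ.choose_spec.choose_spec hρ]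
  rfl

/-- Complete reducibility, on the level of characters and determinants. -/
theorem exists_multiset_irr (d : ℕ) : ∀ {V : Type*} [AddCommGroup V] [Module ℂ V]
    [FiniteDimensional ℂ V] (σ : Representation ℂ H V), Module.finrank ℂ V = d →
    ∃ s : Multiset (H → ℂ), (∀ χ ∈ s, χ ∈ Irr H) ∧ σ.character = s.sum ∧
      ∀ h, LinearMap.det (σ h) = (s.map fun χ => irrDet χ h).prod := by
  induction d using Nat.strong_induction_on with
  | _ d ih =>
  intro V _ _ _ σ hd
  by_cases hV : Nontrivial V
  swap
  · rw [not_nontrivial_iff_subsingleton] at hV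
    refine ⟨0, by simp, ?_, fun h => ?_⟩
    · ext g
      have : σ g = 0 := Subsingleton.elim _ _
      simp [Representation.character, this]
    · have : σ h = LinearMap.id := Subsingleton.elim _ _
      rw [this, LinearMap.det_id, Multiset.map_zero, Multiset.prod_zero]
  by_cases hirr : σ.IsIrreducible
  · obtain ⟨ρ, hρ, hdet⟩ := Irr.of_irreducible hirr
    refine ⟨{σ.character}, ?_, by simp, fun h => ?_⟩
    · simp only [Multiset.mem_singleton, forall_eq]
      exact ⟨_, ρ, hρ⟩
    · simp [hρ.irrDet_eq, hdet]
  rw [isIrreducible_iff_forall_submodule] at hirr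
  push Not at hirr
  obtain ⟨S, hS, hbot, htop⟩ := hirr hV
  -- This is what Maschke's theorem needs; semisimplicity then comes from an instance and supplies
  -- an invariant complement of `S`.
  have : NeZero (Nat.card H : ℂ) := ⟨Nat.cast_ne_zero.mpr Nat.card_pos.ne'⟩
  have hss : σ.IsSemisimpleRepresentation := inferInstance
  obtain ⟨T, hT⟩ := hss.exists_isCompl ⟨S, fun g v hv => hS g v hv⟩
  have hc : IsCompl S T.toSubmodule := by
    constructor
    · rw [disjoint_iff]
      exact congrArg Subrepresentation.toSubmodule (disjoint_iff.1 hT.1)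
    · rw [codisjoint_iff]
      exact congrArg Subrepresentation.toSubmodule (codisjoint_iff.1 hT.2)
  let S' : Subrepresentation σ := ⟨S, fun g v hv => hS g v hv⟩
  have hadd := Submodule.finrank_add_eq_of_isCompl hc
  have hS0 : 0 < Module.finrank ℂ S := Module.finrank_pos_iff.2
    ((Submodule.nontrivial_iff_ne_bot).2 hbot)
  have hSt : Module.finrank ℂ S < Module.finrank ℂ V := Submodule.finrank_lt (lt_top_iff_ne_top.2 htop).ne
  obtain ⟨s, hs1, hs2, hs3⟩ := ih (Module.finrank ℂ S) (by omega) S'.toRepresentation rfl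
  obtain ⟨t, ht1, ht2, ht3⟩ := ih (Module.finrank ℂ T.toSubmodule) (by omega) T.toRepresentation rfl
  have key : ∀ h, σ h = (Submodule.prodEquivOfIsCompl S T.toSubmodule hc).conj
      ((S'.toRepresentation h).prodMap (T.toRepresentation h)) := by
    intro h
    ext v
    obtain ⟨⟨a, b⟩, rfl⟩ := (Submodule.prodEquivOfIsCompl S T.toSubmodule hc).surjective v
    rw [LinearEquiv.conj_apply_apply, LinearEquiv.symm_apply_apply, LinearMap.prodMap_apply,
      Submodule.coe_prodEquivOfIsCompl', Submodule.coe_prodEquivOfIsCompl', map_add]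
    rfl
  refine ⟨s + t, ?_, ?_, fun h => ?_⟩
  · intro χ hχ
    rcases Multiset.mem_add.1 hχ with h | h
    exacts [hs1 _ h, ht1 _ h]
  · rw [Multiset.sum_add, ← hs2, ← ht2]
    ext h
    rw [Pi.add_apply, Representation.character, key h, LinearMap.trace_conj',
      LinearMap.trace_prodMap']
    rfl
  · rw [Multiset.map_add, Multiset.prod_add, ← hs3, ← ht3, key h, LinearEquiv.conj_apply,
      LinearMap.comp_assoc]
    exact (LinearMap.det_conj _ _).trans (LinearMap.det_prodMap _ _)

end Irr

end

/-! ### Multiplicities, the regular character, and characters viewed on subgroups -/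

noncomputable section

open scoped ComplexConjugate

section Complex

variable {H : Type*} [Group H]

theorem charInner_eq_sum [Fintype H] (f k : H → ℂ) :
    charInner f k = (Nat.card H : ℂ)⁻¹ * ∑ g, f g * conj (k g) := by
  rw [charInner, finsum_eq_sum_of_fintype]

theorem charInner_zero_left (k : H → ℂ) : charInner (0 : H → ℂ) k = 0 := by
  simp [charInner]

variable [Finite H]

/-- Over a commutative group the representation is one-dimensional, so its values are roots of
unity, for which inverse and conjugate agree. -/
theorem Irr.apply_inv_of_isMulCommutative [IsMulCommutative H] {χ : H → ℂ} (hχ : χ ∈ Irr H)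
    (h : H) : χ h⁻¹ = conj (χ h) := by
  obtain ⟨n, ρ, hρ⟩ := hχ
  have := hρ.1
  have h1 := Representation.IsIrreducible.finrank_eq_one_of_isMulCommutative ρ
  have hsc : ∀ g, ∃ c : ℂ, ∀ v, ρ g v = c • v := fun g =>
    exists_eq_smul_of_commute hρ.1 (ρ g) fun x v => by
      rw [← Module.End.mul_apply, ← Module.End.mul_apply, ← map_mul, ← map_mul, mul_comm']
  choose c hc using hsc
  have htr : ∀ g, χ g = c g := fun g => by
    rw [← hρ.2, Representation.character]
    have : ρ g = c g • LinearMap.id := LinearMap.ext (hc g)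
    rw [this, map_smul, LinearMap.trace_id, h1]
    simp
  have := ((isIrreducible_iff_forall_submodule ρ).1 hρ.1).1
  obtain ⟨v, hv⟩ := exists_ne (0 : Fin n → ℂ)
  have hmul : ∀ g g', c (g * g') = c g * c g' := fun g g' => by
    apply smul_left_injective ℂ hv
    change c (g * g') • v = (c g * c g') • v
    rw [← hc, map_mul, Module.End.mul_apply, hc, hc, smul_smul, mul_comm]
  have hone : c 1 = 1 := by
    apply smul_left_injective ℂ hv
    change c 1 • v = (1 : ℂ) • v
    rw [← hc, map_one, one_smul]; rfl
  have hpow : ∀ k : ℕ, c (h ^ k) = c h ^ k := fun k => by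
    induction k with
    | zero => simp [hone]
    | succ k ih => rw [pow_succ, pow_succ, hmul, ih]
  have hnorm : ‖c h‖ = 1 := by
    refine Complex.norm_eq_one_of_pow_eq_one (n := orderOf h) ?_ (orderOf_pos h).ne'
    rw [← hpow, pow_orderOf_eq_one, hone]
  rw [htr, htr, ← Complex.inv_eq_conj hnorm]
  apply eq_inv_of_mul_eq_one_left
  rw [← hmul, inv_mul_cancel, hone]

/-- Only the cyclic group generated by `h` matters. There the character is a sum of linear
characters, for which the claim is known. -/
theorem Representation.character_inv_eq_conj {V : Type*} [AddCommGroup V] [Module ℂ V]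
    [FiniteDimensional ℂ V] (σ : Representation ℂ H V) (h : H) :
    σ.character h⁻¹ = conj (σ.character h) := by
  obtain ⟨s, hs, hsum, -⟩ := exists_multiset_irr _ (σ.comp (Subgroup.zpowers h).subtype) rfl
  let x : Subgroup.zpowers h := ⟨h, Subgroup.mem_zpowers h⟩
  have key : ∀ s : Multiset (Subgroup.zpowers h → ℂ),
      (∀ χ ∈ s, χ ∈ Irr (Subgroup.zpowers h)) → s.sum x⁻¹ = conj (s.sum x) := by
    intro s
    induction s using Multiset.induction_on with
    | empty => simp
    | cons a s ih =>
      intro hs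
      rw [Multiset.sum_cons, Pi.add_apply, Pi.add_apply, map_add,
        ih fun χ hχ => hs χ (Multiset.mem_cons_of_mem hχ),
        Irr.apply_inv_of_isMulCommutative (hs a (Multiset.mem_cons_self a s))]
  have := key s hs
  rw [← hsum] at this
  exact this

theorem Irr.apply_inv {χ : H → ℂ} (hχ : χ ∈ Irr H) (h : H) : χ h⁻¹ = conj (χ h) := by
  obtain ⟨n, ρ, hρ⟩ := hχ
  rw [← hρ.2]
  exact ρ.character_inv_eq_conj h

theorem charInner_add_left (f f' k : H → ℂ) :
    charInner (f + f') k = charInner f k + charInner f' k := by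
  have := Fintype.ofFinite H
  simp only [charInner_eq_sum, Pi.add_apply, add_mul, Finset.sum_add_distrib, mul_add]

theorem charInner_multiset_sum_left (s : Multiset (H → ℂ)) (k : H → ℂ) :
    charInner s.sum k = (s.map fun f => charInner f k).sum := by
  induction s using Multiset.induction_on with
  | empty => simp [charInner_zero_left]
  | cons a s ih => simp [charInner_add_left, ih]

theorem charInner_irr {χ ψ : H → ℂ} (hχ : χ ∈ Irr H) (hψ : ψ ∈ Irr H) [Decidable (χ = ψ)] :
    charInner χ ψ = if χ = ψ then 1 else 0 := by
  have := Fintype.ofFinite H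
  rw [charInner_eq_sum, ← Irr.sum_mul_inv hχ hψ]
  simp only [Irr.apply_inv hψ]

theorem charInner_multiset_irr [DecidableEq (H → ℂ)] {s : Multiset (H → ℂ)}
    (hs : ∀ χ ∈ s, χ ∈ Irr H) {ψ : H → ℂ}
    (hψ : ψ ∈ Irr H) : charInner s.sum ψ = s.count ψ := by
  induction s using Multiset.induction_on with
  | empty => simp [charInner_zero_left]
  | cons a s ih =>
    rw [Multiset.sum_cons, charInner_add_left, ih fun χ hχ => hs χ (Multiset.mem_cons_of_mem hχ),
      charInner_irr (hs a (Multiset.mem_cons_self a s)) hψ, Multiset.count_cons]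
    by_cases h : a = ψ
    · simp [h, add_comm]
    · simp [h, Ne.symm h]

/-- The regular representation on functions. -/
def functionRep (H : Type*) [Group H] : Representation ℂ H (H → ℂ) where
  toFun g := LinearMap.funLeft ℂ ℂ (· * g)
  map_one' := by ext; simp [LinearMap.funLeft]
  map_mul' g h := by ext; simp [LinearMap.funLeft, mul_assoc]

open Classical in
theorem functionRep_character (h : H) :
    (functionRep H).character h = if h = 1 then (Nat.card H : ℂ) else 0 := by
  have := Fintype.ofFinite H
  rw [Representation.character, LinearMap.trace_eq_matrix_trace ℂ (Pi.basisFun ℂ H), Matrix.trace]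
  have : ∀ x, Matrix.diag (LinearMap.toMatrix (Pi.basisFun ℂ H) (Pi.basisFun ℂ H)
      (functionRep H h)) x = if h = 1 then 1 else 0 := fun x => by
    rw [Matrix.diag_apply, LinearMap.toMatrix_apply, Pi.basisFun_repr, Pi.basisFun_apply]
    change (Pi.single x (1 : ℂ) : H → ℂ) (x * h) = _
    rw [Pi.single_apply]
    simp
  rw [Finset.sum_congr rfl fun x _ => this x]
  by_cases h1 : h = 1 <;> simp [h1]

open Classical in
-- The decomposition of the regular character. That `χ` occurs `χ(1)` times is what later turns
-- multiplicities into information about degrees.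
theorem exists_regular_multiset (H : Type*) [Group H] [Finite H] [DecidableEq (H → ℂ)] :
    ∃ r : Multiset (H → ℂ), (∀ χ ∈ r, χ ∈ Irr H) ∧
      (∀ h, r.sum h = if h = 1 then (Nat.card H : ℂ) else 0) ∧
      ∀ χ ∈ Irr H, (r.count χ : ℂ) = χ 1 := by
  have := Fintype.ofFinite H
  obtain ⟨r, hr, hsum, -⟩ := exists_multiset_irr _ (functionRep H) rfl
  have h1 : ∀ h, r.sum h = if h = 1 then (Nat.card H : ℂ) else 0 := fun h => by
    rw [← hsum, functionRep_character]
  refine ⟨r, hr, h1, fun χ hχ => ?_⟩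
  rw [← charInner_multiset_irr hr hχ, charInner_eq_sum]
  simp only [h1, ite_mul, zero_mul, Finset.sum_ite_eq', Finset.mem_univ, if_true]
  obtain ⟨n, -, hn⟩ := Irr.exists_degree hχ
  have : (Nat.card H : ℂ) ≠ 0 := Nat.cast_ne_zero.mpr Nat.card_pos.ne'
  rw [hn, inv_mul_cancel_left₀ this]
  simp

theorem Irr.finite (H : Type*) [Group H] [Finite H] : (Irr H).Finite := by
  classical
  obtain ⟨r, -, -, hr⟩ := exists_regular_multiset H
  refine r.toFinset.finite_toSet.subset fun χ hχ => ?_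
  obtain ⟨n, hn, h1⟩ := Irr.exists_degree hχ
  have := hr χ hχ
  rw [h1, Nat.cast_inj] at this
  simp only [Finset.mem_coe, Multiset.mem_toFinset]
  exact Multiset.count_pos.1 (by omega)

end Complex

/-! ### Characters of subgroups, as functions on the ambient group -/

section Ambient

variable {G : Type*} [Group G]

/-- The restriction of `f` to `H` is an irreducible character of `H`. -/
def IrrOn (H : Subgroup G) (f : G → ℂ) : Prop := (fun h : H => f h) ∈ Irr H

/-- The inner product of the restrictions of `f` and `k` to `K`. -/
def multOn (K : Subgroup G) (f k : G → ℂ) : ℂ := charInner (fun x : K => f x) fun x : K => k x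

open Classical in
/-- Extension by zero of a function on a subgroup. -/
def extendZero (K : Subgroup G) (φ : K → ℂ) (g : G) : ℂ := if h : g ∈ K then φ ⟨g, h⟩ else 0

theorem extendZero_coe (K : Subgroup G) (φ : K → ℂ) (x : K) : extendZero K φ x = φ x := by
  simp [extendZero]

theorem extendZero_comp (K : Subgroup G) (φ : K → ℂ) :
    (fun x : K => extendZero K φ x) = φ := funext (extendZero_coe K φ)

theorem irrOn_extendZero {K : Subgroup G} {φ : K → ℂ} (h : φ ∈ Irr K) :
    IrrOn K (extendZero K φ) := by
  rwa [IrrOn, extendZero_comp]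

theorem IrrOn.congr {K : Subgroup G} {f k : G → ℂ} (h : IrrOn K f) (hfk : ∀ x ∈ K, f x = k x) :
    IrrOn K k := by
  have : (fun x : K => f x) = fun x : K => k x := funext fun x => hfk x x.2
  rw [IrrOn, ← this]
  exact h

theorem multOn_congr {K : Subgroup G} {f f' k k' : G → ℂ} (h : ∀ x ∈ K, f x = f' x)
    (h' : ∀ x ∈ K, k x = k' x) : multOn K f k = multOn K f' k' := by
  rw [multOn, multOn, funext fun x : K => h x x.2, funext fun x : K => h' x x.2]

theorem IrrOn.exists_degree {H : Subgroup G} {f : G → ℂ} (h : IrrOn H f) :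
    ∃ n : ℕ, 0 < n ∧ f 1 = n := Irr.exists_degree (χ := fun x : H => f x) h

theorem IrrOn.conj_apply {H : Subgroup G} {f : G → ℂ} (h : IrrOn H f) {g x : G} (hg : g ∈ H)
    (hx : x ∈ H) : f (g * x * g⁻¹) = f x := Irr.conj_apply h ⟨g, hg⟩ ⟨x, hx⟩

/-- Conjugation by an element normalizing `K`. -/
def conjOn (K : Subgroup G) (g : G) (hg : ∀ x, x ∈ K ↔ g * x * g⁻¹ ∈ K) : K ≃* K where
  toFun x := ⟨g * x * g⁻¹, (hg x).1 x.2⟩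
  invFun x := ⟨g⁻¹ * x * g, (hg _).2 (by simp [mul_assoc])⟩
  left_inv x := by ext; simp [mul_assoc]
  right_inv x := by ext; simp [mul_assoc]
  map_mul' x y := by ext; simp [mul_assoc]

/-- Pulling back irreducible characters along isomorphisms. -/
theorem Irr.comp_equiv {H K : Type*} [Group H] [Group K] (e : K ≃* H) {χ : H → ℂ}
    (hχ : χ ∈ Irr H) : (fun k => χ (e k)) ∈ Irr K := by
  obtain ⟨n, ρ, hρ⟩ := hχ
  refine ⟨n, ρ.comp e.toMonoidHom, ?_, ?_⟩
  · exact isIrreducible_of_forall_exists_smul (LinearEquiv.refl ℂ _)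
      (fun g => ⟨e.symm g, 1, fun v => by simp⟩) hρ.1
  · rw [← hρ.2]; rfl

variable [Finite G]

theorem IrrOn.exists_multiset {H K : Subgroup G} (hKH : K ≤ H) {f : G → ℂ} (h : IrrOn H f) :
    ∃ s : Multiset (K → ℂ), (∀ χ ∈ s, χ ∈ Irr K) ∧ (fun x : K => f x) = s.sum := by
  obtain ⟨n, ρ, hρ⟩ := h
  obtain ⟨s, hs, hsum, -⟩ := exists_multiset_irr _ (ρ.comp (Subgroup.inclusion hKH)) rfl
  refine ⟨s, hs, ?_⟩
  rw [← hsum]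
  ext x
  exact (congrFun hρ.2 (Subgroup.inclusion hKH x)).symm

theorem multOn_eq_natCast {H K : Subgroup G} (hKH : K ≤ H) {f k : G → ℂ} (hf : IrrOn H f)
    (hk : IrrOn K k) : ∃ m : ℕ, multOn K f k = m := by
  classical
  obtain ⟨s, hs, hsum⟩ := hf.exists_multiset hKH
  exact ⟨s.count fun x : K => k x, by rw [multOn, hsum, charInner_multiset_irr hs hk]⟩

theorem multOn_self {K : Subgroup G} {k : G → ℂ} (hk : IrrOn K k) : multOn K k k = 1 := by
  classical
  rw [multOn, charInner_irr hk hk, if_pos rfl]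

/-- Each of the `a` copies of `l` in `f_L` contributes `b` copies of `k` to `f_K`, and the other
constituents contribute a nonnegative number. -/
theorem multOn_mul_le {H L K : Subgroup G} (hKL : K ≤ L) (hLH : L ≤ H) {f l k : G → ℂ}
    (hf : IrrOn H f) (hl : IrrOn L l) (hk : IrrOn K k) :
    ∃ a b c : ℕ, multOn L f l = a ∧ multOn K l k = b ∧ multOn K f k = c ∧ a * b ≤ c := by
  classical
  obtain ⟨s, hs, hsum⟩ := hf.exists_multiset hLH
  obtain ⟨b, hb⟩ := multOn_eq_natCast hKL hl hk
  have hm : ∀ φ ∈ s, ∃ m : ℕ, charInner (fun x : K => φ (Subgroup.inclusion hKL x))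
      (fun x : K => k x) = m := fun φ hφ => by
    obtain ⟨m, hm⟩ := multOn_eq_natCast hKL (irrOn_extendZero (hs φ hφ)) hk
    refine ⟨m, ?_⟩
    rw [← hm, multOn]
    congr 1
    ext x
    exact (extendZero_coe L φ (Subgroup.inclusion hKL x)).symm
  let res : (L → ℂ) →+ (K → ℂ) :=
    { toFun := fun φ x => φ (Subgroup.inclusion hKL x)
      map_zero' := rfl
      map_add' := fun _ _ => rfl }
  have hres : (fun x : K => f x) = (s.map res).sum := by
    rw [← map_multiset_sum, ← hsum]; rfl
  have hnat : ∀ t : Multiset (L → ℂ), t ≤ s → ∃ c : ℕ, charInner (t.map res).sum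
      (fun x : K => k x) = c := by
    intro t
    induction t using Multiset.induction_on with
    | empty => exact fun _ => ⟨0, by simp [charInner_zero_left]⟩
    | cons a t ih =>
      intro ht
      obtain ⟨c, hc⟩ := ih ((Multiset.le_cons_self t a).trans ht)
      obtain ⟨m, hm⟩ := hm a (Multiset.mem_of_le ht (Multiset.mem_cons_self a t))
      refine ⟨m + c, ?_⟩
      rw [Multiset.map_cons, Multiset.sum_cons, charInner_add_left, hc, Nat.cast_add, ← hm]
      rfl
  -- Split off all copies of `l`; `t` collects the remaining constituents of `f_L`.
  obtain ⟨t, ht⟩ := Multiset.le_iff_exists_add.1 (Multiset.le_count_iff_replicate_le.1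
    (le_refl (s.count fun x : L => l x)))
  obtain ⟨d, hd⟩ := hnat t (ht ▸ Multiset.le_add_left _ _)
  refine ⟨s.count fun x : L => l x, b, s.count (fun x : L => l x) * b + d,
    by rw [multOn, hsum, charInner_multiset_irr hs hl], hb, ?_, by omega⟩
  have hrl : charInner (res fun x : L => l x) (fun x : K => k x) = b := hb
  rw [multOn, hres]
  conv_lhs => rw [ht]
  rw [Multiset.map_add, Multiset.sum_add, charInner_add_left, hd, charInner_multiset_sum_left,
    Multiset.map_replicate, Multiset.map_replicate, Multiset.sum_replicate, hrl]
  simp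

theorem multOn_ne_zero_trans {H L K : Subgroup G} (hKL : K ≤ L) (hLH : L ≤ H) {f l k : G → ℂ}
    (hf : IrrOn H f) (hl : IrrOn L l) (hk : IrrOn K k) (h1 : multOn L f l ≠ 0)
    (h2 : multOn K l k ≠ 0) : multOn K f k ≠ 0 := by
  obtain ⟨a, b, c, ha, hb, hc, h⟩ := multOn_mul_le hKL hLH hf hl hk
  rw [ha, Nat.cast_ne_zero] at h1
  rw [hb, Nat.cast_ne_zero] at h2
  rw [hc, Nat.cast_ne_zero]
  have := Nat.mul_pos (Nat.pos_of_ne_zero h1) (Nat.pos_of_ne_zero h2)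
  omega

end Ambient

end

noncomputable section

open scoped ComplexConjugate

/-! ### Clifford theory -/

/-- Convolving an irreducible character with an invariant function multiplies it by a scalar. -/
theorem Irr.exists_sum_mul_apply_eq {B N : Type*} [Group B] [Group N] [Fintype N] (ι : N →* B)
    (a : N → ℂ) (h : ∀ b, ∃ e : N ≃ N, ∀ x, ι (e x) = b * ι x * b⁻¹ ∧ a (e x) = a x)
    {χ : B → ℂ} (hχ : χ ∈ Irr B) : ∃ c : ℂ, ∀ b, ∑ x, a x * χ (b * ι x) = c * χ b := by
  obtain ⟨n, ρ, hρ⟩ := hχ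
  -- The conjugation hypothesis makes this weighted sum of operators commute with every `ρ b`, so
  -- Schur's lemma applies.
  obtain ⟨c, hc⟩ := exists_eq_smul_of_commute hρ.1 (∑ x, a x • ρ (ι x)) fun b v => by
    obtain ⟨e, he⟩ := h b
    simp only [LinearMap.sum_apply, LinearMap.smul_apply, map_sum, map_smul]
    rw [← Equiv.sum_comp e]
    refine Finset.sum_congr rfl fun x _ => ?_
    rw [(he x).1, (he x).2, ← Module.End.mul_apply, ← Module.End.mul_apply, ← map_mul, ← map_mul,
      inv_mul_cancel_right]
  refine ⟨c, fun b => ?_⟩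
  have h1 : ρ b * (∑ x, a x • ρ (ι x)) = c • ρ b := by
    refine LinearMap.ext fun v => ?_
    rw [Module.End.mul_apply, hc, map_smul]; rfl
  have h2 := congrArg (LinearMap.trace ℂ _) h1
  rw [map_smul, Finset.mul_sum, map_sum] at h2
  rw [← hρ.2]
  refine Eq.trans (Finset.sum_congr rfl fun x _ => ?_) h2
  rw [mul_smul_comm, map_smul, ← map_mul]
  rfl

/-- Up to a factor, convolution with the conjugate of `θ` is the projection onto the `θ`-isotypic
part. It acts on `φ` by a scalar, which is found by evaluating at `1`, where the sum is `|N|[φ, θ]`.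
-/
theorem Irr.sum_convolution {N : Type*} [Group N] [Fintype N] {φ θ : N → ℂ} (hφ : φ ∈ Irr N)
    (hθ : θ ∈ Irr N) [Decidable (φ = θ)] (n : N) :
    ∑ x, conj (θ x) * φ (n * x) = if φ = θ then (Nat.card N : ℂ) / θ 1 * θ n else 0 := by
  obtain ⟨c, hc⟩ := Irr.exists_sum_mul_apply_eq (MonoidHom.id N) (fun x => conj (θ x))
    (fun b => ⟨(MulAut.conj b).toEquiv, fun x => ⟨rfl, by
      change conj (θ (b * x * b⁻¹)) = _
      rw [Irr.conj_apply hθ]⟩⟩) hφ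
  have h1 := hc 1
  have h2 := charInner_irr hφ hθ
  have hN : (Nat.card N : ℂ) ≠ 0 := Nat.cast_ne_zero.mpr Nat.card_pos.ne'
  obtain ⟨d, hd, hd1⟩ := Irr.exists_degree hφ
  have hd0 : (d : ℂ) ≠ 0 := Nat.cast_ne_zero.mpr hd.ne'
  rw [charInner_eq_sum, inv_mul_eq_iff_eq_mul₀ hN] at h2
  simp only [MonoidHom.id_apply, one_mul] at h1
  simp only [mul_comm (φ _)] at h2
  rw [h2, hd1] at h1
  refine (hc n).trans ?_
  by_cases h : φ = θ
  · subst h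
    rw [if_pos rfl] at h1 ⊢
    rw [mul_one] at h1
    rw [hd1, h1, mul_div_cancel_right₀ _ hd0]
  · rw [if_neg h, mul_zero] at h1
    rw [if_neg h, (mul_eq_zero.1 h1.symm).resolve_right hd0, zero_mul]

theorem Subgroup.card_mul_relIndex_of_le {G : Type*} [Group G] {B A : Subgroup G} (h : B ≤ A) :
    Nat.card B * B.relIndex A = Nat.card A := by
  rw [← Subgroup.relIndex_bot_left, ← Subgroup.relIndex_bot_left,
    Subgroup.relIndex_mul_relIndex _ _ _ bot_le h]

section

variable {G : Type*} [Group G]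

/-- `B` normalizes `N`. -/
def Normalizes (B N : Subgroup G) : Prop := ∀ b ∈ B, ∀ x ∈ N, b * x * b⁻¹ ∈ N

/-- The function `θ` on `N` is invariant under conjugation by `B`. -/
def InvariantUnder (B N : Subgroup G) (θ : G → ℂ) : Prop :=
  ∀ b ∈ B, ∀ x ∈ N, θ (b * x * b⁻¹) = θ x

theorem Normalizes.mem_iff {B N : Subgroup G} (h : Normalizes B N) {b : G} (hb : b ∈ B) (x : G) :
    x ∈ N ↔ b * x * b⁻¹ ∈ N :=
  ⟨h b hb x, fun hx => by simpa [mul_assoc] using h b⁻¹ (B.inv_mem hb) _ hx⟩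

theorem Normalizes.mono {B C N : Subgroup G} (h : Normalizes B N) (hC : C ≤ B) : Normalizes C N :=
  fun b hb => h b (hC hb)

theorem InvariantUnder.mono {B C N : Subgroup G} {θ : G → ℂ} (h : InvariantUnder B N θ)
    (hC : C ≤ B) : InvariantUnder C N θ := fun b hb => h b (hC hb)

/-- The stabilizer in `A` of the restriction of `θ` to `N`. -/
def stabilizerIn (A N : Subgroup G) (hN : Normalizes A N) (θ : G → ℂ) : Subgroup G where
  carrier := {g | g ∈ A ∧ ∀ x ∈ N, θ (g * x * g⁻¹) = θ x}
  one_mem' := ⟨A.one_mem, by simp⟩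
  mul_mem' := by
    rintro a b ⟨ha, ha'⟩ ⟨hb, hb'⟩
    refine ⟨A.mul_mem ha hb, fun x hx => ?_⟩
    rw [← hb' x hx, ← ha' _ (hN b hb x hx)]
    simp [mul_assoc]
  inv_mem' := by
    rintro a ⟨ha, ha'⟩
    refine ⟨A.inv_mem ha, fun x hx => ?_⟩
    rw [← ha' _ (hN _ (A.inv_mem ha) x hx)]
    simp [mul_assoc]

theorem mem_stabilizerIn {A N : Subgroup G} {hN : Normalizes A N} {θ : G → ℂ} {g : G} :
    g ∈ stabilizerIn A N hN θ ↔ g ∈ A ∧ ∀ x ∈ N, θ (g * x * g⁻¹) = θ x := Iff.rfl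

theorem stabilizerIn_le {A N : Subgroup G} {hN : Normalizes A N} {θ : G → ℂ} :
    stabilizerIn A N hN θ ≤ A := fun _ h => h.1

theorem le_stabilizerIn {A N : Subgroup G} (hNA : N ≤ A) {hN : Normalizes A N} {θ : G → ℂ}
    (hθ : IrrOn N θ) : N ≤ stabilizerIn A N hN θ :=
  fun _ h => ⟨hNA h, fun _ hx => hθ.conj_apply h hx⟩

theorem stabilizerIn_invariant {A N : Subgroup G} {hN : Normalizes A N} {θ : G → ℂ} :
    InvariantUnder (stabilizerIn A N hN θ) N θ := fun _ h => h.2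

theorem IrrOn.conj {N : Subgroup G} {θ : G → ℂ} (hθ : IrrOn N θ) {a : G}
    (ha : ∀ x, x ∈ N ↔ a * x * a⁻¹ ∈ N) : IrrOn N fun x => θ (a * x * a⁻¹) :=
  Irr.comp_equiv (conjOn N a ha) hθ

variable [Finite G]

/-- If `θ` is invariant in `B`, then characters of `B` over `θ` restrict to multiples of `θ`. -/
theorem IrrOn.eq_natCast_mul {B N : Subgroup G} (hNB : N ≤ B) (hN : Normalizes B N)
    {θ ψ : G → ℂ} (hθ : IrrOn N θ) (hinv : InvariantUnder B N θ) (hψ : IrrOn B ψ)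
    (hover : multOn N ψ θ ≠ 0) :
    ∃ e : ℕ, 0 < e ∧ multOn N ψ θ = e ∧ ∀ x ∈ N, ψ x = e * θ x := by
  classical
  have := Fintype.ofFinite N
  obtain ⟨s, hs, hsum⟩ := hψ.exists_multiset hNB
  have hm : multOn N ψ θ = s.count fun x : N => θ x := by
    rw [multOn, hsum]
    exact charInner_multiset_irr hs hθ
  set m := s.count fun x : N => θ x
  have hm0 : (m : ℂ) ≠ 0 := hm ▸ hover
  obtain ⟨c, hc⟩ := Irr.exists_sum_mul_apply_eq (Subgroup.inclusion hNB)
    (fun x : N => conj (θ x))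
    (fun b => ⟨(conjOn N b (hN.mem_iff b.2)).toEquiv, fun x => ⟨rfl, by
      exact congrArg conj (hinv b b.2 x x.2)⟩⟩) hψ
  have hNc : (Nat.card N : ℂ) ≠ 0 := Nat.cast_ne_zero.mpr Nat.card_pos.ne'
  obtain ⟨d, hd, hd1⟩ := hψ.exists_degree
  obtain ⟨t, ht, ht1⟩ := hθ.exists_degree
  have ht0 : (t : ℂ) ≠ 0 := Nat.cast_ne_zero.mpr ht.ne'
  -- The same convolution is computed twice. Schur's lemma in `B` makes it a multiple of `ψ`, while
  -- on the constituents of `ψ_N` it kills everything except `θ`. Hence `ψ_N` is a multiple of `θ`.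
  have key : ∀ n : N, ∑ x : N, conj (θ x) * ψ (n * x) = m * (Nat.card N / t * θ n) := by
    intro n
    have h1 : ∀ s : Multiset (N → ℂ), (∀ χ ∈ s, χ ∈ Irr N) →
        ∑ x : N, conj (θ x) * s.sum (n * x) =
          (s.count fun x : N => θ x) * (Nat.card N / t * θ n) := by
      intro s
      induction s using Multiset.induction_on with
      | empty => simp
      | cons a s ih =>
        intro hs
        have h2 := Irr.sum_convolution (hs a (Multiset.mem_cons_self a s)) hθ n
        simp only [Multiset.sum_cons, Pi.add_apply, mul_add, Finset.sum_add_distrib]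
        rw [ih fun χ hχ => hs χ (Multiset.mem_cons_of_mem hχ), h2, Multiset.count_cons]
        have h3 : θ ((1 : N) : G) = t := ht1
        by_cases h : a = fun x : N => θ x
        · rw [if_pos h, if_pos h.symm, h3]; push_cast; ring
        · rw [if_neg h, if_neg (Ne.symm h)]; simp
    have h2 := h1 s hs
    rw [← hsum] at h2
    exact h2
  have hkey : ∀ n : N, c * ψ n = m * (Nat.card N / t * θ n) := fun n => by
    rw [← key n]
    exact (hc (Subgroup.inclusion hNB n)).symm
  have hc0 : c ≠ 0 := by
    rintro rfl
    have := hkey 1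
    rw [zero_mul, Subgroup.coe_one, ht1, div_mul_cancel₀ _ ht0] at this
    exact mul_ne_zero hm0 hNc this.symm
  have hK : ∀ x ∈ N, ψ x = (m * Nat.card N / (c * t)) * θ x := fun x hx => by
    have := hkey ⟨x, hx⟩
    field_simp
    field_simp at this
    linear_combination this
  -- The factor is identified by taking the inner product with `θ`.
  have hKm : (m * Nat.card N / (c * t) : ℂ) = m := by
    have h1 := multOn_self hθ
    rw [multOn, charInner_eq_sum] at h1
    rw [multOn, charInner_eq_sum] at hm
    rw [← mul_one (m * Nat.card N / (c * t) : ℂ), ← h1, mul_left_comm, Finset.mul_sum]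
    refine Eq.trans ?_ hm
    congr 1
    refine Finset.sum_congr rfl fun x _ => ?_
    rw [hK x x.2, mul_assoc]
  refine ⟨m, Nat.pos_of_ne_zero (Nat.cast_ne_zero.1 hm0), hm, fun x hx => ?_⟩
  rw [← hKm]; exact hK x hx

/-- The ramification index is bounded by the square root of the index. -/
theorem IrrOn.sq_mul_card_le {B N : Subgroup G} (hNB : N ≤ B) {θ ψ : G → ℂ} (hθ : IrrOn N θ)
    (hψ : IrrOn B ψ) {e : ℕ} (he : ∀ x ∈ N, ψ x = e * θ x) :
    e ^ 2 * Nat.card N ≤ Nat.card B := by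
  classical
  have := Fintype.ofFinite N
  have := Fintype.ofFinite B
  have h1 := multOn_self hθ
  have h2 := multOn_self hψ
  have hN : (Nat.card N : ℂ) ≠ 0 := Nat.cast_ne_zero.mpr Nat.card_pos.ne'
  have hB : (Nat.card B : ℂ) ≠ 0 := Nat.cast_ne_zero.mpr Nat.card_pos.ne'
  rw [multOn, charInner_eq_sum, inv_mul_eq_iff_eq_mul₀ (by assumption), mul_one] at h1 h2
  simp only [Complex.mul_conj] at h1 h2
  norm_cast at h1 h2
  -- By orthonormality the sum of `|ψ|²` over `B` is `|B|`, and its part over `N` is `e²|N|`.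
  have h3 : ∑ x : N, Complex.normSq (ψ x) ≤ ∑ x : B, Complex.normSq (ψ x) := by
    refine (Finset.sum_image (s := Finset.univ) (g := Subgroup.inclusion hNB)
      (f := fun x : B => Complex.normSq (ψ x))
      fun _ _ _ _ h => Subgroup.inclusion_injective hNB h).symm.trans_le ?_
    exact Finset.sum_le_sum_of_subset_of_nonneg (Finset.subset_univ _)
      fun _ _ _ => Complex.normSq_nonneg _
  have h4 : ∑ x : N, Complex.normSq (ψ x) = (e : ℝ) ^ 2 * Nat.card N := by
    rw [← h1, Finset.mul_sum]
    refine Finset.sum_congr rfl fun x _ => ?_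
    rw [he x x.2, Complex.normSq_mul, Complex.normSq_natCast, sq]
  rw [h4, h2] at h3
  exact_mod_cast h3

theorem multOn_conj {A N : Subgroup G} (hN : Normalizes A N) {χ θ : G → ℂ}
    (hNA : N ≤ A) (hχ : IrrOn A χ) {a : G} (ha : a ∈ A) :
    multOn N χ (fun x => θ (a * x * a⁻¹)) = multOn N χ θ := by
  have := Fintype.ofFinite N
  rw [multOn, multOn, charInner_eq_sum, charInner_eq_sum]
  congr 1
  refine Eq.trans ?_ (Equiv.sum_comp (conjOn N a (hN.mem_iff ha)).toEquiv _)
  refine Finset.sum_congr rfl fun x _ => ?_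
  exact congrArg (· * conj (θ (a * x * a⁻¹))) (hχ.conj_apply ha (hNA x.2)).symm

/-- The regular character of `A` restricted to `B`. -/
theorem exists_multiset_sum_multOn {A B : Subgroup G} (hBA : B ≤ A) [DecidableEq (A → ℂ)]
    {ψ : G → ℂ} (hψ : IrrOn B ψ) : ∃ r : Multiset (A → ℂ), (∀ χ ∈ r, χ ∈ Irr A) ∧
      (r.map fun χ => multOn B (extendZero A χ) ψ).sum = B.relIndex A * ψ 1 ∧
      ∀ χ ∈ Irr A, (r.count χ : ℂ) = χ 1 := by
  classical
  have := Fintype.ofFinite B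
  obtain ⟨r, hr, hsum, hcount⟩ := exists_regular_multiset A
  refine ⟨r, hr, ?_, hcount⟩
  let res : (A → ℂ) →+ (B → ℂ) :=
    { toFun := fun φ x => φ (Subgroup.inclusion hBA x)
      map_zero' := rfl
      map_add' := fun _ _ => rfl }
  have h1 : ∀ χ : A → ℂ, multOn B (extendZero A χ) ψ = charInner (res χ) fun x : B => ψ x := by
    intro χ
    rw [multOn]
    congr 1
    ext x
    exact extendZero_coe A χ (Subgroup.inclusion hBA x)
  rw [Multiset.map_congr rfl fun χ _ => h1 χ]
  have h3 := Multiset.map_map (fun f => charInner f fun x : B => ψ x) (fun χ => res χ) r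
  rw [Function.comp_def] at h3
  rw [← h3, ← charInner_multiset_sum_left, ← map_multiset_sum, charInner_eq_sum]
  have h2 : ∀ x : B, res r.sum x = if x = 1 then (Nat.card A : ℂ) else 0 := fun x => by
    change r.sum (Subgroup.inclusion hBA x) = _
    rw [hsum]
    simp only [← (Subgroup.inclusion hBA).map_one, (Subgroup.inclusion_injective hBA).eq_iff]
  simp only [h2, ite_mul, zero_mul, Finset.sum_ite_eq', Finset.mem_univ, if_true]
  obtain ⟨n, -, hn⟩ := hψ.exists_degree
  have hB : (Nat.card B : ℂ) ≠ 0 := Nat.cast_ne_zero.mpr Nat.card_pos.ne'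
  rw [Subgroup.coe_one, hn, ← Subgroup.card_mul_relIndex_of_le hBA]
  push_cast
  rw [Complex.conj_natCast]
  field_simp

/-- The Clifford correspondence, without induced characters. -/
theorem exists_irrOn_over_of_stabilizer {A N : Subgroup G} (hNA : N ≤ A) (hN : Normalizes A N)
    {θ ψ : G → ℂ} (hθ : IrrOn N θ) (hψ : IrrOn (stabilizerIn A N hN θ) ψ)
    (hover : multOn N ψ θ ≠ 0) :
    ∃ χ, IrrOn A χ ∧ multOn (stabilizerIn A N hN θ) χ ψ ≠ 0 ∧
      χ 1 = (stabilizerIn A N hN θ).relIndex A * ψ 1 := by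
  classical
  set B := stabilizerIn A N hN θ with hB
  have hBA : B ≤ A := stabilizerIn_le
  have hNB : N ≤ B := le_stabilizerIn hNA hθ
  obtain ⟨r, hr, hsum, hcount⟩ := exists_multiset_sum_multOn hBA hψ
  obtain ⟨d, hd, hd1⟩ := hψ.exists_degree
  obtain ⟨t, ht, ht1⟩ := hθ.exists_degree
  have hidx : 0 < B.relIndex A := Nat.pos_of_ne_zero Subgroup.index_ne_zero_of_finite
  -- some constituent of the regular character lies over `ψ`
  obtain ⟨χ, hχr, hχ0⟩ : ∃ χ ∈ r, multOn B (extendZero A χ) ψ ≠ 0 := by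
    by_contra! h
    rw [Multiset.map_congr rfl h] at hsum
    simp only [Multiset.map_const', Multiset.sum_replicate, smul_zero] at hsum
    rw [hd1] at hsum
    exact (mul_ne_zero (Nat.cast_ne_zero.2 hidx.ne') (Nat.cast_ne_zero.2 hd.ne')) hsum.symm
  have hχ := hr χ hχr
  have hχA := irrOn_extendZero hχ
  refine ⟨extendZero A χ, hχA, hχ0, ?_⟩
  obtain ⟨n, hn, hn1⟩ := hχA.exists_degree
  have hcn : r.count χ = n := by
    have h1 := hcount χ hχ
    have h2 := extendZero_coe A χ 1
    rw [Subgroup.coe_one, hn1] at h2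
    rw [← h2] at h1
    exact_mod_cast h1
  -- upper bound
  have hup : n ≤ B.relIndex A * d := by
    have hnat : ∀ u : Multiset (A → ℂ), u ≤ r → ∃ c : ℕ,
        (u.map fun χ => multOn B (extendZero A χ) ψ).sum = c := by
      intro u
      induction u using Multiset.induction_on with
      | empty => exact fun _ => ⟨0, by simp⟩
      | cons a u ih =>
        intro hu
        obtain ⟨c, hc⟩ := ih ((Multiset.le_cons_self u a).trans hu)
        obtain ⟨m, hm⟩ := multOn_eq_natCast hBA (irrOn_extendZero
          (hr a (Multiset.mem_of_le hu (Multiset.mem_cons_self a u)))) hψ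
        exact ⟨m + c, by simp [hc, hm]⟩
    obtain ⟨u, hu⟩ := Multiset.le_iff_exists_add.1 (Multiset.le_count_iff_replicate_le.1
      (le_refl (r.count χ)))
    obtain ⟨c, hc⟩ := hnat u (hu ▸ Multiset.le_add_left _ _)
    obtain ⟨m, hm⟩ := multOn_eq_natCast hBA hχA hψ
    -- The `n = χ(1)` copies of `χ` in the regular character contribute `n * m` to the total
    -- multiplicity `|A:B|ψ(1)` of `ψ`, and `m ≥ 1`.
    rw [hu, Multiset.map_add, Multiset.sum_add, hc, Multiset.map_replicate,
      Multiset.sum_replicate, hm, hd1, hcn, nsmul_eq_mul] at hsum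
    norm_cast at hsum
    have hm1 : 1 ≤ m := by
      rw [hm, Nat.cast_ne_zero] at hχ0; omega
    nlinarith
  -- lower bound
  have hlow : B.relIndex A * d ≤ n := by
    obtain ⟨f, hf, hf1, hfx⟩ := hθ.eq_natCast_mul hNB (hN.mono hBA) stabilizerIn_invariant hψ hover
    obtain ⟨a, b, c, ha, hb, hc, habc⟩ := multOn_mul_le hNB hBA hχA hψ hθ
    have hdf : d = f * t := by
      have := hfx 1 N.one_mem
      rw [hd1, ht1] at this
      exact_mod_cast this
    -- As `χ_B` contains `ψ` and `ψ_N = fθ`, the multiplicity `c` of `θ` in `χ_N` is at least `f`.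
    have hfc : f ≤ c := by
      have : f = b := by rw [hf1] at hb; exact_mod_cast hb
      subst this
      have ha0 : a ≠ 0 := by rintro rfl; simp [ha] at hχ0
      have : 1 ≤ a := Nat.one_le_iff_ne_zero.2 ha0
      nlinarith
    obtain ⟨s, hs, hsumN⟩ := hχA.exists_multiset hNA
    -- the conjugates of `θ`
    let Q := A ⧸ B.subgroupOf A
    have : Fintype Q := Fintype.ofFinite Q
    let cj : Q → (N → ℂ) := fun q x => θ (((q.out : A) : G)⁻¹ * x * ((q.out : A) : G))
    have hcjirr : ∀ q, cj q ∈ Irr N := fun q => by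
      have := hθ.conj (hN.mem_iff (A.inv_mem q.out.2))
      simpa [cj, IrrOn] using this
    have hcjcount : ∀ q, s.count (cj q) = c := fun q => by
      have h1 := multOn_conj (θ := θ) hN hNA hχA (A.inv_mem q.out.2)
      rw [hc, multOn, hsumN] at h1
      have h2 := charInner_multiset_irr hs (hcjirr q)
      have h3 : cj q = fun x : N => θ (((q.out : A) : G)⁻¹ * x * ((q.out : A) : G)⁻¹⁻¹) := by
        simp [cj]
      rw [← h3, h2] at h1
      exact_mod_cast h1
    have hcjinj : Function.Injective cj := fun q q' h => by
      rw [← QuotientGroup.out_eq' q, ← QuotientGroup.out_eq' q', QuotientGroup.eq,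
        Subgroup.mem_subgroupOf]
      refine ⟨A.mul_mem (A.inv_mem q.out.2) q'.out.2, fun x hx => ?_⟩
      have h1 := congrFun h ⟨(q'.out : A) * x * (q'.out : A)⁻¹, hN _ q'.out.2 x hx⟩
      simp only [cj] at h1
      refine Eq.trans ?_ (h1.trans ?_)
      · congr 1; simp [mul_assoc]
      · congr 1; simp [mul_assoc]
    have hdegs : ∀ φ ∈ s, ∃ k : ℕ, φ 1 = k := fun φ hφ => by
      obtain ⟨k, -, hk⟩ := Irr.exists_degree (hs φ hφ); exact ⟨k, hk⟩
    -- The `|A:B|` conjugates of `θ` are distinct and each occurs `c` times in `χ_N`. Evaluating at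
    -- `1` gives `n ≥ |A:B| c θ(1) ≥ |A:B| f θ(1) = |A:B|ψ(1)`.
    have hle : (Finset.univ : Finset Q).val.bind (fun q => Multiset.replicate c (cj q)) ≤ s := by
      rw [Multiset.le_iff_count]
      intro φ
      rw [Multiset.count_bind]
      by_cases hφ : ∃ q, cj q = φ
      · obtain ⟨q, rfl⟩ := hφ
        rw [hcjcount q]
        have : ∀ q', Multiset.count (cj q) (Multiset.replicate c (cj q')) =
            if q' = q then c else 0 := fun q' => by
          rw [Multiset.count_replicate]
          simp only [hcjinj.eq_iff]
        simp only [this]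
        exact le_of_eq ((Finset.sum_ite_eq' Finset.univ q fun _ => c).trans (by simp))
      · push Not at hφ
        have : ∀ q', Multiset.count φ (Multiset.replicate c (cj q')) = 0 := fun q' => by
          rw [Multiset.count_replicate, if_neg (hφ q')]
        simp [this]
    obtain ⟨w, hw⟩ := Multiset.le_iff_exists_add.1 hle
    have hev : ∀ v : Multiset (N → ℂ), v ≤ s → ∃ k : ℕ, v.sum 1 = k := by
      intro v
      induction v using Multiset.induction_on with
      | empty => exact fun _ => ⟨0, by simp⟩
      | cons a v ih =>
        intro hv
        obtain ⟨c, hc⟩ := ih ((Multiset.le_cons_self v a).trans hv)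
        obtain ⟨m, hm⟩ := hdegs a (Multiset.mem_of_le hv (Multiset.mem_cons_self a v))
        exact ⟨m + c, by simp [hc, hm]⟩
    obtain ⟨k, hk⟩ := hev w (hw ▸ Multiset.le_add_left _ _)
    have h1 : (n : ℂ) = s.sum 1 := by rw [← hsumN, ← hn1]; rfl
    rw [hw, Multiset.sum_add, Pi.add_apply, hk, Multiset.sum_bind] at h1
    have h2 : (Multiset.map (fun q => (Multiset.replicate c (cj q)).sum)
        (Finset.univ : Finset Q).val).sum 1 = Nat.card Q * (c * t) := by
      change (∑ q : Q, (Multiset.replicate c (cj q)).sum) 1 = _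
      rw [Finset.sum_apply]
      have : ∀ q : Q, (Multiset.replicate c (cj q)).sum 1 = c * t := fun q => by
        rw [Multiset.sum_replicate, Pi.smul_apply, nsmul_eq_mul]
        congr 1
        simp [cj, ht1]
      rw [Finset.sum_congr rfl fun q _ => this q]
      simp
    rw [h2] at h1
    have hQ : Nat.card Q = B.relIndex A := rfl
    rw [hQ] at h1
    norm_cast at h1
    have : f * t ≤ c * t := Nat.mul_le_mul_right t hfc
    have := Nat.mul_le_mul_left (B.relIndex A) this
    rw [hdf]
    omega
  rw [hn1, hd1, le_antisymm hup hlow]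
  push_cast
  rfl

end

end

noncomputable section

open scoped ComplexConjugate

/-! ### Invariant constituents -/

/-- Sort `S` by weight. Some fibre contributes `k` times its cardinality, prime to `p`, to the sum;
the `p`-group acts on this fibre, whose size is prime to `p`, and therefore fixes a point of it. -/
theorem exists_fixed_of_not_dvd_sum {p : ℕ} [Fact p.Prime] {P X : Type*} [Group P] [MulAction P X]
    (hP : IsPGroup p P) (S : Finset X) (hS : ∀ g : P, ∀ x ∈ S, g • x ∈ S) (w : X → ℕ)
    (hw : ∀ g : P, ∀ x ∈ S, w (g • x) = w x) (h : ¬ p ∣ ∑ x ∈ S, w x) :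
    ∃ x ∈ S, (∀ g : P, g • x = x) ∧ ¬ p ∣ w x := by
  classical
  rw [← Finset.sum_fiberwise_of_maps_to (g := w) (t := S.image w)
    fun x hx => Finset.mem_image_of_mem w hx] at h
  obtain ⟨k, hk, hpk⟩ : ∃ k ∈ S.image w, ¬ p ∣ ∑ x ∈ S with w x = k, w x := by
    by_contra! h'
    exact h (Finset.dvd_sum h')
  rw [Finset.sum_congr rfl (g := fun _ => k) fun x hx => (Finset.mem_filter.1 hx).2,
    Finset.sum_const, smul_eq_mul] at hpk
  let T : SubMulAction P X :=
    { carrier := {x | x ∈ S ∧ w x = k}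
      smul_mem' := fun g x hx => ⟨hS g x hx.1, (hw g x hx.1).trans hx.2⟩ }
  have hT : Nat.card T = (S.filter fun x => w x = k).card := by
    rw [← Nat.card_eq_finsetCard]
    have : ∀ x, x ∈ T ↔ x ∈ S.filter fun x => w x = k := fun x => by
      rw [Finset.mem_filter]; rfl
    exact Nat.card_congr (Equiv.subtypeEquivRight this)
  have : Finite T := Nat.finite_of_card_ne_zero fun h0 => hpk (by
    rw [← hT, h0, zero_mul]; exact dvd_zero p)
  obtain ⟨x, hx⟩ := hP.nonempty_fixed_point_of_prime_not_dvd_card T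
    fun hd => hpk ((hT ▸ hd).mul_right k)
  refine ⟨x, x.2.1, fun g => congrArg Subtype.val (hx g), fun hd => ?_⟩
  rw [x.2.2] at hd
  exact hpk (hd.mul_left _)

section

variable {G : Type*} [Group G]

/-- The conjugation action of a group normalizing `M` on the functions on `M`. -/
abbrev conjFunAction (P M : Subgroup G) (h : Normalizes P M) : MulAction P (M → ℂ) where
  smul g φ x := φ ⟨(g : G)⁻¹ * x * g, by
    simpa using h _ (P.inv_mem g.2) x x.2⟩
  one_smul φ := by
    ext x; change φ _ = φ x; congr 1; ext; simp
  mul_smul g g' φ := by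
    ext x; change φ _ = φ _; congr 1; ext; simp [mul_assoc]

variable [Finite G]

/-- The products `χ(1)[χ_E, θ]` over all `χ` in `Irr M` sum to `|M:E|θ(1)`, by restricting the
regular character. This is prime to `p`, and `P` permutes `Irr M` preserving the products, so some
fixed `χ` has its product prime to `p`. -/
theorem exists_irrOn_invariant_over {p : ℕ} [Fact p.Prime] {P M E : Subgroup G}
    (hP : IsPGroup p P) (hM : Normalizes P M) (hE : Normalizes P E) (hEM : E ≤ M)
    {θ : G → ℂ} (hθ : IrrOn E θ) (hinv : InvariantUnder P E θ)
    {n : ℕ} (hn : θ 1 = n) (hpn : ¬ p ∣ n) (hidx : ¬ p ∣ E.relIndex M) :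
    ∃ φ, IrrOn M φ ∧ InvariantUnder P M φ ∧ multOn E φ θ ≠ 0 ∧
      ∃ m : ℕ, φ 1 = m ∧ ¬ p ∣ m := by
  classical
  obtain ⟨r, hr, hsum, hcount⟩ := exists_multiset_sum_multOn hEM hθ
  let S : Finset (M → ℂ) := (Irr.finite M).toFinset
  have hS : ∀ χ, χ ∈ S ↔ χ ∈ Irr M := fun χ => by simp [S]
  -- Outside `Irr M` both numbers are set to `0`, which lets the weight be defined on all functions,
  -- where `P` acts.
  have hch : ∀ χ : M → ℂ, ∃ m d : ℕ, χ ∈ Irr M →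
      multOn E (extendZero M χ) θ = m ∧ χ 1 = d := fun χ => by
    by_cases h : χ ∈ Irr M
    · obtain ⟨m, hm⟩ := multOn_eq_natCast hEM (irrOn_extendZero h) hθ
      obtain ⟨d, -, hd⟩ := Irr.exists_degree h
      exact ⟨m, d, fun _ => ⟨hm, hd⟩⟩
    · exact ⟨0, 0, fun h' => absurd h' h⟩
  choose m d hmd using hch
  have htot : ∑ χ ∈ S, d χ * m χ = E.relIndex M * n := by
    have h1 : (r.map fun χ => multOn E (extendZero M χ) θ).sum = ∑ χ ∈ S, (d χ * m χ : ℂ) := by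
      rw [Finset.sum_multiset_map_count]
      refine (Finset.sum_subset (fun χ hχ => ?_) fun χ hχ hχ' => ?_).trans
        (Finset.sum_congr rfl fun χ hχ => ?_)
      · exact (hS χ).2 (hr χ (Multiset.mem_toFinset.1 hχ))
      · rw [Multiset.count_eq_zero.2 fun h => hχ' (Multiset.mem_toFinset.2 h), zero_smul]
      · rw [nsmul_eq_mul, hcount χ ((hS χ).1 hχ), (hmd χ ((hS χ).1 hχ)).1,
          (hmd χ ((hS χ).1 hχ)).2]
    rw [h1, hn] at hsum
    exact_mod_cast hsum
  let _ := conjFunAction P M hM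
  have hsmul : ∀ (g : P) (χ : M → ℂ) (x : M), (g • χ) x =
    χ ⟨(g : G)⁻¹ * x * g, by simpa using hM _ (P.inv_mem g.2) x x.2⟩ := fun _ _ _ => rfl
  have hirr : ∀ g : P, ∀ χ ∈ Irr M, g • χ ∈ Irr M := fun g χ hχ => by
    convert Irr.comp_equiv (conjOn M (g : G)⁻¹ (hM.mem_iff (P.inv_mem g.2))) hχ using 1
    ext x
    rw [hsmul]
    congr 1
    ext
    simp [conjOn]
  have hd : ∀ g : P, ∀ χ ∈ Irr M, d (g • χ) = d χ := fun g χ hχ => by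
    have h1 := (hmd _ (hirr g χ hχ)).2
    have h2 := (hmd _ hχ).2
    have h3 : (g • χ) 1 = χ 1 := by rw [hsmul]; congr 1; ext; simp
    rw [h1, h2] at h3
    exact_mod_cast h3
  have hm : ∀ g : P, ∀ χ ∈ Irr M, m (g • χ) = m χ := fun g χ hχ => by
    have h1 := (hmd _ (hirr g χ hχ)).1
    have h2 := (hmd _ hχ).1
    have h3 : multOn E (extendZero M (g • χ)) θ = multOn E (extendZero M χ) θ := by
      have := Fintype.ofFinite E
      rw [multOn, multOn, charInner_eq_sum, charInner_eq_sum]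
      congr 1
      refine (Equiv.sum_comp (conjOn E g (hE.mem_iff g.2)).toEquiv _).symm.trans ?_
      refine Finset.sum_congr rfl fun x _ => ?_
      have e1 : θ ((conjOn E g (hE.mem_iff g.2)) x : G) = θ x := hinv g g.2 x x.2
      have e2 := extendZero_coe M (g • χ)
        ⟨_, hEM ((conjOn E g (hE.mem_iff g.2)) x).2⟩
      have e3 := extendZero_coe M χ ⟨x, hEM x.2⟩
      change extendZero M (g • χ) ((conjOn E g (hE.mem_iff g.2)) x : G) *
        conj (θ ((conjOn E g (hE.mem_iff g.2)) x : G)) = _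
      rw [e1]
      congr 1
      refine e2.trans (Eq.trans ?_ e3.symm)
      rw [hsmul]
      congr 1
      ext
      simp [conjOn, mul_assoc]
    rw [h1, h2] at h3
    exact_mod_cast h3
  obtain ⟨χ, hχS, hfix, hpχ⟩ := exists_fixed_of_not_dvd_sum hP S
    (fun g χ hχ => (hS _).2 (hirr g χ ((hS χ).1 hχ))) (fun χ => d χ * m χ)
    (fun g χ hχ => by rw [hd g χ ((hS χ).1 hχ), hm g χ ((hS χ).1 hχ)])
    (by
      rw [htot]
      exact fun h => ((Fact.out : p.Prime).dvd_mul.1 h).elim hidx hpn)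
  have hχ := (hS χ).1 hχS
  refine ⟨extendZero M χ, irrOn_extendZero hχ, ?_, ?_, d χ, ?_, fun h => hpχ (h.mul_right _)⟩
  · intro g hg x hx
    have h1 := congrFun (hfix ⟨g, hg⟩) ⟨g * x * g⁻¹, hM g hg x hx⟩
    rw [hsmul] at h1
    have e2 := extendZero_coe M χ ⟨g * x * g⁻¹, hM g hg x hx⟩
    have e3 := extendZero_coe M χ ⟨x, hx⟩
    refine e2.trans (Eq.trans ?_ e3.symm)
    rw [← h1]
    congr 1
    ext
    simp [mul_assoc]
  · rw [(hmd χ hχ).1, Nat.cast_ne_zero]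
    intro h0
    exact hpχ (by simp [h0])
  · have := extendZero_coe M χ 1
    rw [← (hmd χ hχ).2]; exact this

end

end

noncomputable section

open scoped ComplexConjugate

/-! ### Canonical extensions -/

section

/-- `χ` is an irreducible character whose degree and determinantal order are prime to `p`. -/
def IsCoprimeIrr (p : ℕ) {H : Type*} [Group H] (χ : H → ℂ) : Prop :=
  ∃ (n : ℕ) (ρ : Representation ℂ H (Fin n → ℂ)), Affords ρ χ ∧ ¬ p ∣ n ∧
    ∃ k : ℕ, ¬ p ∣ k ∧ ∀ h, LinearMap.det (ρ h) ^ k = 1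

variable {p : ℕ} [Fact p.Prime]

theorem eq_one_of_pow_eq_one_of_coprime {M : Type*} [Monoid M] {c : M} {a b : ℕ}
    (hab : Nat.Coprime a b) (ha : c ^ a = 1) (hb : c ^ b = 1) : c = 1 := by
  rw [← orderOf_eq_one_iff]
  exact Nat.eq_one_of_dvd_coprimes hab (orderOf_dvd_of_pow_eq_one ha) (orderOf_dvd_of_pow_eq_one hb)

theorem coprime_pow_of_not_dvd {k b : ℕ} (h : ¬ p ∣ b) : Nat.Coprime (p ^ k) b :=
  Nat.Coprime.pow_left k (((Fact.out : p.Prime).coprime_iff_not_dvd).2 h)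

/-- Since `[χ, χ] = 1`, the space of self-intertwiners is one-dimensional. The projection onto an
invariant subspace along an invariant complement is then a scalar, so the subspace is trivial or
everything. -/
theorem isIrreducible_of_character_mem_irr {H V : Type*} [Group H] [Finite H] [AddCommGroup V]
    [Module ℂ V] [FiniteDimensional ℂ V] {σ : Representation ℂ H V} (h : σ.character ∈ Irr H) :
    σ.IsIrreducible := by
  classical
  have := Fintype.ofFinite H
  have : Invertible (Nat.card H : ℂ) :=
    invertibleOfNonzero (Nat.cast_ne_zero.mpr Nat.card_pos.ne')
  have : NeZero (Nat.card H : ℂ) := ⟨Nat.cast_ne_zero.mpr Nat.card_pos.ne'⟩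
  have hfin := Representation.card_inv_mul_sum_char_mul_char_eq_finrank σ σ
  rw [Irr.sum_mul_inv h h, if_pos rfl] at hfin
  have hV : Nontrivial V := by
    obtain ⟨n, hn, h1⟩ := Irr.exists_degree h
    rw [Representation.char_one, Nat.cast_inj] at h1
    exact Module.nontrivial_of_finrank_pos (R := ℂ) (by omega)
  rw [isIrreducible_iff_forall_submodule]
  refine ⟨hV, fun S hS => ?_⟩
  have hss : σ.IsSemisimpleRepresentation := inferInstance
  obtain ⟨T, hT⟩ := hss.exists_isCompl ⟨S, fun g v hv => hS g v hv⟩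
  have hc : IsCompl S T.toSubmodule := by
    constructor
    · rw [disjoint_iff]
      exact congrArg Subrepresentation.toSubmodule (disjoint_iff.1 hT.1)
    · rw [codisjoint_iff]
      exact congrArg Subrepresentation.toSubmodule (codisjoint_iff.1 hT.2)
  let q : V →ₗ[ℂ] V := S.subtype ∘ₗ Submodule.projectionOnto S T.toSubmodule hc
  have hqS : ∀ v ∈ S, q v = v := fun v hv =>
    congrArg Subtype.val (Submodule.projectionOnto_apply_left hc ⟨v, hv⟩)
  have hqT : ∀ v ∈ T.toSubmodule, q v = 0 := fun v hv =>
    congrArg Subtype.val (Submodule.projectionOnto_apply_right hc ⟨v, hv⟩)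
  have hq : ∀ g v, q (σ g v) = σ g (q v) := fun g v => by
    obtain ⟨a, ha, b, hb, rfl⟩ := Submodule.mem_sup.1 (hc.sup_eq_top ▸ Submodule.mem_top : v ∈ S ⊔ T.toSubmodule)
    simp only [map_add]
    rw [hqS a ha, hqT b hb, hqS _ (hS g a ha), hqT _ (T.apply_mem_toSubmodule g hb), map_zero]
  let Q : Representation.IntertwiningMap σ σ := ⟨q, fun g => LinearMap.ext fun v => hq g v⟩
  have hid : (1 : Representation.IntertwiningMap σ σ) ≠ 0 := fun h0 => by
    obtain ⟨v, hv⟩ := exists_ne (0 : V)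
    exact hv (congrArg (fun F : Representation.IntertwiningMap σ σ => F v) h0)
  obtain ⟨c, hcq⟩ := (finrank_eq_one_iff_of_nonzero' _ hid).1 (by exact_mod_cast hfin.symm) Q
  have hcq' : ∀ v, c • v = q v := fun v =>
    congrArg (fun F : Representation.IntertwiningMap σ σ => F v) hcq
  by_cases hc0 : c = 0
  · left
    rw [Submodule.eq_bot_iff]
    intro v hv
    rw [← hqS v hv, ← hcq' v, hc0, zero_smul]
  · right
    rw [eq_top_iff]
    intro v _
    have h2 : q v ∈ S := (Submodule.projectionOnto S T.toSubmodule hc v).2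
    rw [← hcq'] at h2
    exact (Submodule.smul_mem_iff S hc0).1 h2

/-- Two coprime extensions of an irreducible character across a `p`-quotient coincide. -/
theorem IsCoprimeIrr.eq_of_eq_on {U : Type*} [Group U] [Finite U] {N : Subgroup U} [N.Normal]
    {k : ℕ} (hidx : N.index = p ^ k) {χ χ' : U → ℂ} (hχ : IsCoprimeIrr p χ)
    (hχ' : IsCoprimeIrr p χ') (hN : (fun x : N => χ x) ∈ Irr N) (heq : ∀ x ∈ N, χ x = χ' x) :
    χ = χ' := by
  obtain ⟨n, ρ, hρ, hpn, a, ha, hdet⟩ := hχ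
  obtain ⟨n', ρ', hρ', hpn', a', ha', hdet'⟩ := hχ'
  have hN' : (fun x : N => χ' x) = fun x : N => χ x := funext fun x => (heq x x.2).symm
  let ρN : Representation ℂ N (Fin n → ℂ) := ρ.comp N.subtype
  let ρN' : Representation ℂ N (Fin n' → ℂ) := ρ'.comp N.subtype
  have hc : ρN.character = fun x : N => χ x := by rw [← hρ.2]; rfl
  have hc' : ρN'.character = fun x : N => χ x := by rw [← hN', ← hρ'.2]; rfl
  have hi : ρN.IsIrreducible := isIrreducible_of_character_mem_irr (hc ▸ hN)
  obtain ⟨e⟩ := Affords.nonempty_equiv (ρ := ρN) (σ := ρN') ⟨hi, hc⟩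
    ⟨isIrreducible_of_character_mem_irr (hc' ▸ hN), hc'⟩
  have hτN : ∀ x ∈ N, transportRep e.toLinearEquiv ρ' x = ρ x := fun x hx => by
    refine LinearMap.ext fun w => ?_
    rw [transportRep_apply]
    have := LinearMap.congr_fun (e.toIntertwiningMap.isIntertwining' ⟨x, hx⟩)
      (e.toLinearEquiv.symm w)
    refine this.trans ?_
    exact congrArg (ρ x) (e.toLinearEquiv.apply_symm_apply w)
  have hτdet := transportRep_det e.toLinearEquiv ρ'
  have hτchar := transportRep_character e.toLinearEquiv ρ'
  generalize transportRep e.toLinearEquiv ρ' = τ at hτN hτdet hτchar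
  have hV := ((isIrreducible_iff_forall_submodule ρ).1 hρ.1).1
  ext u
  -- Both extensions agree on `N`, so `ρ(u)⁻¹τ(u)` commutes with the irreducible `ρ_N` and is a
  -- scalar `c`. It remains to see that `c = 1`.
  obtain ⟨c, hcu⟩ := exists_eq_smul_of_commute hi (ρ u⁻¹ * τ u) fun x v => by
    change (ρ u⁻¹ * τ u) (ρ x v) = ρ x ((ρ u⁻¹ * τ u) v)
    rw [← hτN x x.2, ← Module.End.mul_apply, ← Module.End.mul_apply]
    congr 1
    have h1 : u * x * u⁻¹ ∈ N := ‹N.Normal›.conj_mem x x.2 u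
    calc ρ u⁻¹ * τ u * τ x = ρ u⁻¹ * (τ (u * x * u⁻¹) * τ u) := by
          rw [mul_assoc, ← map_mul, ← map_mul]; simp [mul_assoc]
      _ = τ x * (ρ u⁻¹ * τ u) := by
          rw [hτN _ h1, hτN x x.2, ← mul_assoc, ← mul_assoc, ← map_mul, ← map_mul]
          simp [mul_assoc]
  have hτu : τ u = c • ρ u := by
    refine LinearMap.ext fun v => ?_
    have h1 := congrArg (ρ u) (hcu v)
    rw [map_smul, ← Module.End.mul_apply, ← mul_assoc, ← map_mul, mul_inv_cancel, map_one,
      one_mul] at h1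
    exact h1
  -- The element `u ^ (p ^ k)` lies in `N`, where `τ` and `ρ` agree.
  have hc1 : c ^ (p ^ k) = 1 := by
    have h1 := hτN _ (hidx ▸ Subgroup.pow_index_mem N u : u ^ (p ^ k) ∈ N)
    rw [map_pow, hτu, smul_pow, ← map_pow] at h1
    obtain ⟨v, hv⟩ := exists_ne (0 : Fin n → ℂ)
    set y := u ^ (p ^ k)
    have h2 := LinearMap.congr_fun h1 (ρ y⁻¹ v)
    rw [LinearMap.smul_apply, ← Module.End.mul_apply, ← map_mul, mul_inv_cancel, map_one,
      Module.End.one_apply] at h2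
    exact smul_left_injective ℂ hv (h2.trans (one_smul ℂ v).symm)
  -- Comparing determinants: `c ^ n` is a quotient of two roots of unity of orders dividing `a` and
  -- `a'`, so the order of `c` is also prime to `p`.
  have hc2 : c ^ (n * (a * a')) = 1 := by
    have h1 := hτdet u
    rw [hτu, LinearMap.det_smul, Module.finrank_fin_fun] at h1
    have h2 := congrArg (· ^ (a * a')) h1
    simp only [mul_pow] at h2
    rw [pow_mul (LinearMap.det (ρ u)), hdet, one_pow, mul_one, mul_comm a a',
      pow_mul (LinearMap.det (ρ' u)), hdet', one_pow, mul_comm a' a] at h2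
    rw [pow_mul, h2]
  have hcop : ¬ p ∣ n * (a * a') := by
    simp only [(Fact.out : p.Prime).dvd_mul]; tauto
  have h1 := eq_one_of_pow_eq_one_of_coprime (coprime_pow_of_not_dvd hcop) hc1 hc2
  rw [h1, one_smul] at hτu
  rw [← hρ.2, ← hρ'.2, ← hτchar, Representation.character, Representation.character, hτu]

/-- The group of pairs `(u, X)`, where `X` intertwines `ρ` and its `u`-conjugate and
`det X ^ a = 1`. -/
def liftGroup {U : Type*} [Group U] {N : Subgroup U} [N.Normal] {n : ℕ}
    (ρ : Representation ℂ N (Fin n → ℂ)) (a : ℕ) :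
    Subgroup (U × (Module.End ℂ (Fin n → ℂ))ˣ) where
  carrier := {t | (∀ x : N, (t.2 : Module.End ℂ (Fin n → ℂ)) * ρ x =
    ρ (MulAut.conjNormal t.1 x) * t.2) ∧
      LinearMap.det (t.2 : Module.End ℂ (Fin n → ℂ)) ^ a = 1}
  one_mem' := by simp
  mul_mem' := by
    rintro ⟨u, X⟩ ⟨v, Y⟩ ⟨h1, h2⟩ ⟨h3, h4⟩
    dsimp only at h1 h2 h3 h4
    refine ⟨fun x => ?_, ?_⟩
    · simp only [Prod.mk_mul_mk, Units.val_mul]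
      rw [mul_assoc, h3, ← mul_assoc, h1, mul_assoc, map_mul, MulAut.mul_apply]
    · simp only [Prod.mk_mul_mk, Units.val_mul, map_mul, mul_pow, h2, h4, one_mul]
  inv_mem' := by
    rintro ⟨u, X⟩ ⟨h1, h2⟩
    dsimp only at h1 h2
    refine ⟨fun x => ?_, ?_⟩
    · simp only [Prod.inv_mk]
      rw [Units.inv_mul_eq_iff_eq_mul, ← mul_assoc, Units.eq_mul_inv_iff_mul_eq, h1, map_inv,
        MulAut.apply_inv_self]
    · simp only [Prod.inv_mk]
      have h3 := congrArg LinearMap.det (Units.mul_inv X)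
      rw [map_mul, map_one] at h3
      have h4 := congrArg (· ^ a) h3
      simpa only [mul_pow, h2, one_mul, one_pow] using h4

/-- An invariant coprime irreducible character extends across a `p`-quotient. -/
theorem IsCoprimeIrr.exists_extension {U : Type*} [Group U] [Finite U] {N : Subgroup U} [N.Normal]
    {k : ℕ} (hidx : N.index = p ^ k) {θ : N → ℂ} (hθ : IsCoprimeIrr p θ)
    (hinv : ∀ (u : U) (x : N), θ (MulAut.conjNormal u x) = θ x) :
    ∃ χ : U → ℂ, IsCoprimeIrr p χ ∧ ∀ x : N, χ x = θ x := by
  obtain ⟨n, ρ, hρ, hpn, a, ha, hdet⟩ := hθ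
  have hV := ((isIrreducible_iff_forall_submodule ρ).1 hρ.1).1
  have hn0 : n ≠ 0 := hρ.pos.ne'
  have ha0 : a ≠ 0 := fun h => ha (h ▸ dvd_zero p)
  obtain ⟨v₀, hv₀⟩ := exists_ne (0 : Fin n → ℂ)
  -- elements over `N` are scalar multiples of the values of `ρ`
  have hscal : ∀ t ∈ liftGroup ρ a, ∀ x : N, t.1 = x →
      ∃ c : ℂ, (t.2 : Module.End ℂ (Fin n → ℂ)) = c • ρ x ∧ c ^ (n * a) = 1 := by
    rintro ⟨u, X⟩ ⟨h1, h2⟩ x hx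
    dsimp only at hx h1 h2 ⊢
    subst hx
    have hcn : ∀ y : N, MulAut.conjNormal (x : U) y = x * y * x⁻¹ := fun y => by ext; simp
    obtain ⟨c, hc⟩ := exists_eq_smul_of_commute hρ.1 (ρ x⁻¹ * X) fun y v => by
      rw [← Module.End.mul_apply, ← Module.End.mul_apply]
      congr 1
      rw [mul_assoc, h1, hcn, ← mul_assoc, ← mul_assoc, ← map_mul, ← map_mul]
      simp [mul_assoc]
    have hX : (X : Module.End ℂ (Fin n → ℂ)) = c • ρ x := by
      refine LinearMap.ext fun v => ?_
      have h3 := congrArg (ρ x) (hc v)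
      rw [map_smul, ← Module.End.mul_apply, ← mul_assoc, ← map_mul, mul_inv_cancel, map_one,
        one_mul] at h3
      exact h3
    refine ⟨c, hX, ?_⟩
    rw [hX, LinearMap.det_smul, Module.finrank_fin_fun, mul_pow, hdet, mul_one, ← pow_mul] at h2
    exact h2
  let π : liftGroup ρ a →* U := (MonoidHom.fst _ _).comp (liftGroup ρ a).subtype
  have hπ : Function.Surjective π := by
    intro u
    let ρu : Representation ℂ N (Fin n → ℂ) := ρ.comp (MulAut.conjNormal u).toMonoidHom
    have hρu : Affords ρu θ := by
      refine ⟨isIrreducible_of_forall_exists_smul (LinearEquiv.refl ℂ _)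
        (fun g => ⟨(MulAut.conjNormal u).symm g, 1, fun v => by simp [ρu]⟩) hρ.1, ?_⟩
      ext x
      rw [← hinv u x, ← hρ.2]; rfl
    obtain ⟨e⟩ := hρu.nonempty_equiv hρ
    have he : ∀ x v, e.toLinearEquiv (ρ x v) = ρu x (e.toLinearEquiv v) := fun x v =>
      LinearMap.congr_fun (e.toIntertwiningMap.isIntertwining' x) v
    let X : (Module.End ℂ (Fin n → ℂ))ˣ := LinearMap.GeneralLinearGroup.ofLinearEquiv e.toLinearEquiv
    have hXd : LinearMap.det (X : Module.End ℂ (Fin n → ℂ)) ≠ 0 :=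
      (LinearMap.det.comp (Units.coeHom _)).toHomUnits X |>.ne_zero
    -- Invariance of `θ` gives an intertwiner `X`; an `n`-th root of `(det X)⁻¹` rescales it to
    -- determinant `1`, so that it lies in `liftGroup`.
    obtain ⟨c, hc⟩ := IsAlgClosed.exists_pow_nat_eq
      (LinearMap.det (X : Module.End ℂ (Fin n → ℂ)))⁻¹ (Nat.pos_of_ne_zero hn0)
    have hc0 : c ≠ 0 := by
      rintro rfl
      rw [zero_pow hn0] at hc
      exact inv_ne_zero hXd hc.symm
    let Y : (Module.End ℂ (Fin n → ℂ))ˣ := Units.mk0 c hc0 • X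
    have hY : (Y : Module.End ℂ (Fin n → ℂ)) = c • (X : Module.End ℂ (Fin n → ℂ)) := rfl
    refine ⟨⟨(u, Y), fun x => ?_, ?_⟩, rfl⟩
    · dsimp only
      rw [hY]
      refine LinearMap.ext fun v => ?_
      simp only [smul_mul_assoc, mul_smul_comm, LinearMap.smul_apply, Module.End.mul_apply]
      congr 1
      exact he x v
    · dsimp only
      rw [hY, LinearMap.det_smul, Module.finrank_fin_fun, hc, inv_mul_cancel₀ hXd, one_pow]
  -- The kernel of `π` consists of scalars that are `(n * a)`-th roots of unity, and `U` is finite.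
  have hfin : Finite (liftGroup ρ a) := by
    rw [π.finite_iff_finite_ker_range]
    refine ⟨?_, inferInstance⟩
    have h1 : ∀ t : π.ker, ∃ c : ℂ, ((t : liftGroup ρ a) : U × (Module.End ℂ (Fin n → ℂ))ˣ).2.val
        = c • ρ 1 ∧ c ^ (n * a) = 1 := fun t => hscal _ t.1.2 1 t.2
    choose c hc hc' using h1
    have hfs : {z : ℂ | z ^ (n * a) = 1}.Finite := by
      refine (Polynomial.nthRootsFinset (n * a) (1 : ℂ)).finite_toSet.subset fun z hz => ?_
      rw [Finset.mem_coe, Polynomial.mem_nthRootsFinset (Nat.pos_of_ne_zero (mul_ne_zero hn0 ha0))]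
      exact hz
    have := hfs.to_subtype
    refine Finite.of_injective (fun t => (⟨c t, hc' t⟩ : {z : ℂ | z ^ (n * a) = 1})) ?_
    intro t t' h
    have h2 : c t = c t' := congrArg Subtype.val h
    refine Subtype.ext (Subtype.ext (Prod.ext ?_ (Units.ext ?_)))
    · exact t.2.trans t'.2.symm
    · rw [hc, hc, h2]
  -- the copy of `N`
  let ι : N →* liftGroup ρ a :=
    { toFun := fun x => ⟨(x, ρ.asGroupHom x), fun y => by
        simp only [Representation.asGroupHom_apply]
        rw [← map_mul, ← map_mul]
        congr 1
        ext; simp, by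
        simp only [Representation.asGroupHom_apply]; exact hdet x⟩
      map_one' := by ext1; simp
      map_mul' := fun x y => by ext1; simp }
  have hnormal : ι.range.Normal := by
    refine ⟨?_⟩
    rintro _ ⟨x, rfl⟩ ⟨⟨u, X⟩, h1, h2⟩
    refine ⟨MulAut.conjNormal u x, Subtype.ext (Prod.ext ?_ (Units.ext ?_))⟩
    · simp [ι]
    · have h3 := h1 x
      dsimp only at h3
      simp only [ι, MonoidHom.coe_mk, OneHom.coe_mk, Representation.asGroupHom_apply]
      change _ = (X : Module.End ℂ (Fin n → ℂ)) * ρ.asGroupHom x * (X⁻¹ : (Module.End ℂ (Fin n → ℂ))ˣ)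
      rw [Representation.asGroupHom_apply, h3, Units.mul_inv_cancel_right]
  obtain ⟨S⟩ : Nonempty (Sylow p (liftGroup ρ a)) := inferInstance
  -- A member of a Sylow `p`-subgroup lying over `x` is `c • ρ x` with `c` of `p`-power order, but
  -- also `c ^ (n * a) = 1` with `n * a` prime to `p`; so `c = 1`.
  have hSN : ∀ s ∈ S, ∀ x : N, π s = x → s = ι x := by
    intro s hs x hx
    obtain ⟨c, hc, hc'⟩ := hscal s s.2 x hx
    obtain ⟨j, hj⟩ := S.isPGroup' ⟨s, hs⟩
    have hj' : s ^ (p ^ j) = 1 := congrArg Subtype.val hj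
    have hxj : x ^ (p ^ j) = 1 := by
      ext
      rw [Subgroup.coe_pow, ← hx, ← map_pow, hj', map_one]; rfl
    have hcj : c ^ (p ^ j) = 1 := by
      have h1 := congrArg (fun t : liftGroup ρ a => (t.1.2 : Module.End ℂ (Fin n → ℂ))) hj'
      simp only [Subgroup.coe_pow, Prod.pow_snd, Units.val_pow_eq_pow_val, hc, smul_pow] at h1
      rw [← map_pow, hxj, map_one] at h1
      have h2 := LinearMap.congr_fun h1 v₀
      exact smul_left_injective ℂ hv₀ (h2.trans (one_smul ℂ v₀).symm)
    have hcop : ¬ p ∣ n * a := by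
      simp only [(Fact.out : p.Prime).dvd_mul]; tauto
    have h1 := eq_one_of_pow_eq_one_of_coprime (coprime_pow_of_not_dvd hcop) hcj hc'
    rw [h1, one_smul] at hc
    exact Subtype.ext (Prod.ext hx (Units.ext hc))
  let T : Subgroup (liftGroup ρ a) := (S : Subgroup (liftGroup ρ a)) ⊔ ι.range
  have hST : ∀ s ∈ (S : Subgroup (liftGroup ρ a)), s ∈ T := fun s hs => Subgroup.mem_sup_left hs
  have hιT : ∀ x, ι x ∈ T := fun x => Subgroup.mem_sup_right ⟨x, rfl⟩
  -- Thus `T = S ι(N)` meets the scalars trivially, and it covers `U` because `U/N` is a `p`-group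
  -- and hence the image of `S`. The inverse of this isomorphism, followed by the operator
  -- component, is the extension.
  have hbij : Function.Bijective (π.comp T.subtype) := by
    constructor
    · rw [injective_iff_map_eq_one]
      rintro ⟨t, ht⟩ h1
      obtain ⟨s, hs, _, ⟨x, rfl⟩, rfl⟩ := Subgroup.mem_sup_of_normal_right.1 ht
      have h2 : π s * x = 1 := h1
      have h3 := hSN s hs x⁻¹ (eq_inv_of_mul_eq_one_left h2)
      ext1
      change s * ι x = 1
      rw [h3, ← map_mul, inv_mul_cancel, map_one]
    · intro u
      have hq : Function.Surjective ((QuotientGroup.mk' N).comp π) :=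
        (QuotientGroup.mk'_surjective N).comp hπ
      have hpg : IsPGroup p (U ⧸ N) := IsPGroup.of_card (n := k) hidx
      have htop : (S.mapSurjective hq : Subgroup (U ⧸ N)) = ⊤ :=
        ((S.mapSurjective hq).is_maximal' (Q := ⊤) (hpg.to_subgroup ⊤) le_top).symm
      have hu : (QuotientGroup.mk' N u) ∈ (S.mapSurjective hq : Subgroup (U ⧸ N)) :=
        htop ▸ Subgroup.mem_top _
      rw [Sylow.coe_mapSurjective] at hu
      obtain ⟨s, hs, hsu⟩ := hu
      have h1 : (π s)⁻¹ * u ∈ N := QuotientGroup.eq.1 hsu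
      refine ⟨⟨s * ι ⟨_, h1⟩, T.mul_mem (hST s hs) (hιT _)⟩, ?_⟩
      change π s * ((π s)⁻¹ * u) = u
      rw [mul_inv_cancel_left]
  let f : T ≃* U := MulEquiv.ofBijective _ hbij
  let σ : Representation ℂ U (Fin n → ℂ) := ((Units.coeHom (Module.End ℂ (Fin n → ℂ))).comp
    ((MonoidHom.snd _ _).comp ((liftGroup ρ a).subtype.comp T.subtype))).comp f.symm.toMonoidHom
  have hσN : ∀ x : N, σ x = ρ x := fun x => by
    have h1 : f.symm (x : U) = ⟨ι x, hιT x⟩ := by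
      rw [MulEquiv.symm_apply_eq]; rfl
    change ((f.symm (x : U)).1.1.2 : Module.End ℂ (Fin n → ℂ)) = ρ x
    rw [h1]; rfl
  have hσi : σ.IsIrreducible := isIrreducible_of_forall_exists_smul (LinearEquiv.refl ℂ _)
    (fun x : N => ⟨(x : U), 1, fun v => by rw [hσN]; simp⟩) hρ.1
  refine ⟨σ.character, ⟨n, σ, ⟨hσi, rfl⟩, hpn, a, ha, fun u => ?_⟩, fun x => ?_⟩
  · exact (f.symm u).1.2.2
  · rw [← hρ.2, Representation.character, Representation.character, hσN]

end

end

noncomputable section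

open scoped ComplexConjugate

/-! ### Twisting by linear characters -/

/-- Twisting a representation by a linear character. -/
def twistRep {H V : Type*} [Group H] [AddCommGroup V] [Module ℂ V] (β : H →* ℂˣ)
    (ρ : Representation ℂ H V) : Representation ℂ H V where
  toFun h := (β h : ℂ) • ρ h
  map_one' := by simp
  map_mul' g h := by
    rw [map_mul, map_mul, Units.val_mul, smul_mul_smul_comm]

theorem Affords.twist {H : Type*} [Group H] {n : ℕ} (β : H →* ℂˣ)
    {ρ : Representation ℂ H (Fin n → ℂ)} {χ : H → ℂ} (h : Affords ρ χ) :
    Affords (twistRep β ρ) fun x => β x * χ x := by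
  constructor
  · exact isIrreducible_of_forall_exists_smul (LinearEquiv.refl ℂ _)
      (fun g => ⟨g, (β g : ℂ)⁻¹, fun v => by
        simp [twistRep]⟩) h.1
  · ext x
    rw [← h.2, Representation.character, Representation.character]
    simp [twistRep]

/-! ### Coprime characters of subgroups -/

section

variable {p : ℕ}

theorem IsCoprimeIrr.mem_irr {H : Type*} [Group H] {χ : H → ℂ} (h : IsCoprimeIrr p χ) :
    χ ∈ Irr H := by
  obtain ⟨n, ρ, h, -⟩ := h
  exact ⟨n, ρ, h⟩

theorem IsCoprimeIrr.comp_equiv {H K : Type*} [Group H] [Group K] (e : K ≃* H) {χ : H → ℂ}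
    (hχ : IsCoprimeIrr p χ) : IsCoprimeIrr p fun k => χ (e k) := by
  obtain ⟨n, ρ, hρ, hn, a, ha, hdet⟩ := hχ
  refine ⟨n, ρ.comp e.toMonoidHom, ⟨?_, ?_⟩, hn, a, ha, fun h => hdet (e h)⟩
  · exact isIrreducible_of_forall_exists_smul (LinearEquiv.refl ℂ _)
      (fun g => ⟨e.symm g, 1, fun v => by simp⟩) hρ.1
  · rw [← hρ.2]; rfl

variable {G : Type*} [Group G]

/-- The restriction of `f` to `H` is an irreducible character of degree and determinantal order
prime to `p`. -/
def CoprimeIrrOn (p : ℕ) (H : Subgroup G) (f : G → ℂ) : Prop := IsCoprimeIrr p fun x : H => f x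

theorem CoprimeIrrOn.irrOn {H : Subgroup G} {f : G → ℂ} (h : CoprimeIrrOn p H f) : IrrOn H f :=
  h.mem_irr

theorem CoprimeIrrOn.exists_degree {H : Subgroup G} {f : G → ℂ} (h : CoprimeIrrOn p H f) :
    ∃ n : ℕ, 0 < n ∧ f 1 = n ∧ ¬ p ∣ n := by
  obtain ⟨n, ρ, h, hn, -⟩ := h
  exact ⟨n, h.pos, h.apply_one, hn⟩

theorem CoprimeIrrOn.conj {N : Subgroup G} {θ : G → ℂ} (hθ : CoprimeIrrOn p N θ) {a : G}
    (ha : ∀ x, x ∈ N ↔ a * x * a⁻¹ ∈ N) : CoprimeIrrOn p N fun x => θ (a * x * a⁻¹) :=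
  IsCoprimeIrr.comp_equiv (conjOn N a ha) hθ

theorem Normalizes.normal_subgroupOf {U N : Subgroup G} (hN : Normalizes U N) :
    (N.subgroupOf U).Normal :=
  ⟨fun x hx u => hN u u.2 x hx⟩

variable [Finite G] [Fact p.Prime]

theorem CoprimeIrrOn.exists_extension {U N : Subgroup G} (hNU : N ≤ U) (hN : Normalizes U N)
    {k : ℕ} (hidx : N.relIndex U = p ^ k) {θ : G → ℂ} (hθ : CoprimeIrrOn p N θ)
    (hinv : InvariantUnder U N θ) : ∃ f, CoprimeIrrOn p U f ∧ ∀ x ∈ N, f x = θ x := by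
  have := hN.normal_subgroupOf
  obtain ⟨χ, hχ, hχN⟩ := IsCoprimeIrr.exists_extension (N := N.subgroupOf U) hidx
    (hθ.comp_equiv (Subgroup.subgroupOfEquivOfLe hNU)) fun u x => hinv u u.2 x x.2
  refine ⟨extendZero U χ, by rwa [CoprimeIrrOn, extendZero_comp], fun x hx => ?_⟩
  refine (extendZero_coe U χ ⟨x, hNU hx⟩).trans ?_
  exact hχN ⟨⟨x, hNU hx⟩, hx⟩

theorem CoprimeIrrOn.eq_of_eq_on {U N : Subgroup G} (hNU : N ≤ U) (hN : Normalizes U N)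
    {k : ℕ} (hidx : N.relIndex U = p ^ k) {f f' : G → ℂ} (hf : CoprimeIrrOn p U f)
    (hf' : CoprimeIrrOn p U f') (hirr : IrrOn N f) (heq : ∀ x ∈ N, f x = f' x) :
    ∀ x ∈ U, f x = f' x := by
  have := hN.normal_subgroupOf
  have h := IsCoprimeIrr.eq_of_eq_on (N := N.subgroupOf U) hidx hf hf'
    (Irr.comp_equiv (Subgroup.subgroupOfEquivOfLe hNU) hirr) fun x hx => heq x hx
  exact fun x hx => congrFun h ⟨x, hx⟩

/-- The coprime extension inherits invariance. -/
theorem CoprimeIrrOn.invariantUnder_of_eq_on {A U N : Subgroup G} (hNU : N ≤ U) (hUA : U ≤ A)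
    (hU : Normalizes A U) (hN : Normalizes A N) {k : ℕ} (hidx : N.relIndex U = p ^ k)
    {f : G → ℂ} (hf : CoprimeIrrOn p U f) (hirr : IrrOn N f) (hinv : InvariantUnder A N f) :
    InvariantUnder A U f := fun a ha =>
  -- The conjugate of `f` by `a` is again a coprime extension of the same character of `N`, so
  -- uniqueness of such extensions applies.
  CoprimeIrrOn.eq_of_eq_on hNU (hN.mono hUA) hidx (hf.conj (hU.mem_iff ha)) hf
    (hirr.conj (hN.mem_iff ha)) (hinv a ha)

/-- A character of prime-to-`p` degree over an invariant coprime character is coprime if the index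
is prime to `p`. -/
theorem CoprimeIrrOn.of_over {M E : Subgroup G} (hEM : E ≤ M) (hE : Normalizes M E)
    (hidx : ¬ p ∣ E.relIndex M) {θ φ : G → ℂ} (hθ : CoprimeIrrOn p E θ)
    (hinv : InvariantUnder M E θ) (hφ : IrrOn M φ) (hover : multOn E φ θ ≠ 0)
    (hdeg : ∃ m : ℕ, φ 1 = m ∧ ¬ p ∣ m) : CoprimeIrrOn p M φ := by
  classical
  obtain ⟨e, -, -, he⟩ := hθ.irrOn.eq_natCast_mul hEM hE hinv hφ hover
  obtain ⟨t, τ, hτ, -, k, hk, hdet⟩ := hθ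
  obtain ⟨n, ρ, hρ⟩ := hφ
  obtain ⟨m, hm, hpm⟩ := hdeg
  have hnm : n = m := by
    have := hρ.apply_one
    rw [Subgroup.coe_one, hm] at this
    exact_mod_cast this.symm
  let ρE : Representation ℂ E (Fin n → ℂ) := ρ.comp (Subgroup.inclusion hEM)
  obtain ⟨s, hs, hsum, hsdet⟩ := exists_multiset_irr _ ρE rfl
  have hsum' : s.sum = fun x : E => e * θ x := by
    rw [← hsum]
    ext x
    rw [← he x x.2]
    exact congrFun hρ.2 (Subgroup.inclusion hEM x)
  have hθE : (fun x : E => θ x) ∈ Irr E := ⟨t, τ, hτ⟩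
  -- Every constituent of `φ_E` is `θ`, so on `E` the determinant of `φ` is a power of that of `θ`.
  have hall : ∀ χ ∈ s, χ = fun x : E => θ x := fun χ hχ => by
    by_contra hne
    have h1 := charInner_multiset_irr hs (hs χ hχ)
    have h2 : charInner s.sum χ = e * charInner (fun x : E => θ x) χ := by
      have := Fintype.ofFinite E
      rw [hsum', charInner_eq_sum, charInner_eq_sum]
      simp only [mul_assoc, ← Finset.mul_sum]
      rw [mul_left_comm]
    rw [charInner_irr hθE (hs χ hχ), if_neg (Ne.symm hne), mul_zero, h1] at h2
    exact (Multiset.count_ne_zero.2 hχ) (by exact_mod_cast h2)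
  have hdetE : ∀ x : E, LinearMap.det (ρE x) ^ k = 1 := fun x => by
    rw [hsdet, Multiset.map_congr (g := fun _ => LinearMap.det (τ x)) rfl
      fun χ hχ => by rw [hall χ hχ, hτ.irrDet_eq]]
    rw [Multiset.map_const', Multiset.prod_replicate, ← pow_mul, mul_comm, pow_mul, hdet, one_pow]
  refine ⟨n, ρ, hρ, hnm ▸ hpm, E.relIndex M * k,
    fun h => ((Fact.out : p.Prime).dvd_mul.1 h).elim hidx hk, fun x => ?_⟩
  have := hE.normal_subgroupOf
  have hx : ((x ^ E.relIndex M : M) : G) ∈ E :=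
    Subgroup.pow_index_mem (E.subgroupOf M) x
  rw [pow_mul, ← map_pow LinearMap.det, ← map_pow ρ]
  exact hdetE ⟨_, hx⟩

/-- Equal characters have equal determinants, which forces `γ ^ n = 1` with `n` the degree, prime to
`p`, while `γ` has `p`-power order. Consequently twists of a coprime character by distinct
characters of `p`-power order are distinct. -/
theorem eq_one_of_twist_eq {H : Type*} [Group H] [Finite H] {χ : H → ℂ} (hχ : IsCoprimeIrr p χ)
    (γ : H →* ℂˣ) {k : ℕ} (hγ : ∀ x, γ x ^ (p ^ k) = 1) (h : ∀ x, γ x * χ x = χ x) : γ = 1 := by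
  obtain ⟨n, ρ, hρ, hpn, -⟩ := hχ
  have h1 := hρ.twist γ
  rw [funext h] at h1
  have h2 := detChar_eq_of_affords h1 hρ
  ext x
  have h3 : LinearMap.det ((γ x : ℂ) • ρ x) = LinearMap.det (ρ x) := DFunLike.congr_fun h2 x
  have hd : LinearMap.det (ρ x) ≠ 0 := ((detChar ρ).toHomUnits x).ne_zero
  rw [LinearMap.det_smul, Module.finrank_fin_fun, mul_eq_right₀ hd] at h3
  have h4 : γ x = 1 := eq_one_of_pow_eq_one_of_coprime (coprime_pow_of_not_dvd hpn) (hγ x)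
    (Units.ext (by simpa using h3))
  rw [h4]; rfl

end

end

noncomputable section

/-! ### `p`-solvable groups -/

section

variable {p : ℕ} [Fact p.Prime] {Γ R : Type*} [Group Γ] [Group R]

theorem Subgroup.relIndex_dvd_relIndex_of_normal {H K L : Subgroup Γ} [H.Normal] (h : K ≤ L) :
    H.relIndex K ∣ H.relIndex L := by
  rw [← Subgroup.relIndex_subgroupOf h]
  exact Subgroup.relIndex_dvd_index_of_normal _ _

theorem IsPSolvable.factor_of_dvd {a b : ℕ} (hab : a ∣ b) (h : (∃ k : ℕ, b = p ^ k) ∨ ¬ p ∣ b) :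
    (∃ k : ℕ, a = p ^ k) ∨ ¬ p ∣ a := by
  rcases h with ⟨k, rfl⟩ | h
  · obtain ⟨j, -, hj⟩ := (Nat.dvd_prime_pow Fact.out).1 hab
    exact Or.inl ⟨j, hj⟩
  · exact Or.inr fun h' => h (h'.trans hab)

theorem IsPSolvable.of_injective (h : IsPSolvable p Γ) (f : R →* Γ) (hf : Function.Injective f) :
    IsPSolvable p R := by
  obtain ⟨n, H, h0, hn, hnor, hstep⟩ := h
  refine ⟨n, fun i => (H i).comap f, ?_, ?_, fun i hi => ?_, fun i hi => ⟨?_, ?_⟩⟩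
  · change (H 0).comap f = ⊥
    rw [h0, MonoidHom.comap_bot, f.ker_eq_bot_iff.2 hf]
  · change (H n).comap f = ⊤
    rw [hn, Subgroup.comap_top]
  · exact (hnor i hi).comap f
  · exact Subgroup.comap_mono (hstep i hi).1
  · have := hnor i hi.le
    refine IsPSolvable.factor_of_dvd ?_ (hstep i hi).2
    rw [Subgroup.relIndex_comap]
    exact Subgroup.relIndex_dvd_relIndex_of_normal (Subgroup.map_comap_le _ _)

theorem IsPSolvable.of_surjective (h : IsPSolvable p Γ) (f : Γ →* R)
    (hf : Function.Surjective f) : IsPSolvable p R := by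
  obtain ⟨n, H, h0, hn, hnor, hstep⟩ := h
  refine ⟨n, fun i => (H i).map f, ?_, ?_, fun i hi => ?_, fun i hi => ⟨?_, ?_⟩⟩
  · change (H 0).map f = ⊥
    rw [h0, Subgroup.map_bot]
  · change (H n).map f = ⊤
    rw [hn, Subgroup.map_top_of_surjective f hf]
  · exact (hnor i hi).map f hf
  · exact Subgroup.map_mono (hstep i hi).1
  · have := hnor i hi.le
    refine IsPSolvable.factor_of_dvd ?_ (hstep i hi).2
    have hle := (hstep i hi).1
    have : H (i + 1) ⊔ f.ker = H (i + 1) ⊔ (H i ⊔ f.ker) := by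
      rw [← sup_assoc, sup_eq_left.2 hle]
    rw [Subgroup.relIndex_map_map, this, Subgroup.relIndex_sup_right]
    exact Subgroup.relIndex_dvd_of_le_left _ le_sup_left

/-- Take the first term `H (j + 1)` of the series that meets `D` nontrivially. Its intersection with
`D` meets `H j` trivially, so its order divides the order of one factor of the series. -/
theorem IsPSolvable.exists_normal_le (h : IsPSolvable p Γ) {D : Subgroup Γ} (hD : D.Normal)
    (hD0 : D ≠ ⊥) : ∃ N ≤ D, N.Normal ∧ N ≠ ⊥ ∧
      ((∃ k : ℕ, Nat.card N = p ^ k) ∨ ¬ p ∣ Nat.card N) := by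
  classical
  obtain ⟨n, H, h0, hn, hnor, hstep⟩ := h
  have hex : ∃ i, i ≤ n ∧ H i ⊓ D ≠ ⊥ := ⟨n, le_rfl, by rwa [hn, top_inf_eq]⟩
  obtain ⟨hi, hne⟩ := Nat.find_spec hex
  obtain ⟨j, hj⟩ : ∃ j, Nat.find hex = j + 1 := by
    refine Nat.exists_eq_succ_of_ne_zero fun h => ?_
    rw [h, h0, bot_inf_eq] at hne
    exact hne rfl
  have hbot : H j ⊓ D = ⊥ := by
    by_contra hc
    exact Nat.find_min hex (m := j) (by omega) ⟨by omega, hc⟩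
  rw [hj] at hi hne
  have := hnor _ hi
  have := hnor j (by omega)
  refine ⟨H (j + 1) ⊓ D, inf_le_right, inferInstance, hne, ?_⟩
  refine IsPSolvable.factor_of_dvd ?_ (hstep j (by omega)).2
  have h1 : Nat.card (H (j + 1) ⊓ D : Subgroup Γ) = (H j).relIndex (H (j + 1) ⊓ D) := by
    rw [← Subgroup.inf_relIndex_right, inf_left_comm, hbot, inf_bot_eq, Subgroup.relIndex_bot_left]
  rw [h1]
  exact Subgroup.relIndex_dvd_relIndex_of_normal inf_le_left

/-- A linear character of a complemented normal subgroup extends to its stabilizer. -/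
theorem exists_extension_of_complement {C : Type*} [CommGroup C] {E Y T : Subgroup Γ}
    (hE : E.Normal) (hdisj : ∀ x ∈ E, x ∈ Y → x = 1)
    (hdec : ∀ g, ∃ e ∈ E, ∃ y ∈ Y, e * y = g) (hET : E ≤ T) (β : E →* C)
    (hβ : ∀ t ∈ T, ∀ e : E, β ⟨t * e * t⁻¹, hE.conj_mem e e.2 t⟩ = β e) :
    ∃ γ : T →* C, ∀ e : E, γ ⟨e, hET e.2⟩ = β e := by
  have h : ∀ t : T, ∃ e : E, (e : Γ)⁻¹ * t ∈ Y := fun t => by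
    obtain ⟨e, he, y, hy, h⟩ := hdec t
    exact ⟨⟨e, he⟩, by rw [← h]; simpa using hy⟩
  choose f hf using h
  have huniq : ∀ (t : T) (e : E), (e : Γ)⁻¹ * t ∈ Y → f t = e := fun t e he => by
    have h1 : (f t : Γ)⁻¹ * e ∈ Y := by
      have : (f t : Γ)⁻¹ * e = ((f t : Γ)⁻¹ * t) * ((e : Γ)⁻¹ * t)⁻¹ := by group
      rw [this]
      exact mul_mem (hf t) (inv_mem he)
    have h2 := hdisj _ (mul_mem (inv_mem (f t).2) e.2) h1
    exact Subtype.ext (inv_mul_eq_one.1 h2)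
  -- The extension sends `e * y` to `β e`. It is multiplicative because the `Y`-part of `s` lies in
  -- `T`, as `E ≤ T`, and so fixes `β`.
  refine ⟨MonoidHom.mk' (fun t => β (f t)) fun s t => ?_, fun e => ?_⟩
  · have hs : (f s : Γ)⁻¹ * s ∈ T := mul_mem (inv_mem (hET (f s).2)) s.2
    have h1 := hβ _ hs (f t)
    rw [← h1, ← map_mul]
    congr 1
    apply huniq
    have : ((f s * ⟨((f s : Γ)⁻¹ * s) * f t * ((f s : Γ)⁻¹ * s)⁻¹,
        hE.conj_mem _ (f t).2 _⟩ : E) : Γ)⁻¹ * (s * t : T) =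
        ((f s : Γ)⁻¹ * s) * ((f t : Γ)⁻¹ * t) := by
      push_cast; group
    rw [this]
    exact mul_mem (hf s) (hf t)
  · change β (f _) = β e
    rw [huniq ⟨e, hET e.2⟩ e (by simp)]

/-- `O_{p'}(Γ) = 1`. -/
def TrivialPPrimeCore (p : ℕ) (Γ : Type*) [Group Γ] : Prop :=
  ∀ N : Subgroup Γ, N.Normal → ¬ p ∣ Nat.card N → N = ⊥

/-- A normal subgroup with a central Sylow `p`-subgroup is a `p`-group if `O_{p'}(Γ) = 1`. -/
theorem TrivialPPrimeCore.le_of_central (hcore : TrivialPPrimeCore p Γ) {C D : Subgroup Γ}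
    (hD : D.Normal) (hCD : C ≤ D) (hcomm : ∀ c ∈ C, ∀ d ∈ D, c * d = d * c) {k : ℕ}
    (hC : Nat.card C = p ^ k) (hidx : ¬ p ∣ C.relIndex D) : D ≤ C := by
  have hN : (C.subgroupOf D).Normal := ⟨fun x hx d => by
    rw [Subgroup.mem_subgroupOf] at hx ⊢
    have : ((d * x * d⁻¹ : D) : Γ) = x := by
      push_cast
      rw [← hcomm x hx d d.2, mul_inv_cancel_right]
    rwa [this]⟩
  have hcard : Nat.card (C.subgroupOf D) = p ^ k := by
    rw [← hC]
    exact Nat.card_congr (Subgroup.subgroupOfEquivOfLe hCD).toEquiv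
  have hcop : Nat.Coprime (p ^ k) (C.subgroupOf D).index := coprime_pow_of_not_dvd hidx
  -- Schur–Zassenhaus. As `C` is central in `D`, in fact `D = C × Q`.
  obtain ⟨Q, hQ⟩ := Subgroup.exists_right_complement'_of_coprime (N := C.subgroupOf D)
    (by rwa [hcard])
  have hQcard : Nat.card Q = (C.subgroupOf D).index := hQ.symm.index_eq_card.symm
  have hdec : ∀ d : D, ∃ c ∈ C.subgroupOf D, ∃ q ∈ Q, c * q = d := fun d => by
    have : d ∈ C.subgroupOf D ⊔ Q := hQ.sup_eq_top ▸ Subgroup.mem_top d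
    exact Subgroup.mem_sup_of_normal_left.1 this
  -- `Q` is normal in `Γ`, being the set of elements of `D` whose order divides `|Q|`: such an
  -- element has a `C`-component of order dividing both `p ^ k` and `|Q|`.
  have hQn : (Q.map D.subtype).Normal := by
    refine ⟨?_⟩
    rintro _ ⟨x, hx, rfl⟩ g
    obtain ⟨c, hc, q, hq, hcq⟩ := hdec ⟨g * x * g⁻¹, hD.conj_mem x x.2 g⟩
    have hxp : x ^ Nat.card Q = 1 := by
      have := pow_card_eq_one' (x := (⟨x, hx⟩ : Q))
      exact congrArg Subtype.val this
    have hqp : q ^ Nat.card Q = 1 := by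
      have := pow_card_eq_one' (x := (⟨q, hq⟩ : Q))
      exact congrArg Subtype.val this
    have hcomm' : Commute c q := Subtype.ext (hcomm c hc q q.2)
    have h1 : c ^ Nat.card Q = 1 := by
      have h2 := congrArg (· ^ Nat.card Q) hcq
      simp only [hcomm'.mul_pow, hqp, mul_one] at h2
      rw [h2]
      ext
      rw [Subgroup.coe_pow]
      change (g * (x : Γ) * g⁻¹) ^ _ = 1
      rw [conj_pow, ← Subgroup.coe_pow, hxp]
      simp
    have h2 : c ^ (p ^ k) = 1 := by
      have := pow_card_eq_one' (x := (⟨c, hc⟩ : C.subgroupOf D))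
      rw [hcard] at this
      exact congrArg Subtype.val this
    have h3 := eq_one_of_pow_eq_one_of_coprime hcop h2 (hQcard ▸ h1)
    rw [h3, one_mul] at hcq
    exact ⟨q, hq, by rw [hcq]; rfl⟩
  have hQb := hcore _ hQn (by
    rw [Subgroup.card_map_of_injective D.subtype_injective, hQcard]
    exact hidx)
  rw [(Subgroup.map_eq_bot_iff_of_injective _ D.subtype_injective)] at hQb
  intro d hd
  obtain ⟨c, hc, q, hq, hcq⟩ := hdec ⟨d, hd⟩
  rw [hQb, Subgroup.mem_bot] at hq
  rw [hq, mul_one] at hcq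
  rw [hcq] at hc
  exact hc

/-- The centralizer of `E` in `M` is normal and contains the abelian group `E` as a central subgroup
of index prime to `p`, so it equals `E`. This is the faithful action of `M/E` on `E`. -/
theorem TrivialPPrimeCore.mem_of_commute (hcore : TrivialPPrimeCore p Γ) {E M : Subgroup Γ}
    (hE : E.Normal) (hM : M.Normal) (hEM : E ≤ M) (habel : ∀ x ∈ E, ∀ y ∈ E, x * y = y * x)
    {k : ℕ} (hk : Nat.card E = p ^ k) (hidx : ¬ p ∣ E.relIndex M) {m : Γ} (hm : m ∈ M)
    (hcomm : ∀ e ∈ E, e * m = m * e) : m ∈ E := by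
  let D := M ⊓ Subgroup.centralizer (E : Set Γ)
  have hED : E ≤ D := le_inf hEM fun x hx => Subgroup.mem_centralizer_iff.2 fun y hy =>
    habel y hy x hx
  refine hcore.le_of_central (D := D) inferInstance hED
    (fun c hc d hd => Subgroup.mem_centralizer_iff.1 hd.2 c hc) hk (fun h => hidx (h.trans ?_))
    ⟨hm, Subgroup.mem_centralizer_iff.2 hcomm⟩
  exact Subgroup.relIndex_dvd_relIndex_of_normal inf_le_left

variable [Finite Γ]

/-- The Hall–Higman lemma. -/
theorem IsPSolvable.centralizer_normalCore_le (h : IsPSolvable p Γ)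
    (hcore : TrivialPPrimeCore p Γ) (P : Sylow p Γ) :
    Subgroup.centralizer ((P : Subgroup Γ).normalCore : Set Γ) ≤ (P : Subgroup Γ).normalCore := by
  set O := (P : Subgroup Γ).normalCore with hO
  set C := Subgroup.centralizer (O : Set Γ) with hC
  have hCn : C.Normal := inferInstance
  -- Here `O` is `O_p(Γ)`, the normal core of a Sylow subgroup. If `C` exceeds its subgroup `B`,
  -- then `C/B` contains a nontrivial normal subgroup of `Γ/B` that is a `p`-group or a `p'`-group.
  let B : Subgroup Γ := C ⊓ O
  have hBn : B.Normal := inferInstance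
  by_contra hle
  let q := QuotientGroup.mk' B
  have hq : Function.Surjective q := QuotientGroup.mk'_surjective B
  have hker : q.ker = B := QuotientGroup.ker_mk' B
  have hD0 : C.map q ≠ ⊥ := fun h0 => hle fun x hx => by
    have : x ∈ q.ker := (Subgroup.map_eq_bot_iff C).1 h0 hx
    rw [hker] at this
    exact this.2
  obtain ⟨N, hNC, hNn, hN0, hN⟩ := (h.of_surjective q hq).exists_normal_le (hCn.map q hq) hD0
  let N₀ := N.comap q
  have hN₀n : N₀.Normal := hNn.comap q
  have hN₀C : N₀ ≤ C := by
    refine (Subgroup.comap_mono hNC).trans ?_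
    rw [Subgroup.comap_map_eq, hker]
    exact sup_le le_rfl inf_le_left
  have hBN₀ : B ≤ N₀ := by
    rw [← hker]; exact Subgroup.ker_le_comap q N
  have hidx : B.relIndex N₀ = Nat.card N := by
    have h1 := Subgroup.relIndex_ker q (K := N₀)
    rwa [hker, Subgroup.map_comap_eq_self_of_surjective hq] at h1
  have hBp : IsPGroup p B := P.isPGroup'.to_le (inf_le_right.trans (Subgroup.normalCore_le _))
  obtain ⟨j, hj⟩ := IsPGroup.iff_card.1 hBp
  have hcontra : ¬ N₀ ≤ B := fun h1 => hN0 (by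
    rw [← Subgroup.map_comap_eq_self_of_surjective hq N, Subgroup.map_eq_bot_iff, hker]
    exact h1)
  -- In the first case the preimage is a normal `p`-subgroup and lies in `O`. In the second, `B` is
  -- central in the preimage with index prime to `p`, against `O_{p'}(Γ) = 1`.
  rcases hN with ⟨k, hk⟩ | hN
  · have hcard : Nat.card N₀ = p ^ (j + k) := by
      rw [← Subgroup.card_mul_relIndex_of_le hBN₀, hj, hidx, hk, pow_add]
    exact hcontra (le_inf hN₀C (Subgroup.normal_le_normalCore.2 ((IsPGroup.of_card hcard).le_sylow_of_normal P)))
  · refine hcontra (hcore.le_of_central hN₀n hBN₀ (fun c hc d hd => ?_) hj (by rwa [hidx]))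
    exact (Subgroup.mem_centralizer_iff.1 (hN₀C hd)) c hc.2

/-- The image of a normal `p'`-subgroup of `R` and `O_p(Γ)`, which lies in `P` and hence in the
image of `R`, normalize each other and meet trivially, so they commute. By Hall–Higman the image
then lies in `O_p(Γ)`, so it is trivial. -/
theorem IsPSolvable.trivialPPrimeCore_of_sylow_le_range [Finite R] (h : IsPSolvable p Γ)
    (hcore : TrivialPPrimeCore p Γ) (P : Sylow p Γ) (f : R →* Γ) (hf : Function.Injective f)
    (hP : (P : Subgroup Γ) ≤ f.range) : TrivialPPrimeCore p R := by
  intro N hN hpN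
  have hHH := h.centralizer_normalCore_le hcore P
  set O := (P : Subgroup Γ).normalCore with hO
  have hOP : O ≤ P := Subgroup.normalCore_le _
  have hOn : O.Normal := inferInstance
  have hdisj : ∀ x ∈ N.map f, x ∈ O → x = 1 := by
    rintro _ ⟨x, hx, rfl⟩ hxO
    obtain ⟨k, hk⟩ := P.isPGroup' ⟨f x, hOP hxO⟩
    have hk' : f x ^ (p ^ k) = 1 := congrArg Subtype.val hk
    have h2 : f x ^ Nat.card N = 1 := by
      have := pow_card_eq_one' (x := (⟨x, hx⟩ : N))
      rw [← map_pow, show x ^ Nat.card N = 1 from congrArg Subtype.val this, map_one]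
    exact eq_one_of_pow_eq_one_of_coprime (coprime_pow_of_not_dvd hpN) hk' h2
  rw [← Subgroup.map_eq_bot_iff_of_injective N hf, Subgroup.eq_bot_iff_forall]
  intro x hx
  refine hdisj x hx (hHH ?_)
  rw [Subgroup.mem_centralizer_iff]
  intro y hy
  obtain ⟨r, hr⟩ := hP (hOP hy)
  have h1 : y * x * y⁻¹ * x⁻¹ = 1 := by
    apply hdisj
    · refine mul_mem ?_ (inv_mem hx)
      obtain ⟨z, hz, rfl⟩ := hx
      rw [← hr]
      exact ⟨r * z * r⁻¹, hN.conj_mem z hz r, by simp⟩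
    · have : y * x * y⁻¹ * x⁻¹ = y * (x * y⁻¹ * x⁻¹) := by group
      rw [this]
      exact mul_mem hy (hOn.conj_mem _ (inv_mem hy) x)
  rw [mul_inv_eq_one, mul_inv_eq_iff_eq_mul] at h1
  exact h1

/-- Minimal normal subgroups of a `p`-solvable group with `O_{p'} = 1`. -/
theorem IsPSolvable.exists_minimal_normal [Nontrivial Γ] (h : IsPSolvable p Γ)
    (hcore : TrivialPPrimeCore p Γ) :
    ∃ E : Subgroup Γ, E.Normal ∧ E ≠ ⊥ ∧ (∃ k : ℕ, Nat.card E = p ^ k) ∧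
      (∀ x ∈ E, ∀ y ∈ E, x * y = y * x) ∧ (∀ x ∈ E, x ^ p = 1) ∧
      ∀ N : Subgroup Γ, N.Normal → N ≤ E → N = ⊥ ∨ N = E := by
  obtain ⟨E, ⟨hEn, hE0⟩, hmin⟩ := (Set.toFinite {N : Subgroup Γ | N.Normal ∧ N ≠ ⊥}).exists_minimal
    ⟨⊤, inferInstance, top_ne_bot⟩
  have hmin' : ∀ N : Subgroup Γ, N.Normal → N ≤ E → N = ⊥ ∨ N = E := fun N hN hNE => by
    by_cases h0 : N = ⊥
    · exact Or.inl h0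
    · exact Or.inr (le_antisymm hNE (hmin ⟨hN, h0⟩ hNE))
  have hk : ∃ k : ℕ, Nat.card E = p ^ k := by
    obtain ⟨N, hNE, hNn, hN0, hN⟩ := h.exists_normal_le hEn hE0
    rcases hmin' N hNn hNE with h | rfl
    · exact absurd h hN0
    · rcases hN with hN | hN
      · exact hN
      · exact absurd (hcore _ hNn hN) hN0
  have hpE : IsPGroup p E := IsPGroup.iff_card.2 hk
  have hnt : Nontrivial E := (Subgroup.nontrivial_iff_ne_bot E).2 hE0
  -- The centre of the `p`-group `E` is nontrivial and normal in `Γ`, so by minimality it is all of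
  -- `E`; the same reasoning applies below to the elements with `x ^ p = 1`.
  have habel : ∀ x ∈ E, ∀ y ∈ E, x * y = y * x := by
    have := hpE.center_nontrivial
    rcases hmin' ((Subgroup.center E).map E.subtype) inferInstance (Subgroup.map_subtype_le _)
      with h | h
    · rw [Subgroup.map_eq_bot_iff_of_injective _ E.subtype_injective] at h
      exact absurd h ((Subgroup.nontrivial_iff_ne_bot _).1 this)
    · intro x hx y hy
      rw [← h] at hx
      obtain ⟨z, hz, rfl⟩ := hx
      exact congrArg Subtype.val (Subgroup.mem_center_iff.1 hz ⟨y, hy⟩).symm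
  refine ⟨E, hEn, hE0, hk, habel, ?_, hmin'⟩
  let F : Subgroup Γ :=
    { carrier := {x | x ∈ E ∧ x ^ p = 1}
      one_mem' := ⟨one_mem _, one_pow _⟩
      mul_mem' := by
        rintro a b ⟨ha, ha'⟩ ⟨hb, hb'⟩
        refine ⟨mul_mem ha hb, ?_⟩
        rw [Commute.mul_pow (habel a ha b hb), ha', hb', one_mul]
      inv_mem' := by
        rintro a ⟨ha, ha'⟩
        exact ⟨inv_mem ha, by rw [inv_pow, ha', inv_one]⟩ }
  have hFn : F.Normal := ⟨by
    rintro x ⟨hx, hx'⟩ g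
    exact ⟨hEn.conj_mem x hx g, by rw [conj_pow, hx']; simp⟩⟩
  rcases hmin' F hFn (fun x hx => hx.1) with h | h
  · exfalso
    obtain ⟨k, hk⟩ := hk
    have hk0 : k ≠ 0 := by
      rintro rfl
      rw [pow_zero] at hk
      exact hE0 (Subgroup.card_eq_one.1 hk)
    obtain ⟨x, hx⟩ := exists_prime_orderOf_dvd_card' (G := E) p (hk ▸ dvd_pow_self p hk0)
    have hxF : (x : Γ) ∈ F := ⟨x.2, by
      rw [← Subgroup.coe_pow, ← hx, pow_orderOf_eq_one]; rfl⟩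
    rw [h, Subgroup.mem_bot] at hxF
    have : x = 1 := Subtype.ext hxF
    rw [this, orderOf_one] at hx
    exact (Fact.out : p.Prime).one_lt.ne hx
  · intro x hx
    rw [← h] at hx
    exact hx.2

/-- Complements of an abelian normal subgroup of coprime index are conjugate to their
`Γ`-conjugates. -/
theorem exists_mul_mem_normalizer {E M Q : Subgroup Γ} (hE : E.Normal) (hM : M.Normal)
    (habel : ∀ x ∈ E, ∀ y ∈ E, x * y = y * x) (hcop : Nat.Coprime (Nat.card E) (Nat.card Q))
    (hdec : ∀ m ∈ M, ∃ e ∈ E, ∃ q ∈ Q, e * q = m) (hQM : Q ≤ M)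
    (hdisj : ∀ x ∈ E, x ∈ Q → x = 1) (g : Γ) :
    ∃ a ∈ E, ∀ q ∈ Q, (g⁻¹ * a) * q * (g⁻¹ * a)⁻¹ ∈ Q := by
  classical
  have := Fintype.ofFinite Q
  let _ : CommGroup E := { (inferInstance : Group E) with
    mul_comm := fun x y => Subtype.ext (habel x x.2 y y.2) }
  -- The cocycle comparing two complements of `E` in `M`: `c q` moves `q` into the conjugate of `Q`
  -- by `g`.
  have hc : ∀ q : Q, ∃ c : E, g⁻¹ * (c * q) * g ∈ Q := fun q => by
    obtain ⟨e, he, r, hr, her⟩ := hdec (g⁻¹ * q * g) (by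
      simpa using hM.conj_mem q (hQM q.2) g⁻¹)
    refine ⟨⟨g * e⁻¹ * g⁻¹, hE.conj_mem _ (inv_mem he) g⟩, ?_⟩
    have : g⁻¹ * (g * e⁻¹ * g⁻¹ * q) * g = r := by
      have : r = e⁻¹ * (g⁻¹ * q * g) := by rw [← her]; group
      rw [this]; group
    change g⁻¹ * (g * e⁻¹ * g⁻¹ * q) * g ∈ Q
    rwa [this]
  choose c hc using hc
  let act : Q → (E →* E) := fun q => (MulAut.conjNormal (q : Γ) : E ≃* E).toMonoidHom
  have hact : ∀ (q : Q) (e : E), ((act q e : E) : Γ) = q * e * (q : Γ)⁻¹ := fun q e => rfl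
  have hcoc : ∀ q r : Q, c (q * r) = c q * act q (c r) := fun q r => by
    have h1 : g⁻¹ * ((c q * act q (c r) : E) * (q * r : Q)) * g ∈ Q := by
      have : g⁻¹ * ((c q * act q (c r) : E) * (q * r : Q)) * g =
          (g⁻¹ * (c q * q) * g) * (g⁻¹ * (c r * r) * g) := by
        push_cast
        rw [hact]; group
      rw [this]
      exact mul_mem (hc q) (hc r)
    have h2 : g⁻¹ * (c (q * r) * (c q * act q (c r) : E)⁻¹ : E) * g ∈ Q := by
      have : g⁻¹ * ((c (q * r) * (c q * act q (c r) : E)⁻¹ : E) : Γ) * g =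
          (g⁻¹ * (c (q * r) * (q * r : Q)) * g) *
            (g⁻¹ * ((c q * act q (c r) : E) * (q * r : Q)) * g)⁻¹ := by
        push_cast; group
      rw [this]
      exact mul_mem (hc _) (inv_mem h1)
    have h3 : g⁻¹ * ((c (q * r) * (c q * act q (c r) : E)⁻¹ : E) : Γ) * g = 1 :=
      hdisj _ (by simpa using hE.conj_mem _ (c (q * r) * (c q * act q (c r) : E)⁻¹ : E).2 g⁻¹) h2
    have h4 : (c (q * r) * (c q * act q (c r) : E)⁻¹ : E) = 1 := by
      ext
      have := congrArg (fun x => g * x * g⁻¹) h3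
      simpa [mul_assoc] using this
    exact mul_inv_eq_one.1 h4
  -- Averaging over `Q`: multiplying the cocycle identity over `r` gives `b = (c q) ^ |Q| · (q b
  -- q⁻¹)`. As `|Q|` is prime to `|E|`, the `|Q|`-th root `a` of `b` exhibits `c` as a coboundary.
  let b : E := ∏ r, c r
  have hb : ∀ q, b = c q ^ Nat.card Q * act q b := fun q => by
    have h1 : b = ∏ r, c (q * r) := (Equiv.prod_comp (Equiv.mulLeft q) c).symm
    refine h1.trans ?_
    simp only [hcoc]
    rw [Finset.prod_mul_distrib, Finset.prod_const, Finset.card_univ, ← Nat.card_eq_fintype_card,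
      ← map_prod]
  have hpow := Nat.Coprime.pow_left_bijective (G := E) hcop
  obtain ⟨a, ha : a ^ Nat.card Q = b⟩ := hpow.2 b
  refine ⟨a, a.2, fun q hq => ?_⟩
  have h1 : a = c ⟨q, hq⟩ * act ⟨q, hq⟩ a := by
    apply hpow.1
    change a ^ _ = (_ * _) ^ _
    rw [mul_pow, ← map_pow, ha]
    exact hb ⟨q, hq⟩
  have h2 := congrArg (Subtype.val) h1
  rw [Subgroup.coe_mul, hact] at h2
  have h3 : g⁻¹ * a * q * (g⁻¹ * a)⁻¹ =
      g⁻¹ * (c ⟨q, hq⟩ * q) * g := by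
    have : (c ⟨q, hq⟩ : Γ) = a * (q * a * q⁻¹)⁻¹ := eq_mul_inv_of_mul_eq h2.symm
    rw [this]; group
  rw [h3]
  exact hc ⟨q, hq⟩

/-- A minimal normal subgroup `E` is complemented if it is properly contained in a normal
`M` with `M / E` a `p'`-group. -/
theorem TrivialPPrimeCore.exists_complement (hcore : TrivialPPrimeCore p Γ) {E M : Subgroup Γ}
    (hE : E.Normal) (hM : M.Normal) (hEM : E ≤ M) (habel : ∀ x ∈ E, ∀ y ∈ E, x * y = y * x)
    {k : ℕ} (hk : Nat.card E = p ^ k) (hidx : ¬ p ∣ E.relIndex M) (hne : ¬ M ≤ E)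
    (hmin : ∀ N : Subgroup Γ, N.Normal → N ≤ E → N = ⊥ ∨ N = E) :
    ∃ Y : Subgroup Γ, (∀ x ∈ E, x ∈ Y → x = 1) ∧ ∀ g, ∃ e ∈ E, ∃ y ∈ Y, e * y = g := by
  have hcard : Nat.card (E.subgroupOf M) = p ^ k := by
    rw [← hk]
    exact Nat.card_congr (Subgroup.subgroupOfEquivOfLe hEM).toEquiv
  have hcop : Nat.Coprime (p ^ k) (E.subgroupOf M).index := coprime_pow_of_not_dvd hidx
  obtain ⟨Q₀, hQ₀⟩ := Subgroup.exists_right_complement'_of_coprime (N := E.subgroupOf M)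
    (by rwa [hcard])
  let Q := Q₀.map M.subtype
  have hQM : Q ≤ M := Subgroup.map_subtype_le _
  have hQcard : Nat.card Q = (E.subgroupOf M).index := by
    rw [Subgroup.card_map_of_injective M.subtype_injective]
    exact hQ₀.symm.index_eq_card.symm
  have hdec : ∀ m ∈ M, ∃ e ∈ E, ∃ q ∈ Q, e * q = m := fun m hm => by
    have : (⟨m, hm⟩ : M) ∈ E.subgroupOf M ⊔ Q₀ := hQ₀.sup_eq_top ▸ Subgroup.mem_top _
    obtain ⟨c, hc, q, hq, hcq⟩ := Subgroup.mem_sup_of_normal_left.1 this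
    exact ⟨c, hc, q, ⟨q, hq, rfl⟩, congrArg Subtype.val hcq⟩
  have hdisj : ∀ x ∈ E, x ∈ Q → x = 1 := by
    rintro _ hx ⟨q, hq, rfl⟩
    have : q ∈ E.subgroupOf M ⊓ Q₀ := ⟨hx, hq⟩
    rw [disjoint_iff.1 hQ₀.disjoint, Subgroup.mem_bot] at this
    rw [this]; rfl
  -- The normalizer of `Q`. That `EY = Γ` is the Frattini argument, from the conjugacy of `Q` and
  -- its `Γ`-conjugates under `E`.
  let Y : Subgroup Γ :=
    { carrier := {y | ∀ q, q ∈ Q ↔ y * q * y⁻¹ ∈ Q}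
      one_mem' := by simp
      mul_mem' := fun {a b} ha hb q => by
        rw [hb q, ha]; simp [mul_assoc]
      inv_mem' := fun {a} ha q => by
        rw [ha (a⁻¹ * q * a⁻¹⁻¹)]; simp [mul_assoc] }
  refine ⟨Y, fun x hx hxY => ?_, fun g => ?_⟩
  -- An element of `E ∩ Y` commutes with `Q`, since the commutators lie in `E ∩ Q`, and with `E`; so
  -- it lies in the normal subgroup `F`. By minimality `F` is trivial or `E`, and `F = E` would
  -- force `M ≤ E`.
  · let F := E ⊓ Subgroup.centralizer (M : Set Γ)
    have hxF : x ∈ F := by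
      refine ⟨hx, Subgroup.mem_centralizer_iff.2 fun m hm => ?_⟩
      obtain ⟨e, he, q, hq, rfl⟩ := hdec m hm
      have h1 : x * q * x⁻¹ * q⁻¹ = 1 := by
        apply hdisj
        · have : x * q * x⁻¹ * q⁻¹ = x * (q * x⁻¹ * q⁻¹) := by group
          rw [this]
          exact mul_mem hx (hE.conj_mem _ (inv_mem hx) q)
        · exact mul_mem ((hxY q).1 hq) (inv_mem hq)
      rw [mul_inv_eq_one, mul_inv_eq_iff_eq_mul] at h1
      rw [mul_assoc, ← h1, ← mul_assoc, habel e he x hx, mul_assoc]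
    rcases hmin F inferInstance inf_le_left with h | h
    · rw [h] at hxF; exact hxF
    · exfalso
      refine hne fun m hm => hcore.mem_of_commute hE hM hEM habel hk hidx hm fun e he => ?_
      rw [← h] at he
      exact (Subgroup.mem_centralizer_iff.1 he.2 m hm).symm
  · obtain ⟨a, ha, haQ⟩ := exists_mul_mem_normalizer hE hM habel
      (by rw [hk, hQcard]; exact hcop) hdec hQM hdisj g
    refine ⟨a, ha, (g⁻¹ * a)⁻¹, inv_mem (?_ : g⁻¹ * a ∈ Y), by group⟩
    intro q
    refine ⟨haQ q, fun hq => ?_⟩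
    have hbij : Function.Surjective fun r : Q => (⟨_, haQ r r.2⟩ : Q) :=
      Finite.surjective_of_injective fun r s hrs => by
        have := congrArg Subtype.val hrs
        simpa using this
    obtain ⟨r, hr⟩ := hbij ⟨_, hq⟩
    have h2 := congrArg Subtype.val hr
    have h3 : (r : Γ) = q := by simpa using h2
    rw [← h3]; exact r.2

end

end

noncomputable section

open scoped MonoidAlgebra

/-! ### Large orbits -/

section

theorem isSemisimpleRepresentation_of_forall_submodule {k G V : Type*} [Field k] [Group G]
    [AddCommGroup V] [Module k V] {ρ : Representation k G V}
    (h : ∀ S : Submodule k V, (∀ g, ∀ v ∈ S, ρ g v ∈ S) →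
      ∃ T : Submodule k V, (∀ g, ∀ v ∈ T, ρ g v ∈ T) ∧ IsCompl S T) :
    ρ.IsSemisimpleRepresentation := by
  refine ⟨fun S => ?_⟩
  obtain ⟨T, hT, hc⟩ := h S.toSubmodule fun g v hv => S.apply_mem_toSubmodule g hv
  refine ⟨⟨T, fun g v hv => hT g v hv⟩, ?_, ?_⟩
  · rw [disjoint_iff]
    exact Subrepresentation.toSubmodule_injective (disjoint_iff.1 hc.1)
  · rw [codisjoint_iff]
    exact Subrepresentation.toSubmodule_injective (codisjoint_iff.1 hc.2)

theorem exists_isCompl_of_isSemisimpleRepresentation {k G V : Type*} [Field k] [Group G]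
    [AddCommGroup V] [Module k V] {ρ : Representation k G V} (h : ρ.IsSemisimpleRepresentation)
    (S : Submodule k V) (hS : ∀ g, ∀ v ∈ S, ρ g v ∈ S) :
    ∃ T : Submodule k V, (∀ g, ∀ v ∈ T, ρ g v ∈ T) ∧ IsCompl S T := by
  obtain ⟨T, hT⟩ := h.exists_isCompl ⟨S, fun g v hv => hS g v hv⟩
  refine ⟨T.toSubmodule, fun g v hv => T.apply_mem_toSubmodule g hv, ?_, ?_⟩
  · rw [disjoint_iff]
    exact congrArg Subrepresentation.toSubmodule (disjoint_iff.1 hT.1)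
  · rw [codisjoint_iff]
    exact congrArg Subrepresentation.toSubmodule (codisjoint_iff.1 hT.2)

/-- The socle: a semisimple subrepresentation that meets every nonzero subrepresentation. -/
theorem exists_semisimple_subrepresentation {k G V : Type*} [Field k] [Group G]
    [AddCommGroup V] [Module k V] [Finite V] (ρ : Representation k G V) :
    ∃ S : Subrepresentation ρ, S.toRepresentation.IsSemisimpleRepresentation ∧
      ∀ W : Submodule k V, (∀ g, ∀ v ∈ W, ρ g v ∈ W) → W ≠ ⊥ → ∃ v ∈ W, v ∈ S ∧ v ≠ 0 := by
  have hfin : Finite ρ.asModule := ‹Finite V›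
  let S₀ : Submodule k[G] ρ.asModule := sSup {m : Submodule k[G] ρ.asModule | IsSimpleModule k[G] m}
  have hss : IsSemisimpleModule k[G] S₀ := by
    have := isSemisimpleModule_biSup_of_isSemisimpleModule_submodule
      (R := k[G]) (M := ρ.asModule) (s := {m : Submodule k[G] ρ.asModule | IsSimpleModule k[G] m}) (p := id)
      (fun m hm => by
        have : IsSimpleModule k[G] m := hm
        exact (inferInstance : IsSemisimpleModule k[G] m))
    have h1 : S₀ = ⨆ m ∈ {m : Submodule k[G] ρ.asModule | IsSimpleModule k[G] m}, id m :=
      sSup_eq_iSup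
    rw [h1]
    exact this
  let S : Subrepresentation ρ := Subrepresentation.ofSubmodule' S₀
  refine ⟨S, ?_, fun W hW hW0 => ?_⟩
  · rw [Representation.isSemisimpleRepresentation_iff_isSemisimpleModule_asModule]
    let e₀ : S.toRepresentation.asModule ≃+ S₀ := AddEquiv.refl _
    have key : ∀ (a : k[G]) (x : S.toRepresentation.asModule),
        S₀.subtype (e₀ (a • x)) = a • S₀.subtype (e₀ x) := fun a x => by
      induction a using MonoidAlgebra.induction_linear with
      | zero => rw [zero_smul, zero_smul, map_zero, map_zero]
      | add a b ha hb => rw [add_smul, map_add, map_add, ha, hb, add_smul]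
      | single g c =>
        rw [Representation.single_smul, Representation.single_smul]; rfl
    let e : S.toRepresentation.asModule ≃ₗ[k[G]] S₀ :=
      { e₀ with map_smul' := fun a x => Subtype.ext (key a x) }
    exact IsSemisimpleModule.congr e
  · let W' : Subrepresentation ρ := ⟨W, fun g v hv => hW g v hv⟩
    have hW' : Subrepresentation.asSubmodule W' ≠ ⊥ := fun h => hW0 (by
      rw [Submodule.eq_bot_iff]
      intro v hv
      have : v ∈ Subrepresentation.asSubmodule W' := hv
      rw [h] at this
      exact this)
    obtain ⟨m, hm, hmW⟩ := (eq_bot_or_exists_atom_le (Subrepresentation.asSubmodule W')).resolve_left hW'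
    have hms : IsSimpleModule k[G] m := isSimpleModule_iff_isAtom.2 hm
    obtain ⟨v, hv, hv0⟩ := Submodule.exists_mem_ne_zero_of_ne_bot hm.1
    exact ⟨v, hmW hv, (le_sSup hms : m ≤ S₀) hv, hv0⟩

/-- A normal `p'`-subgroup that acts faithfully acts faithfully on the socle. -/
theorem eq_one_of_trivial_on_socle {p : ℕ} {F H V : Type*} [Field F] [CharP F p] [Group H]
    [Finite H] [AddCommGroup V] [Module F V] {ρ : Representation F H V}
    {K : Subgroup H} (hKn : K.Normal) (hKp : ¬ p ∣ Nat.card K)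
    (hfaith : ∀ k ∈ K, (∀ v, ρ k v = v) → k = 1) (S : Subrepresentation ρ)
    (hsoc : ∀ W : Submodule F V, (∀ g, ∀ v ∈ W, ρ g v ∈ W) → W ≠ ⊥ → ∃ v ∈ W, v ∈ S ∧ v ≠ 0) :
    ∀ k ∈ K, (∀ v ∈ S, ρ k v = v) → k = 1 := by
  classical
  let K₀ : Subgroup H :=
    { carrier := {k | k ∈ K ∧ ∀ v ∈ S, ρ k v = v}
      one_mem' := ⟨one_mem _, by simp⟩
      mul_mem' := by
        rintro a b ⟨ha, ha'⟩ ⟨hb, hb'⟩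
        refine ⟨mul_mem ha hb, fun v hv => ?_⟩
        rw [map_mul, Module.End.mul_apply, hb' v hv, ha' v hv]
      inv_mem' := by
        rintro a ⟨ha, ha'⟩
        refine ⟨inv_mem ha, fun v hv => ?_⟩
        conv_lhs => rw [← ha' v hv]
        rw [← Module.End.mul_apply, ← map_mul, inv_mul_cancel, map_one, Module.End.one_apply] }
  have hK₀n : ∀ g, ∀ x ∈ K₀, g * x * g⁻¹ ∈ K₀ := by
    rintro g x ⟨hx, hx'⟩
    refine ⟨hKn.conj_mem x hx g, fun v hv => ?_⟩
    rw [map_mul, map_mul, Module.End.mul_apply, Module.End.mul_apply,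
      hx' _ (S.apply_mem_toSubmodule g⁻¹ hv), ← Module.End.mul_apply, ← map_mul, mul_inv_cancel,
      map_one, Module.End.one_apply]
  have := Fintype.ofFinite K₀
  -- On the socle `e` is multiplication by `|K₀|`, which is nonzero in `F`. So the invariant
  -- subspace `ker e` misses the socle and is zero; as `e` absorbs `K₀`, injectivity makes `K₀` act
  -- trivially on all of `V`.
  let e : V →ₗ[F] V := ∑ x : K₀, ρ x
  have he : ∀ v, e v = ∑ x : K₀, ρ x v := fun v => by simp [e]
  have hcomm : ∀ g v, e (ρ g v) = ρ g (e v) := fun g v => by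
    rw [he, he, map_sum, ← Equiv.sum_comp (conjOn K₀ g fun x => ⟨hK₀n g x, fun hx => by
      simpa [mul_assoc] using hK₀n g⁻¹ _ hx⟩).toEquiv]
    refine Finset.sum_congr rfl fun x _ => ?_
    change ρ (g * x * g⁻¹) (ρ g v) = _
    rw [← Module.End.mul_apply, ← Module.End.mul_apply, ← map_mul, ← map_mul,
      inv_mul_cancel_right]
  have hker : LinearMap.ker e = ⊥ := by
    by_contra hne
    obtain ⟨v, hv, hvS, hv0⟩ := hsoc (LinearMap.ker e) (fun g v hv => by
      rw [LinearMap.mem_ker] at hv ⊢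
      rw [hcomm, hv, map_zero]) hne
    rw [LinearMap.mem_ker, he, Finset.sum_congr rfl fun x _ => x.2.2 v hvS, Finset.sum_const,
      Finset.card_univ, ← Nat.card_eq_fintype_card, ← Nat.cast_smul_eq_nsmul F] at hv
    rcases smul_eq_zero.1 hv with h | h
    · rw [CharP.cast_eq_zero_iff F p] at h
      exact hKp (h.trans (Subgroup.card_dvd_of_le fun x hx => hx.1))
    · exact hv0 h
  intro k hk hkS
  refine hfaith k hk fun v => ?_
  apply LinearMap.ker_eq_bot.1 hker
  have hk₀ : k ∈ K₀ := ⟨hk, hkS⟩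
  rw [he, he, ← Equiv.sum_comp (Equiv.mulRight (⟨k, hk₀⟩ : K₀)) fun x : K₀ => ρ x v]
  refine Finset.sum_congr rfl fun x _ => ?_
  rw [← Module.End.mul_apply, ← map_mul]
  rfl

/-- The hypothesis is applied to the group `H'` of operators, which acts faithfully. `K` maps
isomorphically to its image, so the bound on the stabilizer in the image bounds the one in `K`. -/
theorem LargeOrbitAffirmative.exists_of_quotient {p : ℕ} [Fact p.Prime]
    (hQ : LargeOrbitAffirmative.{u} p) {F H H' W : Type u} [Field F] [CharP F p] [Group H]
    [Group H'] [Finite H] [Finite H'] [AddCommGroup W] [Module F W] [Finite W]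
    (σ : Representation F H W) (hss : σ.IsSemisimpleRepresentation) (q : H →* H')
    (hq : Function.Surjective q) (σ' : Representation F H' W) (hσ' : ∀ h, σ' (q h) = σ h)
    (hinj : Function.Injective σ') (K : Subgroup H)
    (P : Sylow p H) (hK : IsNormalPComplement p K) (hK0 : K ≠ ⊥)
    (hfaith : ∀ k ∈ K, (∀ v, σ k v = v) → k = 1) :
    ∃ v : W, (∀ g ∈ P, σ g v = v) ∧ Nat.card {k : K // σ k v = v} ^ 2 < Nat.card K := by
  obtain ⟨hKn, hKp, j, hj⟩ := hK
  have hss' : σ'.IsSemisimpleRepresentation := isSemisimpleRepresentation_of_forall_submodule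
    fun W hW => by
      obtain ⟨T, hT, hc⟩ := exists_isCompl_of_isSemisimpleRepresentation hss W
        fun g v hv => by rw [← hσ']; exact hW (q g) v hv
      refine ⟨T, fun g v hv => ?_, hc⟩
      obtain ⟨g, rfl⟩ := hq g
      rw [hσ']
      exact hT g v hv
  have hqK : ∀ k ∈ K, q k = 1 → k = 1 := fun k hk h => by
    refine hfaith k hk fun v => ?_
    rw [← hσ', h, map_one, Module.End.one_apply]
  have hinjK : Function.Injective (q.comp K.subtype) := by
    rw [injective_iff_map_eq_one]
    exact fun k hk => Subtype.ext (hqK k k.2 hk)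
  have hcard : Nat.card (K.map q) = Nat.card K := by
    have : K.map q = (q.comp K.subtype).range := by
      rw [MonoidHom.range_comp, Subgroup.range_subtype]
    rw [this]
    exact (Nat.card_congr (MonoidHom.ofInjective hinjK).toEquiv).symm
  obtain ⟨v, hvP, hv⟩ := hQ F H' W σ' hinj hss' (K.map q) (P.mapSurjective hq)
    ⟨hKn.map q hq, by rwa [hcard], by
      obtain ⟨i, -, hi⟩ := (Nat.dvd_prime_pow Fact.out).1
        (hj ▸ Subgroup.index_map_dvd K hq)
      exact ⟨i, hi⟩⟩
    (fun h => hK0 (by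
      rw [Subgroup.eq_bot_iff_forall]
      exact fun k hk => hqK k hk ((Subgroup.map_eq_bot_iff K).1 h hk)))
  refine ⟨v, fun g hg => ?_, ?_⟩
  · rw [← hσ']
    exact hvP _ ⟨g, hg, rfl⟩
  · rw [hcard] at hv
    refine lt_of_le_of_lt (Nat.pow_le_pow_left ?_ 2) hv
    refine Nat.card_le_card_of_injective
      (fun k => ⟨⟨q k.1, ⟨k.1, k.1.2, rfl⟩⟩, by
        change σ' (q k.1) v = v
        rw [hσ']; exact k.2⟩) fun k k' h => ?_
    have h2 : q k.1 = q k'.1 := congrArg (fun x => (x.1 : H')) h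
    exact Subtype.ext (hinjK h2)

theorem Representation.exists_faithful_quotient {F H W : Type u} [Field F] [Group H] [Finite H]
    [AddCommGroup W] [Module F W] (σ : Representation F H W) :
    ∃ (H' : Type u) (_ : Group H') (_ : Finite H') (q : H →* H') (σ' : Representation F H' W),
      Function.Surjective q ∧ (∀ h, σ' (q h) = σ h) ∧ Function.Injective σ' :=
  ⟨σ.asGroupHom.range, inferInstance,
    Finite.of_surjective _ σ.asGroupHom.rangeRestrict_surjective, σ.asGroupHom.rangeRestrict,
    (Units.coeHom _).comp σ.asGroupHom.range.subtype, σ.asGroupHom.rangeRestrict_surjective,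
    fun _ => rfl, fun _ _ h => Subtype.ext (Units.ext h)⟩

/-- The large orbit property for modules that are only faithful for the normal `p`-complement and
not necessarily completely reducible. -/
theorem LargeOrbitAffirmative.exists_of_faithful {p : ℕ} [Fact p.Prime]
    (hQ : LargeOrbitAffirmative.{u} p) {F H V : Type u} [Field F] [CharP F p] [Group H] [Finite H]
    [AddCommGroup V] [Module F V] [Finite V] (ρ : Representation F H V) (K : Subgroup H)
    (P : Sylow p H) (hK : IsNormalPComplement p K) (hK0 : K ≠ ⊥)
    (hfaith : ∀ k ∈ K, (∀ v, ρ k v = v) → k = 1) :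
    ∃ v : V, (∀ g ∈ P, ρ g v = v) ∧ Nat.card {k : K // ρ k v = v} ^ 2 < Nat.card K := by
  obtain ⟨S, hss, hsoc⟩ := exists_semisimple_subrepresentation ρ
  have hfaithS := eq_one_of_trivial_on_socle hK.1 hK.2.1 hfaith S hsoc
  have hval : ∀ g (v : S.toSubmodule), (S.toRepresentation g v : V) = ρ g v := fun _ _ => rfl
  obtain ⟨H', _, _, q, σ', hq, hσ', hinj⟩ := S.toRepresentation.exists_faithful_quotient
  obtain ⟨v, hvP, hv⟩ := hQ.exists_of_quotient S.toRepresentation hss q hq σ' hσ' hinj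
    K P hK hK0 fun k hk h => hfaithS k hk fun v hv =>
      congrArg Subtype.val (h ⟨v, hv⟩)
  refine ⟨v, fun g hg => congrArg Subtype.val (hvP g hg), ?_⟩
  have h1 : Nat.card {k : K // ρ k v = v} = Nat.card {k : K // S.toRepresentation k v = v} :=
    Nat.card_congr (Equiv.subtypeEquivRight fun k => by rw [Subtype.ext_iff, hval])
  rwa [h1]

end

end

noncomputable section

/-! ### Large orbits on linear characters -/

section

variable {Γ : Type u} [Group Γ] {p : ℕ}

/-- The linear characters of a group, as an additive group. -/
def LinChar (E : Type*) [Group E] : Type _ := Additive (E →* ℂˣ)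

instance (E : Type*) [Group E] : AddCommGroup (LinChar E) :=
  inferInstanceAs (AddCommGroup (Additive (E →* ℂˣ)))

/-- The conjugation action of `Γ` on the linear characters of a normal subgroup. -/
def conjLinChar (E : Subgroup Γ) [E.Normal] : Γ →* AddMonoid.End (LinChar E) where
  toFun g := (MonoidHom.toAdditive
    { toFun := fun β => β.comp (MulAut.conjNormal g⁻¹ : MulAut E).toMonoidHom
      map_one' := rfl
      map_mul' := fun _ _ => rfl } : Additive (E →* ℂˣ) →+ Additive (E →* ℂˣ))
  map_one' := by
    refine AddMonoidHom.ext fun β => MonoidHom.ext fun e => ?_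
    change β.toMul (MulAut.conjNormal 1⁻¹ e) = β.toMul e
    simp
  map_mul' g h := by
    refine AddMonoidHom.ext fun β => MonoidHom.ext fun e => ?_
    change β.toMul (MulAut.conjNormal (g * h)⁻¹ e) =
      β.toMul (MulAut.conjNormal h⁻¹ (MulAut.conjNormal g⁻¹ e))
    simp [mul_inv_rev, map_mul]

theorem finite_linChar_of_exponent (hp : 0 < p) {E : Type*} [Group E] [Finite E]
    (hE : ∀ x : E, x ^ p = 1) : Finite (E →* ℂˣ) := by
  have : NeZero p := ⟨hp.ne'⟩
  refine Finite.of_injective (β := E → rootsOfUnity p ℂ)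
    (fun β e => ⟨β e, by rw [mem_rootsOfUnity, ← map_pow, hE, map_one]⟩) fun β γ h => ?_
  refine MonoidHom.ext fun e => ?_
  exact congrArg (fun f => (f e).1) h

theorem exists_linChar_ne_one {E : Type*} [Group E] [Finite E]
    (habel : ∀ x y : E, x * y = y * x) {x : E} (hx : x ≠ 1) : ∃ β : E →* ℂˣ, β x ≠ 1 := by
  let _ : CommGroup E := { mul_comm := habel }
  exact CommGroup.exists_apply_ne_one_of_hasEnoughRootsOfUnity E ℂ hx

/-- The stabilizer of a linear character of a normal subgroup. -/
def linCharStabilizer (E : Subgroup Γ) [E.Normal] (β : E →* ℂˣ) : Subgroup Γ where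
  carrier := {g | ∀ e, β (MulAut.conjNormal g e) = β e}
  one_mem' := by simp
  mul_mem' := by
    intro a b ha hb e
    rw [map_mul, MulAut.mul_apply, ha, hb]
  inv_mem' := by
    intro a ha e
    rw [← ha (MulAut.conjNormal a⁻¹ e), ← MulAut.mul_apply, ← map_mul]
    simp

theorem mem_linCharStabilizer {E : Subgroup Γ} [E.Normal] {β : E →* ℂˣ} {g : Γ} :
    g ∈ linCharStabilizer E β ↔ ∀ e, β (MulAut.conjNormal g e) = β e := Iff.rfl

theorem le_linCharStabilizer (E : Subgroup Γ) [E.Normal] (β : E →* ℂˣ) :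
    E ≤ linCharStabilizer E β := by
  intro x hx e
  have : MulAut.conjNormal x e = (⟨x, hx⟩ : E) * e * (⟨x, hx⟩ : E)⁻¹ := Subtype.ext rfl
  rw [this, map_mul, map_mul, mul_right_comm, ← map_mul, mul_inv_cancel, map_one, one_mul]

theorem conjLinChar_eq_iff {E : Subgroup Γ} [E.Normal] (β : E →* ℂˣ) (g : Γ) :
    conjLinChar E g (Additive.ofMul β : LinChar E) = (Additive.ofMul β : LinChar E) ↔ g ∈ linCharStabilizer E β := by
  rw [← inv_mem_iff, mem_linCharStabilizer]
  exact ⟨fun h e => DFunLike.congr_fun (F := E →* ℂˣ) (Additive.ofMul.injective h) e,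
    fun h => congrArg Additive.ofMul (MonoidHom.ext h)⟩

theorem Subgroup.card_map_eq_relIndex {R H : Type*} [Group R] [Group H] (q : R →* H)
    {E S : Subgroup R} (hES : E ≤ S) (hker : ∀ x ∈ S, q x = 1 ↔ x ∈ E) :
    Nat.card (S.map q) = E.relIndex S := by
  rw [← Subgroup.relIndex_ker, ← Subgroup.inf_relIndex_right]
  congr 1
  ext x
  exact ⟨fun h => (hker x h.2).1 h.1, fun h => ⟨(hker x (hES h)).2 h, hES h⟩⟩

/-- The large orbit property, applied to the linear characters of an elementary abelian normal
`p`-subgroup `E` on which `M / E` acts faithfully. -/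
theorem LargeOrbitAffirmative.exists_linChar [Finite Γ] [Fact p.Prime]
    (hQ : LargeOrbitAffirmative.{u} p) {E M : Subgroup Γ} [E.Normal] [M.Normal] (hEM : E ≤ M)
    (habel : ∀ x ∈ E, ∀ y ∈ E, x * y = y * x) (hexp : ∀ x ∈ E, x ^ p = 1)
    (hidx : ¬ p ∣ E.relIndex M) (hne : ¬ M ≤ E)
    (hcent : ∀ m ∈ M, (∀ e ∈ E, e * m = m * e) → m ∈ E) (P : Sylow p Γ) :
    ∃ β : E →* ℂˣ, (P : Subgroup Γ) ≤ linCharStabilizer E β ∧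
      Nat.card (linCharStabilizer E β ⊓ M : Subgroup Γ) ^ 2 < Nat.card M * Nat.card E := by
  have hexp' : ∀ x : E, x ^ p = 1 := fun x => Subtype.ext (hexp x x.2)
  have hfin : Finite (E →* ℂˣ) := finite_linChar_of_exponent (Fact.out : p.Prime).pos hexp'
  have : Finite (LinChar E) := hfin
  let _ : Module (ZMod p) (LinChar E) := AddCommGroup.zmodModule fun β =>
    congrArg Additive.ofMul (MonoidHom.ext (f := β.toMul ^ p) (g := 1) fun e => by
      rw [MonoidHom.pow_apply, ← map_pow, hexp', map_one, MonoidHom.one_apply])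
  -- The prime field is lifted because the large orbit hypothesis takes field, group and module from
  -- one universe.
  have hchar : CharP (ULift.{u} (ZMod p)) p := inferInstance
  -- Restricting to `MP` makes the image of `M` a normal `p`-complement in the group of operators on
  -- the linear characters of `E`.
  let R : Subgroup Γ := M ⊔ P
  let ρ : Representation (ULift.{u} (ZMod p)) R (LinChar E) :=
    { toFun := fun g =>
        { toFun := conjLinChar E g
          map_add' := map_add _
          map_smul' := fun c v => by
            rw [ULift.smul_def, RingHom.id_apply, ULift.smul_def]
            exact ZMod.map_smul (conjLinChar E (g : Γ)) c.down v }
      map_one' := by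
        refine LinearMap.ext fun v => ?_
        change conjLinChar E ((1 : R) : Γ) v = v
        rw [Subgroup.coe_one, map_one]; rfl
      map_mul' := fun g h => by
        refine LinearMap.ext fun v => ?_
        change conjLinChar E ((g * h : R) : Γ) v = conjLinChar E g (conjLinChar E h v)
        rw [Subgroup.coe_mul, map_mul]; rfl }
  obtain ⟨H, _, _, q, σ, hq, hσ, hinj⟩ := ρ.exists_faithful_quotient
  have hρ : ∀ (g : R) β, σ (q g) (Additive.ofMul β : LinChar E) = (Additive.ofMul β : LinChar E) ↔
      (g : Γ) ∈ linCharStabilizer E β := fun g β => by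
    rw [hσ]; exact conjLinChar_eq_iff β g
  -- An element of `M` fixing every linear character of `E` centralizes `E`, since these characters
  -- separate points, and so lies in `E`. The image of `M` is therefore a copy of `M/E`.
  have hker : ∀ g : R, (g : Γ) ∈ M → (q g = 1 ↔ (g : Γ) ∈ E) := by
    refine fun g hg => ⟨fun h => hcent g hg fun e he => ?_, fun h => hinj ?_⟩
    · by_contra hne
      have hne' : (⟨e, he⟩ : E)⁻¹ * MulAut.conjNormal (g : Γ) ⟨e, he⟩ ≠ 1 := by
        rw [Ne, inv_mul_eq_one]
        intro h1
        have := congrArg (fun x : E => (x : Γ)) h1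
        simp only [MulAut.conjNormal_apply] at this
        exact hne (eq_mul_inv_iff_mul_eq.1 this)
      obtain ⟨β, hβ⟩ := exists_linChar_ne_one
        (fun x y : E => Subtype.ext (habel x x.2 y y.2)) hne'
      refine hβ ?_
      rw [map_mul, map_inv, (hρ g β).1 (by rw [h, map_one]; rfl), inv_mul_cancel]
    · rw [map_one]
      refine LinearMap.ext fun β => ?_
      exact (hρ g β.toMul).2 (le_linCharStabilizer E _ h)
  have hMR : M ≤ R := le_sup_left
  have hPR : (P : Subgroup Γ) ≤ R := le_sup_right
  have hcard : ∀ S : Subgroup Γ, E ≤ S → S ≤ M →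
      Nat.card ((S.subgroupOf R).map q) = E.relIndex S := by
    intro S hES hSM
    rw [Subgroup.card_map_eq_relIndex q (E := E.subgroupOf R), Subgroup.relIndex_subgroupOf]
    · exact hSM.trans hMR
    · exact fun x hx => hES hx
    · exact fun x hx => hker x (hSM hx)
  have hidx' : ∃ k, ((M.subgroupOf R).map q).index = p ^ k := by
    obtain ⟨n, hn⟩ := (IsPGroup.iff_card.1 P.2)
    have h1 : (M.subgroupOf R).index ∣ p ^ n := by
      rw [← hn]
      change M.relIndex (M ⊔ (P : Subgroup Γ)) ∣ _
      rw [Subgroup.relIndex_sup_left]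
      exact Subgroup.relIndex_dvd_card _ _
    obtain ⟨i, -, hi⟩ := (Nat.dvd_prime_pow Fact.out).1 ((Subgroup.index_map_dvd _ hq).trans h1)
    exact ⟨i, hi⟩
  obtain ⟨v, hvP, hv⟩ := hQ.exists_of_faithful σ ((M.subgroupOf R).map q)
    ((P.subtype hPR).mapSurjective hq)
    ⟨Subgroup.Normal.map inferInstance q hq, by rwa [hcard M hEM le_rfl], hidx'⟩
    (fun h => hne fun m hm => (hker ⟨m, hMR hm⟩ hm).1 ((Subgroup.map_eq_bot_iff _).1 h hm))
    (fun k _ hk => hinj (by rw [map_one]; exact LinearMap.ext hk))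
  refine ⟨v.toMul, fun g hg => ?_, ?_⟩
  · exact (hρ ⟨g, hPR hg⟩ v.toMul).1 (hvP _ ⟨⟨g, hPR hg⟩, hg, rfl⟩)
  · set T := linCharStabilizer E v.toMul
    have hEI : E ≤ T ⊓ M := le_inf (le_linCharStabilizer E _) hEM
    rw [hcard M hEM le_rfl] at hv
    have h1 : E.relIndex (T ⊓ M) ≤ Nat.card {k : (M.subgroupOf R).map q // σ k v = v} := by
      rw [← hcard _ hEI inf_le_right]
      refine Nat.card_le_card_of_injective
        (fun k => ⟨⟨k, Subgroup.map_mono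
          (Subgroup.comap_mono (inf_le_right : T ⊓ M ≤ M)) k.2⟩, ?_⟩) fun k k' h => ?_
      · obtain ⟨_, g, hg, rfl⟩ := k
        exact (hρ g v.toMul).2 hg.1
      · exact Subtype.ext (congrArg (fun x => (x.1 : H)) h)
    have h2 := lt_of_le_of_lt (Nat.pow_le_pow_left h1 2) hv
    rw [← Subgroup.card_mul_relIndex_of_le hEI, ← Subgroup.card_mul_relIndex_of_le hEM]
    have h3 : 0 < Nat.card E := Nat.card_pos
    nlinarith [Nat.mul_lt_mul_of_pos_left h2 (Nat.mul_pos h3 h3)]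

end

end

noncomputable section

open scoped ComplexConjugate

section

variable {G : Type u} [Group G] {p : ℕ}

/-! ### Preimages of subgroups of a quotient of a subgroup -/

section

variable {A : Subgroup G} {Γ : Type*} [Group Γ] (π : A →* Γ)

/-- The preimage of `S ≤ Γ` under `π : A →* Γ`, as a subgroup of the group that contains `A`. -/
def preimageIn (S : Subgroup Γ) : Subgroup G := (S.comap π).map A.subtype

variable {π}

theorem mem_preimageIn {S : Subgroup Γ} {g : G} :
    g ∈ preimageIn π S ↔ ∃ h : g ∈ A, π ⟨g, h⟩ ∈ S := by
  constructor
  · rintro ⟨a, ha, rfl⟩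
    exact ⟨a.2, ha⟩
  · rintro ⟨h, hS⟩
    exact ⟨⟨g, h⟩, hS, rfl⟩

theorem preimageIn_le {S : Subgroup Γ} : preimageIn π S ≤ A := fun _ h => (mem_preimageIn.1 h).1

theorem preimageIn_mono {S T : Subgroup Γ} (h : S ≤ T) : preimageIn π S ≤ preimageIn π T :=
  fun _ hg => mem_preimageIn.2 ⟨_, h (mem_preimageIn.1 hg).2⟩

theorem normalizes_preimageIn {B S : Subgroup Γ} (h : ∀ b ∈ B, ∀ x ∈ S, b * x * b⁻¹ ∈ S) :
    Normalizes (preimageIn π B) (preimageIn π S) := by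
  intro b hb x hx
  obtain ⟨hbA, hb⟩ := mem_preimageIn.1 hb
  obtain ⟨hxA, hx⟩ := mem_preimageIn.1 hx
  refine mem_preimageIn.2 ⟨A.mul_mem (A.mul_mem hbA hxA) (A.inv_mem hbA), ?_⟩
  have : (⟨b * x * b⁻¹, A.mul_mem (A.mul_mem hbA hxA) (A.inv_mem hbA)⟩ : A) =
    ⟨b, hbA⟩ * ⟨x, hxA⟩ * ⟨b, hbA⟩⁻¹ := rfl
  rw [this, map_mul, map_mul, map_inv]
  exact h _ hb _ hx

theorem preimageIn_top : preimageIn π ⊤ = A :=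
  le_antisymm preimageIn_le fun _ h => mem_preimageIn.2 ⟨h, Subgroup.mem_top _⟩

theorem normalizes_preimageIn_of_normal {S : Subgroup Γ} (h : S.Normal) :
    Normalizes A (preimageIn π S) := by
  have := normalizes_preimageIn (π := π) (B := ⊤) (S := S) fun b _ x hx => h.conj_mem x hx b
  rwa [preimageIn_top] at this

theorem relIndex_preimageIn (hπ : Function.Surjective π) (S T : Subgroup Γ) :
    (preimageIn π S).relIndex (preimageIn π T) = S.relIndex T := by
  rw [preimageIn, preimageIn, Subgroup.relIndex_map_map_of_injective _ _ A.subtype_injective,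
    Subgroup.relIndex_comap, Subgroup.map_comap_eq_self_of_surjective hπ]

end

/-! ### Degrees of characters over a given one -/

/-- The degrees, prime to `p`, of the irreducible characters of `A` over `lam`. -/
def coprimeDegrees (p : ℕ) (A Z : Subgroup G) (lam : G → ℂ) : Set ℕ :=
  {n | ¬ p ∣ n ∧ ∃ χ, IrrOn A χ ∧ multOn Z χ lam ≠ 0 ∧ χ 1 = n}

theorem irrOn_twist {T : Subgroup G} {lam θ : G → ℂ} (hlam : IrrOn T lam) (μ : T →* ℂˣ)
    (hθ : ∀ x : T, θ x = μ x * lam x) : IrrOn T θ := by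
  obtain ⟨n, ρ, hρ⟩ := hlam
  refine ⟨n, twistRep μ ρ, ?_⟩
  rw [show (fun x : T => θ x) = fun x : T => μ x * lam x from funext hθ]
  exact hρ.twist μ

variable [Finite G]

theorem units_mul_conj_eq_one {E : Type*} [Group E] [Finite E] (β : E →* ℂˣ) (x : E) :
    (β x : ℂ) * conj (β x : ℂ) = 1 := by
  have h : (β x : ℂ) ^ Nat.card E = 1 := by
    rw [← Units.val_pow_eq_pow_val, ← map_pow, pow_card_eq_one', map_one, Units.val_one]
  rw [Complex.mul_conj, Complex.normSq_eq_norm_sq,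
    Complex.norm_eq_one_of_pow_eq_one h Nat.card_pos.ne']
  simp

theorem multOn_twist {E : Subgroup G} (β : E →* ℂˣ) {f f' k k' : G → ℂ}
    (hf : ∀ x : E, f' x = β x * f x) (hk : ∀ x : E, k' x = β x * k x) :
    multOn E f' k' = multOn E f k := by
  have := Fintype.ofFinite E
  rw [multOn, multOn, charInner_eq_sum, charInner_eq_sum]
  congr 1
  refine Finset.sum_congr rfl fun x _ => ?_
  rw [hf, hk, map_mul, mul_mul_mul_comm, units_mul_conj_eq_one, one_mul]

/-- Multiplication by a linear character of `T` preserves irreducibility, degrees and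
multiplicities. This is why `β` has to extend to its stabilizer. -/
theorem coprimeDegrees_subset_of_twist {T E : Subgroup G} (hET : E ≤ T) (μ : T →* ℂˣ)
    {lam θ : G → ℂ} (hθ : ∀ x : E, θ x = μ ⟨x, hET x.2⟩ * lam x) :
    coprimeDegrees p T E lam ⊆ coprimeDegrees p T E θ := by
  rintro n ⟨hpn, χ, hχ, hover, hn⟩
  have h1 : ∀ x : T, extendZero T (fun x => μ x * χ x) x = μ x * χ x := extendZero_coe T _
  refine ⟨hpn, extendZero T fun x => μ x * χ x, irrOn_twist hχ μ h1, ?_, ?_⟩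
  · rwa [multOn_twist (μ.comp (Subgroup.inclusion hET)) (fun x => h1 ⟨x, hET x.2⟩) hθ]
  · have := h1 1
    rwa [map_one, Units.val_one, one_mul, Subgroup.coe_one, hn] at this

theorem coprimeDegrees_subset_of_over {A E Z : Subgroup G} (hZE : Z ≤ E) (hEA : E ≤ A)
    {lam θ : G → ℂ} (hlam : IrrOn Z lam) (hθ : IrrOn E θ) (hover : multOn Z θ lam ≠ 0) :
    coprimeDegrees p A E θ ⊆ coprimeDegrees p A Z lam := by
  rintro n ⟨hpn, χ, hχ, hχθ, hn⟩
  exact ⟨hpn, χ, hχ, multOn_ne_zero_trans hZE hEA hχ hθ hlam hχθ hover, hn⟩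

theorem mul_mem_coprimeDegrees [Fact p.Prime] {A N : Subgroup G} (hNA : N ≤ A)
    (hN : Normalizes A N) {θ : G → ℂ} (hθ : IrrOn N θ)
    (hidx : ¬ p ∣ (stabilizerIn A N hN θ).relIndex A) {n : ℕ}
    (hn : n ∈ coprimeDegrees p (stabilizerIn A N hN θ) N θ) :
    (stabilizerIn A N hN θ).relIndex A * n ∈ coprimeDegrees p A N θ := by
  obtain ⟨hpn, ψ, hψ, hover, hn⟩ := hn
  obtain ⟨χ, hχ, hχψ, h1⟩ := exists_irrOn_over_of_stabilizer hNA hN hθ hψ hover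
  refine ⟨fun h => ((Fact.out : p.Prime).dvd_mul.1 h).elim hidx hpn, χ, hχ,
    multOn_ne_zero_trans (le_stabilizerIn hNA hθ) stabilizerIn_le hχ hψ hθ hχψ hover, ?_⟩
  rw [h1, hn, Nat.cast_mul]

theorem degree_mem_coprimeDegrees {U N : Subgroup G} {f θ : G → ℂ} (hf : CoprimeIrrOn p U f)
    (hθ : IrrOn N θ) (heq : ∀ x ∈ N, f x = θ x) {n : ℕ} (hn : θ 1 = n) :
    n ∈ coprimeDegrees p U N θ := by
  obtain ⟨m, -, hm, hpm⟩ := hf.exists_degree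
  have hmn : m = n := by
    have := heq 1 N.one_mem
    rw [hm, hn] at this
    exact_mod_cast this
  refine ⟨hmn ▸ hpm, f, hf.irrOn, ?_, hmn ▸ hm⟩
  rw [multOn_congr heq fun _ _ => rfl, multOn_self hθ]
  exact one_ne_zero

/-- The stabilizer of a coprime character twisted by a linear character of order `p`. -/
theorem mem_stabilizerIn_twist [Fact p.Prime] {A E : Subgroup G} (hE : Normalizes A E)
    {lam θ : G → ℂ} (hlam : CoprimeIrrOn p E lam) (hinv : InvariantUnder A E lam) (β : E →* ℂˣ)
    (hβ : ∀ x, β x ^ p = 1) (hθ : ∀ x : E, θ x = β x * lam x) {g : G} (hg : g ∈ A) :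
    g ∈ stabilizerIn A E hE θ ↔ ∀ x : E, β ⟨g * x * g⁻¹, hE g hg x x.2⟩ = β x := by
  have key : ∀ x : E, θ (g * x * g⁻¹) = β ⟨g * x * g⁻¹, hE g hg x x.2⟩ * lam x := fun x => by
    rw [← hinv g hg x x.2]
    exact hθ ⟨g * x * g⁻¹, hE g hg x x.2⟩
  rw [mem_stabilizerIn]
  constructor
  · rintro ⟨-, h⟩
    -- If `g` fixes `β · lam`, then invariance of `lam` shows that twisting `lam` by `γ = β^g β⁻¹`
    -- changes nothing, hence `γ = 1`.
    let γ : E →* ℂˣ := (β.comp (conjOn E g (hE.mem_iff hg)).toMonoidHom) * β⁻¹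
    have hγ : ∀ x, γ x = β ⟨g * x * g⁻¹, hE g hg x x.2⟩ * (β x)⁻¹ := fun _ => rfl
    have h1 : γ = 1 := by
      refine eq_one_of_twist_eq hlam γ (k := 1) (fun x => ?_) fun x => ?_
      · rw [pow_one, hγ, mul_pow, inv_pow, hβ, hβ, inv_one, one_mul]
      · have h2 := h x x.2
        rw [key, hθ] at h2
        rw [hγ, Units.val_mul, mul_right_comm, h2, mul_right_comm, ← Units.val_mul,
          mul_inv_cancel, Units.val_one, one_mul]
    intro x
    rw [← mul_inv_eq_one, ← hγ, h1, MonoidHom.one_apply]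
  · refine fun h => ⟨hg, fun x hx => ?_⟩
    rw [key ⟨x, hx⟩, h ⟨x, hx⟩, hθ ⟨x, hx⟩]

/-! ### The induction -/

/-- The theorem for quotients of order less than `n` of subgroups of `G`. -/
def DegreeTheoremBelow (p : ℕ) (G : Type u) [Group G] (n : ℕ) : Prop :=
  ∀ (A Z : Subgroup G) (Γ : Type u) [Group Γ] [Finite Γ] (π : A →* Γ) (lam : G → ℂ),
    Nat.card Γ < n → Function.Surjective π → (∀ a, π a = 1 ↔ (a : G) ∈ Z) → Z ≤ A →
    CoprimeIrrOn p Z lam → InvariantUnder A Z lam → IsPSolvable p Γ → TrivialPPrimeCore p Γ →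
    (coprimeDegrees p A Z lam).Subsingleton → IsPGroup p Γ

/-- The induction hypothesis is applied to `U/N`, which embeds in `Γ/M` and is thus smaller than
`Γ`. It contains a Sylow `p`-subgroup of `Γ/M`, so its `O_{p'}` is trivial as well. -/
theorem DegreeTheoremBelow.exists_relIndex_eq_pow [Fact p.Prime] {A : Subgroup G} {Γ : Type u}
    [Group Γ] [Finite Γ] (IH : DegreeTheoremBelow p G (Nat.card Γ)) {π : A →* Γ}
    (hπ : Function.Surjective π) (hsolv : IsPSolvable p Γ) {M : Subgroup Γ} [M.Normal]
    (hM : M ≠ ⊥) (hcore : TrivialPPrimeCore p (Γ ⧸ M)) (P : Sylow p A) {U N : Subgroup G}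
    (hUA : U ≤ A) (hPU : (P : Subgroup A).map A.subtype ≤ U) (hNU : N ≤ U)
    (hN : ∀ u (hu : u ∈ U), u ∈ N ↔ π ⟨u, hUA hu⟩ ∈ M) {φ : G → ℂ} (hφ : CoprimeIrrOn p N φ)
    (hinv : InvariantUnder U N φ) (hdeg : (coprimeDegrees p U N φ).Subsingleton) :
    ∃ a, N.relIndex U = p ^ a := by
  let q := QuotientGroup.mk' M
  have hq : Function.Surjective q := QuotientGroup.mk'_surjective M
  let f : U →* Γ ⧸ M := q.comp (π.comp (Subgroup.inclusion hUA))
  have hf : ∀ u : U, f u = 1 ↔ (u : G) ∈ N := fun u => by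
    rw [hN u u.2]
    exact QuotientGroup.eq_one_iff _
  have hsolvM : IsPSolvable p (Γ ⧸ M) := hsolv.of_surjective q hq
  have hPf : (((P.mapSurjective hπ).mapSurjective hq : Sylow p (Γ ⧸ M)) : Subgroup (Γ ⧸ M)) ≤
      f.range.subtype.range := by
    rw [Subgroup.range_subtype]
    rintro _ ⟨_, ⟨a, ha, rfl⟩, rfl⟩
    exact ⟨⟨a, hPU ⟨a, ha, rfl⟩⟩, rfl⟩
  have hinj : Function.Injective f.range.subtype := Subgroup.subtype_injective _
  have hcardM : 1 < Nat.card M := M.one_lt_card_iff_ne_bot.2 hM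
  have hlt : Nat.card f.range < Nat.card Γ := by
    refine lt_of_le_of_lt (Nat.card_le_card_of_injective _ hinj) ?_
    rw [← M.card_mul_index, Subgroup.index]
    exact lt_mul_of_one_lt_left Nat.card_pos hcardM
  have hpg := IH U N f.range f.rangeRestrict φ hlt f.rangeRestrict_surjective
    (fun u => by rw [← hf, Subtype.ext_iff]; rfl) hNU hφ hinv
    (hsolvM.of_injective _ hinj)
    (hsolvM.trivialPPrimeCore_of_sylow_le_range hcore _ _ hinj hPf) hdeg
  obtain ⟨a, ha⟩ := IsPGroup.iff_card.1 hpg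
  refine ⟨a, ?_⟩
  have hker : N.subgroupOf U = f.ker := by
    ext u
    exact (hf u).symm
  rw [Subgroup.relIndex, hker, Subgroup.index_ker, ha]

/-- `M/E` is `O_{p'}(Γ/E)`: the preimage of a normal `p'`-subgroup of `Γ/M` would again have index
over `E` prime to `p`, so maximality absorbs it into `M`. -/
theorem exists_maximal_normal_coprime_relIndex [Fact p.Prime] {Γ : Type*} [Group Γ] [Finite Γ]
    (E : Subgroup Γ) (hE : E.Normal) :
    ∃ M : Subgroup Γ, ∃ _ : M.Normal, E ≤ M ∧ ¬ p ∣ E.relIndex M ∧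
      TrivialPPrimeCore p (Γ ⧸ M) := by
  obtain ⟨M, ⟨hM, hEM, hidx⟩, hmax⟩ :=
    (Set.toFinite {N : Subgroup Γ | N.Normal ∧ E ≤ N ∧ ¬ p ∣ E.relIndex N}).exists_maximal
      ⟨E, hE, le_rfl, by
        rw [Subgroup.relIndex_self]; exact (Fact.out : p.Prime).not_dvd_one⟩
  refine ⟨M, hM, hEM, hidx, fun N hN hpN => ?_⟩
  have hMN : M ≤ N.comap (QuotientGroup.mk' M) := fun x hx => by
    have h : QuotientGroup.mk' M x = 1 := (QuotientGroup.eq_one_iff (N := M) x).2 hx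
    rw [Subgroup.mem_comap, h]
    exact N.one_mem
  have hcard : M.relIndex (N.comap (QuotientGroup.mk' M)) = Nat.card N := by
    have h := Subgroup.relIndex_ker (N.comap (QuotientGroup.mk' M)) (QuotientGroup.mk' M)
    rwa [QuotientGroup.ker_mk',
      Subgroup.map_comap_eq_self_of_surjective (QuotientGroup.mk'_surjective M)] at h
  have hle := hmax (y := N.comap (QuotientGroup.mk' M)) ⟨inferInstance, hEM.trans hMN, by
    rw [← Subgroup.relIndex_mul_relIndex _ _ _ hEM hMN, hcard]
    exact fun h => ((Fact.out : p.Prime).dvd_mul.1 h).elim hidx hpN⟩ hMN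
  rw [Subgroup.eq_bot_iff_forall]
  intro x hx
  obtain ⟨g, rfl⟩ := QuotientGroup.mk'_surjective M x
  exact (QuotientGroup.eq_one_iff g).2 (hle hx)

/-- Cancelling the powers of `p` and the common factor `l` leaves `i * e = j * f`, so `j² ≤ i²e² ≤
i²j < j²`. -/
theorem false_of_degree_equation [Fact p.Prime] {i j a b e f l : ℕ} (hi : ¬ p ∣ i) (hj : ¬ p ∣ j)
    (he : ¬ p ∣ e * l) (hf : ¬ p ∣ f * l) (h : i * p ^ b * (e * l) = j * p ^ a * (f * l))
    (hej : e ^ 2 ≤ j) (hij : i ^ 2 < j) : False := by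
  have hp : p.Prime := Fact.out
  have h1 : p ^ b * (i * (e * l)) = p ^ a * (j * (f * l)) := by linarith
  have hx : ¬ p ∣ i * (e * l) := fun h => (hp.dvd_mul.1 h).elim hi he
  have hy : ¬ p ∣ j * (f * l) := fun h => (hp.dvd_mul.1 h).elim hj hf
  have hba : p ^ b ∣ p ^ a :=
    (coprime_pow_of_not_dvd hy).dvd_of_dvd_mul_right (Dvd.intro _ h1)
  have hab : p ^ a ∣ p ^ b :=
    (coprime_pow_of_not_dvd hx).dvd_of_dvd_mul_right (Dvd.intro _ h1.symm)
  rw [Nat.dvd_antisymm hba hab] at h1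
  have h2 := Nat.eq_of_mul_eq_mul_left (pow_pos hp.pos a) h1
  have hl : 0 < l := Nat.pos_of_ne_zero fun h => he (by simp [h])
  have hf0 : 0 < f := Nat.pos_of_ne_zero fun h => hf (by simp [h])
  have h3 : i * e = j * f := by
    refine Nat.eq_of_mul_eq_mul_right hl ?_
    rw [mul_assoc, mul_assoc, h2]
  have h4 : j ^ 2 ≤ i ^ 2 * j := by
    calc j ^ 2 ≤ (j * f) ^ 2 := Nat.pow_le_pow_left (Nat.le_mul_of_pos_right j hf0) 2
      _ = i ^ 2 * e ^ 2 := by rw [← h3, mul_pow]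
      _ ≤ i ^ 2 * j := Nat.mul_le_mul_left _ hej
  nlinarith

end

end

/-! ### The inductive step: comparing the degrees over two extensions -/

noncomputable section

section

variable {G : Type u} [Group G] {p : ℕ}

/-- The restriction of `π` to the preimage of `S`. -/
def preimageInHom {A : Subgroup G} {Γ : Type*} [Group Γ] (π : A →* Γ) (S : Subgroup Γ) :
    preimageIn π S →* S :=
  (π.comp (Subgroup.inclusion preimageIn_le)).codRestrict S fun g => (mem_preimageIn.1 g.2).2

/-- Since `lam` is invariant and coprime, an element fixes `lam · β` exactly when its image in `Γ`
fixes `β`. -/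
theorem mem_stabilizerIn_twist_linChar [Finite G] [Fact p.Prime] {A : Subgroup G} {Γ : Type*}
    [Group Γ] {π : A →* Γ} (hπ : Function.Surjective π) {E : Subgroup Γ} [hE : E.Normal]
    (hexp : ∀ x ∈ E, x ^ p = 1) {lam θ : G → ℂ} (hlam : CoprimeIrrOn p (preimageIn π E) lam)
    (hinv : InvariantUnder A (preimageIn π E) lam) (β : E →* ℂˣ)
    (hθ : ∀ x : preimageIn π E, θ x = β (preimageInHom π E x) * lam x) :
    stabilizerIn A (preimageIn π E) (normalizes_preimageIn_of_normal hE) θ =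
      preimageIn π (linCharStabilizer E β) := by
  have hβ : ∀ x : preimageIn π E, (β.comp (preimageInHom π E)) x ^ p = 1 := fun x => by
    rw [← map_pow, MonoidHom.comp_apply, map_pow,
      show (preimageInHom π E x) ^ p = 1 from Subtype.ext (hexp _ (preimageInHom π E x).2), map_one]
  ext g
  rw [mem_preimageIn]
  by_cases hg : g ∈ A
  · rw [mem_stabilizerIn_twist _ hlam hinv (β.comp (preimageInHom π E)) hβ hθ hg]
    have key : ∀ x : preimageIn π E, preimageInHom π E
        ⟨g * x * g⁻¹, normalizes_preimageIn_of_normal hE g hg x x.2⟩ =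
        MulAut.conjNormal (π ⟨g, hg⟩) (preimageInHom π E x) := fun x => by
      refine Subtype.ext ?_
      rw [MulAut.conjNormal_apply]
      change π (⟨g, hg⟩ * ⟨x, preimageIn_le x.2⟩ * ⟨g, hg⟩⁻¹) = _
      rw [map_mul, map_mul, map_inv]
      rfl
    constructor
    · refine fun h => ⟨hg, fun e => ?_⟩
      obtain ⟨a, ha⟩ := hπ e
      have haE : (a : G) ∈ preimageIn π E := mem_preimageIn.2 ⟨a.2, by
        change π a ∈ E
        rw [ha]; exact e.2⟩
      have he : preimageInHom π E ⟨a, haE⟩ = e := Subtype.ext ha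
      have := h ⟨a, haE⟩
      rwa [MonoidHom.comp_apply, MonoidHom.comp_apply, key, he] at this
    · rintro ⟨_, h⟩ x
      rw [MonoidHom.comp_apply, MonoidHom.comp_apply, key]
      exact h _
  · exact ⟨fun h => (hg (stabilizerIn_le h)).elim, fun h => (hg h.1).elim⟩

variable [Finite G] [Fact p.Prime]

theorem not_dvd_relIndex_of_sylow_le {A S : Subgroup G} (P : Sylow p A)
    (hP : (P : Subgroup A).map A.subtype ≤ S) : ¬ p ∣ S.relIndex A := by
  intro h
  refine P.not_dvd_index (h.trans ?_)
  exact Subgroup.index_dvd_of_le fun x hx => hP ⟨x, hx, rfl⟩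

/-- If `M / E` is a nontrivial `p'`-group for the minimal normal subgroup `E`, then the degrees
cannot all be equal. -/
theorem DegreeTheoremBelow.not_subsingleton (hQ : LargeOrbitAffirmative.{u} p) {A : Subgroup G}
    {Γ : Type u} [Group Γ] [Finite Γ] (IH : DegreeTheoremBelow p G (Nat.card Γ)) {π : A →* Γ}
    (hπ : Function.Surjective π) (hsolv : IsPSolvable p Γ) (hcore : TrivialPPrimeCore p Γ)
    {E M : Subgroup Γ} [hE : E.Normal] [hM : M.Normal] (hEM : E ≤ M) (hME : ¬ M ≤ E)
    {k : ℕ} (hk : Nat.card E = p ^ k) (habel : ∀ x ∈ E, ∀ y ∈ E, x * y = y * x)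
    (hexp : ∀ x ∈ E, x ^ p = 1) (hmin : ∀ N : Subgroup Γ, N.Normal → N ≤ E → N = ⊥ ∨ N = E)
    (hidx : ¬ p ∣ E.relIndex M) (hcoreM : TrivialPPrimeCore p (Γ ⧸ M)) {lam : G → ℂ}
    (hlam : CoprimeIrrOn p (preimageIn π E) lam) (hinv : InvariantUnder A (preimageIn π E) lam)
    {D : Set ℕ} (hD : D.Subsingleton)
    (hDE : ∀ (β : E →* ℂˣ) (θ : G → ℂ), IrrOn (preimageIn π E) θ →
      (∀ x : preimageIn π E, θ x = β (preimageInHom π E x) * lam x) →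
      coprimeDegrees p A (preimageIn π E) θ ⊆ D) : False := by
  have hp : p.Prime := Fact.out
  let P : Sylow p A := default
  obtain ⟨β, hPβ, hβ⟩ := hQ.exists_linChar hEM habel hexp hidx hME
    (fun m hm h => hcore.mem_of_commute hE hM hEM habel hk hidx hm h) (P.mapSurjective hπ)
  obtain ⟨Y, hY, hdec⟩ := hcore.exists_complement hE hM hEM habel hk hidx hME hmin
  set T := linCharStabilizer E β
  have hET : E ≤ T := le_linCharStabilizer E β
  obtain ⟨γ, hγ⟩ := exists_extension_of_complement hE hY hdec hET β fun t ht e => ht e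
  have hEI : E ≤ T ⊓ M := le_inf hET hEM
  -- the preimages
  have hnE : Normalizes A (preimageIn π E) := normalizes_preimageIn_of_normal hE
  have hnM : Normalizes A (preimageIn π M) := normalizes_preimageIn_of_normal hM
  have hnI : Normalizes (preimageIn π T) (preimageIn π (T ⊓ M)) :=
    normalizes_preimageIn fun b hb x hx =>
      ⟨T.mul_mem (T.mul_mem hb hx.1) (T.inv_mem hb), hM.conj_mem x hx.2 b⟩
  have hTA : preimageIn π T ≤ A := preimageIn_le
  have hEM' : preimageIn π E ≤ preimageIn π M := preimageIn_mono hEM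
  have hEI' : preimageIn π E ≤ preimageIn π (T ⊓ M) := preimageIn_mono hEI
  have hET' : preimageIn π E ≤ preimageIn π T := preimageIn_mono hET
  have hIT' : preimageIn π (T ⊓ M) ≤ preimageIn π T := preimageIn_mono inf_le_left
  have hidxM : ¬ p ∣ (preimageIn π E).relIndex (preimageIn π M) := by
    rwa [relIndex_preimageIn hπ]
  have hidxI : ¬ p ∣ E.relIndex (T ⊓ M) := fun h =>
    hidx (h.trans (Subgroup.relIndex_dvd_relIndex_of_normal inf_le_right))
  have hidxI' : ¬ p ∣ (preimageIn π E).relIndex (preimageIn π (T ⊓ M)) := by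
    rwa [relIndex_preimageIn hπ]
  -- the Sylow subgroup
  set Q := (P : Subgroup A).map A.subtype with hQdef
  have hQp : IsPGroup p Q := P.2.map _
  have hQA : Q ≤ A := Subgroup.map_subtype_le _
  have hQT : Q ≤ preimageIn π T := by
    rintro _ ⟨a, ha, rfl⟩
    exact mem_preimageIn.2 ⟨a.2, hPβ ⟨a, ha, rfl⟩⟩
  obtain ⟨l, -, hl, hpl⟩ := hlam.exists_degree
  -- the twisted character
  let μ : preimageIn π T →* ℂˣ := γ.comp (preimageInHom π T)
  let θ : G → ℂ := extendZero (preimageIn π E) fun x => β (preimageInHom π E x) * lam x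
  have hθ : ∀ x : preimageIn π E, θ x = β (preimageInHom π E x) * lam x := extendZero_coe _ _
  have hθirr : IrrOn (preimageIn π E) θ := irrOn_twist hlam.irrOn (β.comp (preimageInHom π E)) hθ
  have hθμ : ∀ x : preimageIn π E, θ x = μ ⟨x, hET' x.2⟩ * lam x := fun x => by
    rw [hθ, ← hγ]
    rfl
  have hstab := mem_stabilizerIn_twist_linChar hπ hexp hlam hinv β hθ
  -- A character of `T` over `lam` is twisted to one over `θ`; since `T` is the stabilizer of `θ`,
  -- Clifford's correspondence multiplies its degree by `|A:T|`. The index is prime to `p` because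
  -- `T` contains a Sylow `p`-subgroup.
  have hDT : ∀ n ∈ coprimeDegrees p (preimageIn π T) (preimageIn π E) lam,
      (preimageIn π T).relIndex A * n ∈ D := by
    intro n hn
    have h1 := coprimeDegrees_subset_of_twist hET' μ hθμ hn
    have h2 := mul_mem_coprimeDegrees (p := p) (n := n) (preimageIn_le) hnE hθirr
    rw [hstab] at h2
    exact hDE β θ hθirr hθ (h2 (not_dvd_relIndex_of_sylow_le P hQT) h1)
  have hDA : coprimeDegrees p A (preimageIn π E) lam ⊆ D :=
    hDE 1 lam hlam.irrOn fun x => by simp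
  -- invariant characters over `lam`
  obtain ⟨φ, hφ, hφP, hφlam, m, hm, hpm⟩ := exists_irrOn_invariant_over hQp (hnM.mono hQA)
    (hnE.mono hQA) hEM' hlam.irrOn (hinv.mono hQA) hl hpl hidxM
  obtain ⟨η, hη, hηP, hηlam, n, hn, hpn⟩ := exists_irrOn_invariant_over hQp (hnI.mono hQT)
    (hnE.mono hQA) hEI' hlam.irrOn (hinv.mono hQA) hl hpl hidxI'
  have hφc : CoprimeIrrOn p (preimageIn π M) φ := .of_over hEM' (hnE.mono preimageIn_le) hidxM hlam
    (hinv.mono preimageIn_le) hφ hφlam ⟨m, hm, hpm⟩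
  have hηc : CoprimeIrrOn p (preimageIn π (T ⊓ M)) η := .of_over hEI' (hnE.mono preimageIn_le)
    hidxI' hlam (hinv.mono preimageIn_le) hη hηlam ⟨n, hn, hpn⟩
  set U := stabilizerIn A (preimageIn π M) hnM φ with hU
  set S := stabilizerIn (preimageIn π T) (preimageIn π (T ⊓ M)) hnI η with hS
  have hUA : U ≤ A := stabilizerIn_le
  have hST : S ≤ preimageIn π T := stabilizerIn_le
  have hMU : preimageIn π M ≤ U := le_stabilizerIn preimageIn_le hφ
  have hIS : preimageIn π (T ⊓ M) ≤ S := le_stabilizerIn hIT' hη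
  have hQU : Q ≤ U := fun x hx => ⟨hQA hx, hφP x hx⟩
  have hQS : Q ≤ S := fun x hx => ⟨hQT hx, hηP x hx⟩
  have hpU : ¬ p ∣ U.relIndex A := not_dvd_relIndex_of_sylow_le P hQU
  have hpSA : ¬ p ∣ S.relIndex A := not_dvd_relIndex_of_sylow_le P hQS
  have hrel : S.relIndex (preimageIn π T) * (preimageIn π T).relIndex A = S.relIndex A :=
    Subgroup.relIndex_mul_relIndex _ _ _ hST hTA
  have hpS : ¬ p ∣ S.relIndex (preimageIn π T) := fun h => hpSA (hrel ▸ h.mul_right _)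
  have hDU : ∀ x ∈ coprimeDegrees p U (preimageIn π M) φ, U.relIndex A * x ∈ D := fun x hx =>
    hDA (coprimeDegrees_subset_of_over hEM' preimageIn_le hlam.irrOn hφ hφlam
      (mul_mem_coprimeDegrees preimageIn_le hnM hφ hpU hx))
  have hDS : ∀ x ∈ coprimeDegrees p S (preimageIn π (T ⊓ M)) η, S.relIndex A * x ∈ D :=
    fun x hx => by
      rw [← hrel, mul_comm (S.relIndex _), mul_assoc]
      exact hDT _ (coprimeDegrees_subset_of_over hEI' hIT' hlam.irrOn hη hηlam
        (mul_mem_coprimeDegrees hIT' hnI hη hpS hx))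
  have hsub : ∀ {V : Subgroup G} {C : Set ℕ}, (∀ x ∈ C, V.relIndex A * x ∈ D) →
      C.Subsingleton := fun {V} {C} h x hx y hy =>
    Nat.eq_of_mul_eq_mul_left (Nat.pos_of_ne_zero Subgroup.index_ne_zero_of_finite)
      (hD (h x hx) (h y hy))
  have hM0 : M ≠ ⊥ := fun h => hME (h ▸ bot_le)
  obtain ⟨a, ha⟩ := IH.exists_relIndex_eq_pow hπ hsolv hM0 hcoreM P hUA hQU hMU
    (fun u hu => by rw [mem_preimageIn]; exact ⟨fun h => h.2, fun h => ⟨_, h⟩⟩) hφc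
    stabilizerIn_invariant (hsub hDU)
  obtain ⟨b, hb⟩ := IH.exists_relIndex_eq_pow hπ hsolv hM0 hcoreM P (hST.trans hTA) hQS hIS
    (fun u hu => by
      rw [mem_preimageIn]
      exact ⟨fun h => h.2.2, fun h => ⟨_, (mem_preimageIn.1 (hST hu)).2, h⟩⟩) hηc
    stabilizerIn_invariant (hsub hDS)
  obtain ⟨f₁, hf₁, hf₁φ⟩ := hφc.exists_extension hMU (hnM.mono hUA) ha stabilizerIn_invariant
  obtain ⟨f₂, hf₂, hf₂η⟩ := hηc.exists_extension hIS (hnI.mono hST) hb stabilizerIn_invariant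
  -- Extensions of `φ` to `U` and of `η` to `S` have degrees `m` and `n`, and both products are
  -- degrees in `D`, which has at most one element.
  have heq : U.relIndex A * m = S.relIndex A * n :=
    hD (hDU _ (degree_mem_coprimeDegrees hf₁ hφ hf₁φ hm))
      (hDS _ (degree_mem_coprimeDegrees hf₂ hη hf₂η hn))
  -- ramification
  obtain ⟨e, -, -, he⟩ := hlam.irrOn.eq_natCast_mul hEM' (hnE.mono preimageIn_le)
    (hinv.mono preimageIn_le) hφ hφlam
  obtain ⟨f, -, -, hf⟩ := hlam.irrOn.eq_natCast_mul hEI' (hnE.mono preimageIn_le)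
    (hinv.mono preimageIn_le) hη hηlam
  have hme : m = e * l := by
    have := he 1 (one_mem _)
    rw [hm, hl] at this
    exact_mod_cast this
  have hnf : n = f * l := by
    have := hf 1 (one_mem _)
    rw [hn, hl] at this
    exact_mod_cast this
  have hsq := hlam.irrOn.sq_mul_card_le hEM' hφ he
  have c1 := Subgroup.card_mul_relIndex_of_le hEM'
  have c2 := Subgroup.card_mul_relIndex_of_le hEI'
  have c3 := Subgroup.card_mul_relIndex_of_le hMU
  have c4 := Subgroup.card_mul_relIndex_of_le hIS
  have c5 := Subgroup.card_mul_relIndex_of_le hUA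
  have c6 := Subgroup.card_mul_relIndex_of_le (hST.trans hTA)
  rw [relIndex_preimageIn hπ] at c1 c2
  rw [ha, ← c1] at c3
  rw [hb, ← c2] at c4
  rw [← c3] at c5
  rw [← c4] at c6
  rw [← c1] at hsq
  have d1 := Subgroup.card_mul_relIndex_of_le hEM
  have d2 := Subgroup.card_mul_relIndex_of_le hEI
  rw [← d1, ← d2] at hβ
  have hc : 0 < Nat.card (preimageIn π E) := Nat.card_pos
  have hA : 0 < Nat.card A := Nat.card_pos
  have hEc : 0 < Nat.card E := Nat.card_pos
  refine false_of_degree_equation (p := p) (a := a) (b := b) (e := e) (f := f) (l := l)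
    hidxI hidx (hme ▸ hpm) (hnf ▸ hpn) ?_ ?_ ?_
  · rw [← hme, ← hnf]
    generalize Nat.card (preimageIn π E) = c at *
    generalize E.relIndex (T ⊓ M) = i at *
    generalize E.relIndex M = j at *
    generalize U.relIndex A = x at *
    generalize S.relIndex A = y at *
    have hx : 0 < x := Nat.pos_of_ne_zero fun h => by simp [h] at c5; omega
    -- Multiplying by `c|A|` allows `|A|` to be rewritten as `|U||A:U|` on one side and as
    -- `|S||A:S|` on the other.
    have hcA : 0 < c * Nat.card A := Nat.mul_pos hc hA
    refine Nat.eq_of_mul_eq_mul_left hcA ?_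
    calc c * Nat.card A * (i * p ^ b * m)
        = c * i * p ^ b * (c * j * p ^ a) * (x * m) := by rw [← c5]; ring
      _ = c * j * p ^ a * (c * i * p ^ b * y) * n := by rw [heq]; ring
      _ = c * Nat.card A * (j * p ^ a * n) := by rw [c6]; ring
  · refine Nat.le_of_mul_le_mul_left ?_ hc
    rwa [mul_comm (Nat.card _) (e ^ 2)]
  · refine Nat.lt_of_mul_lt_mul_left (a := Nat.card E * Nat.card E) ?_
    calc _ = (Nat.card E * E.relIndex (T ⊓ M)) ^ 2 := by ring
      _ < _ := hβ
      _ = _ := by ring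

/-- The inductive step. The coprime extension of `lam` to a minimal normal subgroup replaces `lam`,
and the cases `M = E` and `M > E` are settled by the induction hypothesis and by `not_subsingleton`
respectively. -/
theorem DegreeTheoremBelow.isPGroup (hQ : LargeOrbitAffirmative.{u} p) {A Z : Subgroup G}
    {Γ : Type u} [Group Γ] [Finite Γ] (IH : DegreeTheoremBelow p G (Nat.card Γ)) {π : A →* Γ}
    {lam : G → ℂ} (hπ : Function.Surjective π) (hker : ∀ a, π a = 1 ↔ (a : G) ∈ Z) (hZA : Z ≤ A)
    (hlam : CoprimeIrrOn p Z lam) (hinv : InvariantUnder A Z lam) (hsolv : IsPSolvable p Γ)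
    (hcore : TrivialPPrimeCore p Γ) (hdeg : (coprimeDegrees p A Z lam).Subsingleton) :
    IsPGroup p Γ := by
  cases subsingleton_or_nontrivial Γ
  · exact IsPGroup.iff_card.2 ⟨0, by rw [pow_zero, Nat.card_unique]⟩
  obtain ⟨E, hE, hE0, ⟨k, hk⟩, habel, hexp, hmin⟩ := hsolv.exists_minimal_normal hcore
  have hZ : Z = preimageIn π ⊥ := by
    ext g
    rw [mem_preimageIn]
    exact ⟨fun h => ⟨hZA h, (hker ⟨g, hZA h⟩).2 h⟩, fun ⟨h, h'⟩ => (hker ⟨g, h⟩).1 h'⟩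
  have hZE : Z ≤ preimageIn π E := hZ ▸ preimageIn_mono bot_le
  have hnZ : Normalizes A Z := hZ ▸ normalizes_preimageIn_of_normal inferInstance
  have hnE : Normalizes A (preimageIn π E) := normalizes_preimageIn_of_normal hE
  have hidxZ : Z.relIndex (preimageIn π E) = p ^ k := by
    rw [hZ, relIndex_preimageIn hπ, Subgroup.relIndex_bot_left, hk]
  obtain ⟨lam', hlam', heq⟩ := hlam.exists_extension hZE (hnZ.mono preimageIn_le) hidxZ
    (hinv.mono preimageIn_le)
  have hinv' : InvariantUnder A (preimageIn π E) lam' :=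
    hlam'.invariantUnder_of_eq_on hZE preimageIn_le hnE hnZ hidxZ
      (hlam.irrOn.congr fun x hx => (heq x hx).symm) fun a ha x hx => by
        rw [heq _ (hnZ a ha x hx), heq x hx, hinv a ha x hx]
  -- Linear characters of `E ≤ Γ` are trivial on `Z`, so every twist of `lam'` still restricts to
  -- `lam` and all the characters above it count towards the same set of degrees.
  have hDE : ∀ (β : E →* ℂˣ) (θ : G → ℂ), IrrOn (preimageIn π E) θ →
      (∀ x : preimageIn π E, θ x = β (preimageInHom π E x) * lam' x) →
      coprimeDegrees p A (preimageIn π E) θ ⊆ coprimeDegrees p A Z lam := by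
    intro β θ hθ h
    refine coprimeDegrees_subset_of_over hZE preimageIn_le hlam.irrOn hθ ?_
    rw [multOn_congr (f' := lam) (k' := lam) (fun x hx => ?_) (fun _ _ => rfl),
      multOn_self hlam.irrOn]
    · exact one_ne_zero
    · have h1 : preimageInHom π E ⟨x, hZE hx⟩ = 1 := Subtype.ext ((hker ⟨x, hZA hx⟩).2 hx)
      have h2 := h ⟨x, hZE hx⟩
      rw [h1, map_one, Units.val_one, one_mul] at h2
      exact h2.trans (heq x hx)
  obtain ⟨M, hM, hEM, hidx, hcoreM⟩ := exists_maximal_normal_coprime_relIndex (p := p) E hE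
  by_cases hME : M ≤ E
  · obtain rfl := le_antisymm hEM hME
    obtain ⟨a, ha⟩ := IH.exists_relIndex_eq_pow hπ hsolv hE0 hcoreM default le_rfl
      (Subgroup.map_subtype_le _) preimageIn_le
      (fun u hu => by rw [mem_preimageIn]; exact ⟨fun h => h.2, fun h => ⟨_, h⟩⟩) hlam' hinv'
      (hdeg.anti (hDE 1 lam' hlam'.irrOn fun x => by simp))
    have h1 := relIndex_preimageIn hπ E ⊤
    rw [preimageIn_top, ha, Subgroup.relIndex_top_right] at h1
    exact IsPGroup.iff_card.2 ⟨k + a, by rw [pow_add, ← hk, h1, Subgroup.card_mul_index]⟩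
  · exact (IH.not_subsingleton hQ hπ hsolv hcore hEM hME hk habel hexp hmin hidx hcoreM hlam' hinv'
      hdeg hDE).elim

theorem degreeTheoremBelow (hQ : LargeOrbitAffirmative.{u} p) (n : ℕ) :
    DegreeTheoremBelow p G n := by
  induction n with
  | zero => exact fun _ _ _ _ _ _ _ h => (Nat.not_lt_zero _ h).elim
  | succ n ih =>
    intro A Z Γ _ _ π lam hn hπ hker hZA hlam hinv hsolv hcore hdeg
    have : DegreeTheoremBelow p G (Nat.card Γ) :=
      fun A' Z' Γ' _ _ π' lam' h => ih A' Z' Γ' π' lam' (lt_of_lt_of_le h (Nat.le_of_lt_succ hn))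
    exact this.isPGroup hQ hπ hker hZA hlam hinv hsolv hcore hdeg

end

end

/-! ### Passage from determinantal orders and `pPrimeCore` to the inductive statement -/

noncomputable section

theorem isCoprimeIrr_of_not_dvd_detOrder {H : Type*} [Group H] [Finite H] {p : ℕ} {χ : H → ℂ}
    (hχ : χ ∈ Irr H) (h : ∃ n : ℕ, χ 1 = n ∧ ¬ p ∣ detOrder χ * n) : IsCoprimeIrr p χ := by
  obtain ⟨n, ρ, hρ⟩ := hχ
  obtain ⟨m, hm, hp⟩ := h
  have hnm : n = m := by
    have := hρ.apply_one
    rw [hm] at this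
    exact_mod_cast this.symm
  subst hnm
  refine ⟨n, ρ, hρ, fun h => hp (h.mul_left _), detOrder χ, fun h => hp (h.mul_right _),
    fun x => ?_⟩
  rw [detOrder_eq hρ]
  exact DFunLike.congr_fun (pow_orderOf_eq_one (detChar ρ)) x

theorem trivialPPrimeCore_of_pPrimeCore_eq_bot {Γ : Type*} [Group Γ] {p : ℕ}
    (h : pPrimeCore p Γ = ⊥) : TrivialPPrimeCore p Γ := fun N hN hp =>
  le_bot_iff.1 (h ▸ le_sSup (show N ∈ {N : Subgroup Γ | N.Normal ∧ ¬ p ∣ Nat.card N} from ⟨hN, hp⟩))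

end

theorem mainTheorem11 {G : Type u} [Group G] [Finite G] (p : ℕ) [Fact p.Prime]
    (hQ : LargeOrbitAffirmative.{u} p)
    (Z : Subgroup G) [Z.Normal] (lam : Z → ℂ) (hlam : lam ∈ Irr Z)
    (hinv : ∀ (g : G) (z : Z), lam (MulAut.conjNormal g z) = lam z)
    (hp' : ∃ n : ℕ, lam 1 = n ∧ ¬ p ∣ detOrder lam * n)
    (hsolv : IsPSolvable p (G ⧸ Z))
    (hcore : pPrimeCore p (G ⧸ Z) = ⊥)
    (hdeg : ∃ d : ℤ, ∀ χ ∈ IrrOver Z lam, (∃ n : ℕ, χ 1 = n ∧ ¬ p ∣ n) → χ 1 = d) :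
    IsPGroup p (G ⧸ Z) := by
  obtain ⟨d, hd⟩ := hdeg
  have hval : ∀ z : Z, extendZero Z lam z = lam z := extendZero_coe Z lam
  -- The bound is `|G/Z| + 1` because the inductive statement concerns quotients of strictly smaller
  -- order.
  refine degreeTheoremBelow (G := G) hQ (Nat.card (G ⧸ Z) + 1) ⊤ Z (G ⧸ Z)
    ((QuotientGroup.mk' Z).comp (⊤ : Subgroup G).subtype) (extendZero Z lam) (Nat.lt_succ_self _)
    (fun x => ?_) (fun a => QuotientGroup.eq_one_iff (a : G)) le_top ?_ (fun g _ z hz => ?_) hsolv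
    (trivialPPrimeCore_of_pPrimeCore_eq_bot hcore) ?_
  · obtain ⟨g, rfl⟩ := QuotientGroup.mk'_surjective Z x
    exact ⟨⟨g, Subgroup.mem_top g⟩, rfl⟩
  · rw [CoprimeIrrOn, extendZero_comp]
    exact isCoprimeIrr_of_not_dvd_detOrder hlam hp'
  · have h := hinv g ⟨z, hz⟩
    rw [← hval, ← hval] at h
    exact h
  · have key : ∀ n ∈ coprimeDegrees p ⊤ Z (extendZero Z lam), (n : ℂ) = d := by
      rintro n ⟨hpn, χ, hχ, hover, hn⟩
      rw [multOn, extendZero_comp] at hover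
      have hχG : χ ∈ Irr G := Irr.comp_equiv (Subgroup.topEquiv (G := G)).symm hχ
      rw [← hn]
      exact hd χ ⟨hχG, hover⟩ ⟨n, hn, hpn⟩
    intro m hm n hn
    exact_mod_cast (key m hm).trans (key n hn).symm
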